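/- Consider the class of variable-coefficient Gardner equations $$u_t+k(t)uu_x+f(t)u^2u_x+g(t)u_{xxx}=0,\qquad (*)$$ where $k,f,g$ are smooth real functions on a nonempty open interval $I\subseteq\mathbb R$ with $f(t)g(t)\neq0$ for all $t\in I$. A Lie symmetry operator of $(*)$ is a smooth vector field $Q=\tau\partial_t+\xi\partial_x+\eta\partial_u$, with $\tau,\xi,\eta$ functions of $(t,x,u)\in I\times\mathbb R^2$, whose third prolongation applied to the left-hand side of $(*)$ vanishes at all jets satisfying $(*)$. The maximal Lie invariance algebra $A^{\max}$ of $(*)$ is the set of all its Lie symmetry operators. The generalized extended equivalence group $\hat G^\sim$ of the class consists of the transformations $$\tilde t=\alpha(t),\quad \tilde x=\delta_1x+\frac{\delta_1\delta_3}{\delta_2^2}\int(\delta_2k-\delta_3f)\,dt+\delta_4,\quad \tilde u=\delta_2u+\delta_3,$$ $$\tilde k(\tilde t)=\frac{\delta_1}{\delta_2\alpha_t}\Bigl(k-2\frac{\delta_3}{\delta_2}f\Bigr),\quad \tilde f(\tilde t)=\frac{\delta_1}{\delta_2^2\alpha_t}f,\quad \tilde g(\tilde t)=\frac{\delta_1^3}{\alpha_t}g,$$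 where $\delta_1,\dots,\delta_4$ are constants with $\delta_1\delta_2\ne0$ and $\alpha$ is a smooth function on $I$ with $\alpha_t\neq0$; the transformed equation is considered on the interval $\alpha(I)$. The usual equivalence group $G^\sim$ consists of those transformations with $\delta_3=0$. **Theorem.** For every nonempty open interval $I$, the kernel (intersection) of the maximal Lie invariance algebras of all equations $(*)$ on $I$ is $\langle\partial_x\rangle$. Every equation $(*)$ whose algebra $A^{\max}$ is strictly larger than $\langle\partial_x\rangle$ is $G^\sim$-equivalent (resp. $\hat G^\sim$-equivalent) to an equation from Cases I–IV of Table 1 (resp. Table 2) below. Conversely, for every equation in these cases, considered on any nonempty open interval contained in the stated range of $t$, the listed operators form a basis of $A^{\max}$, which is strictly larger than $\langle\partial_x\rangle$. Equations from differently numbered cases of Table 1 (resp. Table 2) are not $G^\sim$-equivalent (resp. not $\hat G^\sim$-equivalent). In both tables $g=1$; $\lambda_1,\lambda_2,\rho$ are real constants with $\lambda_1\ne0$; $\delta\in\{0,1\}$; $\varepsilon=\pm1$. In Cases I.1–I.4 the range is $t>0$, in Cases II–IV it is $t\in\mathbb R$. *Table 1* ($\varkappa=\frac{\delta}{2\lambda_1}$,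 with $\lambda_1=\varepsilon$ in Case IV): - I.1. $f=\lambda_1t^\rho$, $k=\lambda_2t^{\frac{3\rho-2}6}+\delta t^\rho$, where $\rho\ne-\frac43,-1$ and $(\rho,\lambda_2)\ne(0,0)$: $\ \partial_x$, $\ 3t\partial_t+\Bigl(x-\varkappa\frac{3\rho+2}2\bigl(\frac{6\lambda_2}{3\rho+4}t^{\frac{3\rho+4}6}+\frac{\delta}{\rho+1}t^{\rho+1}\bigr)\Bigr)\partial_x-\frac{3\rho+2}2(u+\varkappa)\partial_u$; - I.2. $f=\lambda_1t^{-\frac23}$, $k=t^{-\frac23}\ln|t|$: $\ \partial_x$, $\ 2\lambda_1t\partial_t+\bigl(\frac23\lambda_1x-3(\ln|t|-3)t^{\frac13}\bigr)\partial_x-\partial_u$; - I.3. $f=\lambda_1t^{-1}$, $k=\lambda_2t^{-\frac56}+\delta t^{-1}$: $\ \partial_x$, $\ 3t\partial_t+\bigl(x+\varkappa(3\lambda_2t^{\frac16}+\frac12\delta\ln|t|)\bigr)\partial_x+\frac12(u+\varkappa)\partial_u$; - I.4. $f=\lambda_1t^{-\frac43}$, $k=\lambda_2t^{-1}+\delta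 t^{-\frac43}$: $\ \partial_x$, $\ 3t\partial_t+\bigl(x+\varkappa(\lambda_2\ln|t|-3\delta t^{-\frac13})\bigr)\partial_x+(u+\varkappa)\partial_u$; - II. $f=\lambda_1e^t$, $k=\lambda_2e^{\frac t2}+\delta e^t$: $\ \partial_x$, $\ 2\partial_t-\varkappa(2\lambda_2e^{\frac t2}+\delta e^t)\partial_x-(u+\varkappa)\partial_u$; - III. $f=\lambda_1$, $k=t$: $\ \partial_x$, $\ 2\lambda_1\partial_t-\frac12t^2\partial_x-\partial_u$; - IV. $f=\varepsilon$, $k=\delta$: $\ \partial_x$, $\ \partial_t$, $\ 3t\partial_t+(x-\varkappa\delta t)\partial_x-(u+\varkappa)\partial_u$. *Table 2*: - I.1. $f=\lambda_1t^\rho$, $k=\delta t^{\frac{3\rho-2}6}$, where $(\rho,\delta)\ne(0,0)$: $\ \partial_x$, $\ 3t\partial_t+x\partial_x-\frac{3\rho+2}2u\partial_u$; - I.2. as Case I.2 of Table 1; - II. $f=\lambda_1e^t$, $k=\delta e^{\frac t2}$: $\ \partial_x$, $\ 2\partial_t-u\partial_u$; - III. as Case III of Table 1; - IV. $f=\varepsilon$,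 $k=0$: $\ \partial_x$, $\ \partial_t$, $\ 3t\partial_t+x\partial_x-u\partial_u$. -/

import Mathlib

open scoped ContDiff

noncomputable section

namespace Gardner

/-- Points `(t, x, u)`, and also vectors `(τ, ξ, η)` standing for `τ ∂_t + ξ ∂_x + η ∂_u`. -/
abbrev Pt : Type := ℝ × ℝ × ℝ

/-- A (not yet regular) vector field `τ ∂_t + ξ ∂_x + η ∂_u` on the space of `(t, x, u)`. -/
abbrev VField : Type := Pt → Pt

/-- The field `τ(t,x,u) ∂_t + ξ(t,x,u) ∂_x + η(t,x,u) ∂_u`. -/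
def vfield (τ ξ η : ℝ → ℝ → ℝ → ℝ) : VField := fun p =>
  (τ p.1 p.2.1 p.2.2, ξ p.1 p.2.1 p.2.2, η p.1 p.2.1 p.2.2)

/-- The operator `∂_t`. -/
def dT : VField := vfield (fun _ _ _ => 1) (fun _ _ _ => 0) (fun _ _ _ => 0)

/-- The operator `∂_x`. -/
def dX : VField := vfield (fun _ _ _ => 0) (fun _ _ _ => 1) (fun _ _ _ => 0)

/-- Nonempty open intervals of the time axis, bounded or not. -/
structure IsOpenInterval (I : Set ℝ) : Prop where
  isOpen : IsOpen I
  ordConnected : I.OrdConnected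
  nonempty : I.Nonempty

/-- The set of all `(t, x, u)` with `t ∈ I`. -/
def dom (I : Set ℝ) : Set Pt := {p | p.1 ∈ I}

/-! ### Jets, total derivatives and prolongation -/

/-- Jets `(t, x, (u_{a,b}))` of functions `u(t, x)`: the coordinate `u_{a,b}` stands for
`∂_t^a ∂_x^b u`, so that `u_{0,0} = u`. -/
abbrev Jet : Type := ℝ × ℝ × (ℕ → ℕ → ℝ)

/-- The point `(t, x, u)` below a jet. -/
def Jet.base (j : Jet) : Pt := (j.1, j.2.1, j.2.2 0 0)

/-- The total derivative `D_t = ∂_t + ∑ u_{a+1,b} ∂_{u_{a,b}}`: the derivative along the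
vector `(1, 0, (u_{a+1,b}))`. -/
def totalDt (F : Jet → ℝ) (j : Jet) : ℝ :=
  lineDeriv ℝ F j (1, 0, fun a b => j.2.2 (a + 1) b)

/-- The total derivative `D_x = ∂_x + ∑ u_{a,b+1} ∂_{u_{a,b}}`: the derivative along the
vector `(0, 1, (u_{a,b+1}))`. -/
def totalDx (F : Jet → ℝ) (j : Jet) : ℝ :=
  lineDeriv ℝ F j (0, 1, fun a b => j.2.2 a (b + 1))

/-- The coefficients `η, η^x, η^{xx}, η^{xxx}, …` of the prolongation of `Q`:
`η^{x…xx} = D_x(η^{x…x}) - u_{tx…x} D_x(τ) - u_{xx…x} D_x(ξ)`. -/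
def prolongX (Q : VField) : ℕ → Jet → ℝ
  | 0 => fun j => (Q j.base).2.2
  | b + 1 => fun j =>
      totalDx (prolongX Q b) j
        - j.2.2 1 b * totalDx (fun i => (Q i.base).1) j
        - j.2.2 0 (b + 1) * totalDx (fun i => (Q i.base).2.1) j

/-- The coefficient of `∂_{u_{a,b}}` in the prolongation of `Q`. -/
def prolongCoeff (Q : VField) : ℕ → ℕ → Jet → ℝ
  | 0, b => prolongX Q b
  | a + 1, b => fun j =>
      totalDt (prolongCoeff Q a b) j
        - j.2.2 (a + 1) b * totalDt (fun i => (Q i.base).1) j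
        - j.2.2 a (b + 1) * totalDt (fun i => (Q i.base).2.1) j

/-- The prolongation of `Q`, as a vector field on the space of jets. Applied to a function of
the jet coordinates of order at most three it is the third prolongation. -/
def prolong (Q : VField) (j : Jet) : Jet :=
  ((Q j.base).1, (Q j.base).2.1, fun a b => prolongCoeff Q a b j)

/-! ### The class of equations and their Lie symmetries -/

/-- An equation `u_t + k(t) u u_x + f(t) u² u_x + g(t) u_xxx = 0` over the time interval `I`,
with smooth coefficients and `f g ≠ 0`. Values of the coefficients outside `I` are irrelevant. -/
structure GardnerEq (I : Set ℝ) where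
  k : ℝ → ℝ
  f : ℝ → ℝ
  g : ℝ → ℝ
  smooth_k : ContDiffOn ℝ ∞ k I
  smooth_f : ContDiffOn ℝ ∞ f I
  smooth_g : ContDiffOn ℝ ∞ g I
  fg_ne_zero : ∀ t ∈ I, f t * g t ≠ 0

/-- The left-hand side `u_t + k u u_x + f u² u_x + g u_xxx`, as a function of the jet. -/
def GardnerEq.lhs {I : Set ℝ} (E : GardnerEq I) (j : Jet) : ℝ :=
  j.2.2 1 0 + E.k j.1 * j.2.2 0 0 * j.2.2 0 1 + E.f j.1 * (j.2.2 0 0) ^ 2 * j.2.2 0 1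
    + E.g j.1 * j.2.2 0 3

/-- Infinitesimal invariance: `Q` is smooth over `I`, and its prolongation applied to the
left-hand side of the equation vanishes at all jets satisfying the equation. -/
def GardnerEq.IsLieSymmetry {I : Set ℝ} (E : GardnerEq I) (Q : VField) : Prop :=
  ContDiffOn ℝ ∞ Q (dom I) ∧
    ∀ j : Jet, j.1 ∈ I → E.lhs j = 0 → lineDeriv ℝ E.lhs j (prolong Q j) = 0

/-- The restriction of a vector field to the part of the space over `I`. -/
def restrictTo (I : Set ℝ) (Q : VField) : dom I → Pt := fun p => Q p

/-- The maximal Lie invariance algebra `A^max`: all Lie symmetry operators, as vector fields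
on the part of the space of `(t, x, u)` over `I`. -/
def GardnerEq.maxAlgebra {I : Set ℝ} (E : GardnerEq I) : Set (dom I → Pt) :=
  {q | ∃ Q : VField, E.IsLieSymmetry Q ∧ q = restrictTo I Q}

/-- The kernel of the maximal Lie invariance algebras over the interval `I`: the operators
that are admitted by every equation of the class. -/
def kernelAlgebra (I : Set ℝ) : Set (dom I → Pt) :=
  ⋂ E : GardnerEq I, E.maxAlgebra

/-- The equation admits an extension of the kernel algebra. -/
def GardnerEq.HasExtension {I : Set ℝ} (E : GardnerEq I) : Prop :=
  kernelAlgebra I ⊂ E.maxAlgebra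

/-! ### Equivalence transformations -/

/-- The parameters of an element of the generalized extended equivalence group, applied to the
equation `E`; `Γ` is the antiderivative `∫ (δ₂ k - δ₃ f) dt`. -/
structure EquivTransf {I : Set ℝ} (E : GardnerEq I) where
  α : ℝ → ℝ
  δ₁ : ℝ
  δ₂ : ℝ
  δ₃ : ℝ
  δ₄ : ℝ
  Γ : ℝ → ℝ
  smooth_α : ContDiffOn ℝ ∞ α I
  deriv_α_ne_zero : ∀ t ∈ I, deriv α t ≠ 0
  δ₁_ne_zero : δ₁ ≠ 0
  δ₂_ne_zero : δ₂ ≠ 0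
  hasDerivAt_Γ : ∀ t ∈ I, HasDerivAt Γ (δ₂ * E.k t - δ₃ * E.f t) t

/-- The action on the variables:
`t̃ = α(t)`, `x̃ = δ₁ x + (δ₁ δ₃ / δ₂²) ∫ (δ₂ k - δ₃ f) dt + δ₄`, `ũ = δ₂ u + δ₃`. -/
def EquivTransf.pointMap {I : Set ℝ} {E : GardnerEq I} (T : EquivTransf E) : Pt → Pt := fun p =>
  (T.α p.1, T.δ₁ * p.2.1 + T.δ₁ * T.δ₃ / T.δ₂ ^ 2 * T.Γ p.1 + T.δ₄, T.δ₂ * p.2.2 + T.δ₃)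

/-- The transformation takes the equation `E` over `I` to the equation `E'` over `I'`. -/
structure EquivTransf.Maps {I I' : Set ℝ} {E : GardnerEq I} (T : EquivTransf E)
    (E' : GardnerEq I') : Prop where
  bijOn : Set.BijOn T.pointMap (dom I) (dom I')
  map_k : ∀ t ∈ I, E'.k (T.α t) =
    T.δ₁ / (T.δ₂ * deriv T.α t) * (E.k t - 2 * (T.δ₃ / T.δ₂) * E.f t)
  map_f : ∀ t ∈ I, E'.f (T.α t) = T.δ₁ / (T.δ₂ ^ 2 * deriv T.α t) * E.f t
  map_g : ∀ t ∈ I, E'.g (T.α t) = T.δ₁ ^ 3 / deriv T.α t * E.g t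

/-- Equivalence with respect to the generalized extended equivalence group `Ĝ^∼`. -/
def GenExtEquivalent {I I' : Set ℝ} (E : GardnerEq I) (E' : GardnerEq I') : Prop :=
  ∃ T : EquivTransf E, T.Maps E'

/-- Equivalence with respect to the usual equivalence group `G^∼`, given by `δ₃ = 0`. -/
def UsualEquivalent {I I' : Set ℝ} (E : GardnerEq I) (E' : GardnerEq I') : Prop :=
  ∃ T : EquivTransf E, T.δ₃ = 0 ∧ T.Maps E'

/-! ### The tables -/

/-- One line of a table, for fixed values of its parameters: the range of `t`, the coefficients
`f` and `k` (with `g = 1`), and a basis of the maximal Lie invariance algebra. -/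
structure Row where
  timeDomain : Set ℝ
  f : ℝ → ℝ
  k : ℝ → ℝ
  n : ℕ
  basis : Fin n → VField

/-- `E` has `g = 1` and the coefficients `f`, `k` of the line `r`. -/
structure GardnerEq.IsOfForm {I : Set ℝ} (E : GardnerEq I) (r : Row) : Prop where
  subset : I ⊆ r.timeDomain
  g_eq : ∀ t ∈ I, E.g t = 1
  f_eq : ∀ t ∈ I, E.f t = r.f t
  k_eq : ∀ t ∈ I, E.k t = r.k t

/-- The operators `b` form a basis of the maximal Lie invariance algebra of `E`. -/
def GardnerEq.IsBasisOfMaxAlgebra {I : Set ℝ} (E : GardnerEq I) {n : ℕ} (b : Fin n → VField) :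
    Prop :=
  LinearIndependent ℝ (fun i => restrictTo I (b i)) ∧
    E.maxAlgebra = (Submodule.span ℝ (Set.range fun i => restrictTo I (b i)) :
      Submodule ℝ (dom I → Pt))

/-- The numbers of the cases of the first table. -/
inductive Case1 : Type
  | I1
  | I2
  | I3
  | I4
  | II
  | III
  | IV

/-- The numbers of the cases of the second table. -/
inductive Case2 : Type
  | I1
  | I2
  | II
  | III
  | IV

/-- The line I.2, common to both tables. -/
def rowI2 (l₁ : ℝ) : Row where
  timeDomain := Set.Ioi 0
  f := fun t => l₁ * t ^ (-(2 / 3) : ℝ)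
  k := fun t => t ^ (-(2 / 3) : ℝ) * Real.log |t|
  n := 2
  basis := ![dX, vfield (fun t _ _ => 2 * l₁ * t)
    (fun t x _ => 2 / 3 * l₁ * x - 3 * (Real.log |t| - 3) * t ^ (1 / 3 : ℝ))
    (fun _ _ _ => -1)]

/-- The line III, common to both tables. -/
def rowIII (l₁ : ℝ) : Row where
  timeDomain := Set.univ
  f := fun _ => l₁
  k := fun t => t
  n := 2
  basis := ![dX, vfield (fun _ _ _ => 2 * l₁) (fun t _ _ => -(1 / 2) * t ^ 2) (fun _ _ _ => -1)]

/-- The first table (classification up to `G^∼`). Parameters: `l₁ = λ₁`, `l₂ = λ₂`, `ρ`, `δ`, `ε`;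
`ϰ = δ / (2 λ₁)`, with `λ₁ = ε` in Case IV. -/
def table1 : Case1 → Set Row
  | .I1 => {r | ∃ l₁ l₂ ρ δ ϰ : ℝ, l₁ ≠ 0 ∧ ρ ≠ -(4 / 3) ∧ ρ ≠ -1 ∧ (δ = 0 ∨ δ = 1) ∧
      (ρ, l₂) ≠ (0, 0) ∧ ϰ = 1 / 2 * (δ / l₁) ∧
      r = { timeDomain := Set.Ioi 0
            f := fun t => l₁ * t ^ ρ
            k := fun t => l₂ * t ^ ((3 * ρ - 2) / 6) + δ * t ^ ρ
            n := 2
            basis := ![dX, vfield (fun t _ _ => 3 * t)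
              (fun t x _ => x - ϰ * ((3 * ρ + 2) / 2) *
                (6 * l₂ / (3 * ρ + 4) * t ^ ((3 * ρ + 4) / 6) + δ / (ρ + 1) * t ^ (ρ + 1)))
              (fun _ _ u => -((3 * ρ + 2) / 2) * (u + ϰ))] }}
  | .I2 => {r | ∃ l₁ : ℝ, l₁ ≠ 0 ∧ r = rowI2 l₁}
  | .I3 => {r | ∃ l₁ l₂ δ ϰ : ℝ, l₁ ≠ 0 ∧ (δ = 0 ∨ δ = 1) ∧ ϰ = 1 / 2 * (δ / l₁) ∧
      r = { timeDomain := Set.Ioi 0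
            f := fun t => l₁ * t ^ (-1 : ℝ)
            k := fun t => l₂ * t ^ (-(5 / 6) : ℝ) + δ * t ^ (-1 : ℝ)
            n := 2
            basis := ![dX, vfield (fun t _ _ => 3 * t)
              (fun t x _ => x + ϰ * (3 * l₂ * t ^ (1 / 6 : ℝ) + 1 / 2 * δ * Real.log |t|))
              (fun _ _ u => 1 / 2 * (u + ϰ))] }}
  | .I4 => {r | ∃ l₁ l₂ δ ϰ : ℝ, l₁ ≠ 0 ∧ (δ = 0 ∨ δ = 1) ∧ ϰ = 1 / 2 * (δ / l₁) ∧
      r = { timeDomain := Set.Ioi 0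
            f := fun t => l₁ * t ^ (-(4 / 3) : ℝ)
            k := fun t => l₂ * t ^ (-1 : ℝ) + δ * t ^ (-(4 / 3) : ℝ)
            n := 2
            basis := ![dX, vfield (fun t _ _ => 3 * t)
              (fun t x _ => x + ϰ * (l₂ * Real.log |t| - 3 * δ * t ^ (-(1 / 3) : ℝ)))
              (fun _ _ u => u + ϰ)] }}
  | .II => {r | ∃ l₁ l₂ δ ϰ : ℝ, l₁ ≠ 0 ∧ (δ = 0 ∨ δ = 1) ∧ ϰ = 1 / 2 * (δ / l₁) ∧
      r = { timeDomain := Set.univ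
            f := fun t => l₁ * Real.exp t
            k := fun t => l₂ * Real.exp (t / 2) + δ * Real.exp t
            n := 2
            basis := ![dX, vfield (fun _ _ _ => 2)
              (fun t _ _ => -ϰ * (2 * l₂ * Real.exp (t / 2) + δ * Real.exp t))
              (fun _ _ u => -(u + ϰ))] }}
  | .III => {r | ∃ l₁ : ℝ, l₁ ≠ 0 ∧ r = rowIII l₁}
  | .IV => {r | ∃ ε δ ϰ : ℝ, (ε = 1 ∨ ε = -1) ∧ (δ = 0 ∨ δ = 1) ∧ ϰ = 1 / 2 * (δ / ε) ∧
      r = { timeDomain := Set.univ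
            f := fun _ => ε
            k := fun _ => δ
            n := 3
            basis := ![dX, dT, vfield (fun t _ _ => 3 * t)
              (fun t x _ => x - ϰ * δ * t)
              (fun _ _ u => -(u + ϰ))] }}

/-- The second table (classification up to `Ĝ^∼`). -/
def table2 : Case2 → Set Row
  | .I1 => {r | ∃ l₁ ρ δ : ℝ, l₁ ≠ 0 ∧ (δ = 0 ∨ δ = 1) ∧ (ρ, δ) ≠ (0, 0) ∧
      r = { timeDomain := Set.Ioi 0
            f := fun t => l₁ * t ^ ρ
            k := fun t => δ * t ^ ((3 * ρ - 2) / 6)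
            n := 2
            basis := ![dX, vfield (fun t _ _ => 3 * t) (fun _ x _ => x)
              (fun _ _ u => -((3 * ρ + 2) / 2) * u)] }}
  | .I2 => {r | ∃ l₁ : ℝ, l₁ ≠ 0 ∧ r = rowI2 l₁}
  | .II => {r | ∃ l₁ δ : ℝ, l₁ ≠ 0 ∧ (δ = 0 ∨ δ = 1) ∧
      r = { timeDomain := Set.univ
            f := fun t => l₁ * Real.exp t
            k := fun t => δ * Real.exp (t / 2)
            n := 2
            basis := ![dX, vfield (fun _ _ _ => 2) (fun _ _ _ => 0) (fun _ _ u => -u)] }}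
  | .III => {r | ∃ l₁ : ℝ, l₁ ≠ 0 ∧ r = rowIII l₁}
  | .IV => {r | ∃ ε : ℝ, (ε = 1 ∨ ε = -1) ∧
      r = { timeDomain := Set.univ
            f := fun _ => ε
            k := fun _ => 0
            n := 3
            basis := ![dX, dT, vfield (fun t _ _ => 3 * t) (fun _ x _ => x) (fun _ _ u => -u)] }}

end Gardner

end

noncomputable section

namespace Gardner

/-! ### Partial derivatives over an open set of times -/

/-! After u_t is eliminated by the equation, the invariance condition is polynomial in the jet
coordinates above (t, x, u) and therefore splits. The coefficients of u_txx, u_xx², u_xx and u_xxx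
force τ = T(t), ξ_u = 0 and η affine in u. Since f and g do not vanish, the rest leaves exactly the
fields T ∂_t + (ax + X) ∂_x + (bu + c) ∂_u with constants a, b, c and (gT)' = 3ag, (fT)' = (a -
2b)f, (kT)' = (a - b)k - 2cf, X' = ck (`GardnerEq.IsLieSymmetry.exists_symData`,
`GardnerEq.SymData.isLieSymmetry`). If T = 0, then a = b = c = 0 and X is constant, so modulo ∂_x an
operator is determined by T. The kernel follows from the single equation `expEq`, which admits only
T = 0. If g = 1, then T = 3at + d, and computing the algebra of a row means deciding which affine T
its f and k allow.

Completeness needs one symmetry with T ≠ 0. Let G be an antiderivative of g, the natural new time.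
Then gT = 3aG + const. If a ≠ 0, the constant is absorbed in G, and φ = f/g, κ = k/g solve Euler
equations in G: φ is a power of |G|, while κ is a combination of φ and a second power, with a
logarithm at the resonant exponent -2/3. If a = 0, the equations have constant coefficients and give
exponentials or linear functions. This is the list `NormalForm`. Scalings and an affine change of G
normalise the constants (`GardnerEq.exists_equiv`). The parameter δ₃ removes a multiple of f from k,
and this accounts for the difference between the two tables.

For inequivalence, a transformation between equations with g = 1 has affine α. Hence being a shifted
power with a given exponent, or an exponential, is invariant for f, and being constant or affine is
invariant for k/f, even when δ₃ ≠ 0 (`AffineRelated`). These invariants separate the cases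
(`Case1.Holds.unique`, `Case2.Holds.unique`). -/

theorem isOpen_dom {I : Set ℝ} (hI : IsOpen I) : IsOpen (dom I) :=
  hI.preimage continuous_fst

/-- The derivative of `F` in the direction `v`. -/
def pd (v : Pt) (F : Pt → ℝ) (p : Pt) : ℝ := fderiv ℝ F p v

/-- The partial derivative with respect to `t`. -/
notation "pdt" => pd (1, 0, 0)

/-- The partial derivative with respect to `x`. -/
notation "pdx" => pd (0, 1, 0)

/-- The partial derivative with respect to `u`. -/
notation "pdu" => pd (0, 0, 1)

section partial_derivatives

variable {I : Set ℝ} {F F' : Pt → ℝ} {p : Pt}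

theorem contDiffOn_pd (hI : IsOpen I) (v : Pt) (hF : ContDiffOn ℝ ∞ F (dom I)) :
    ContDiffOn ℝ ∞ (pd v F) (dom I) :=
  (hF.fderiv_of_isOpen (m := ∞) (isOpen_dom hI) (by simp)).clm_apply contDiffOn_const

theorem differentiableAt_of_mem_dom (hI : IsOpen I) (hF : ContDiffOn ℝ ∞ F (dom I))
    (hp : p ∈ dom I) : DifferentiableAt ℝ F p :=
  (hF.differentiableOn (by simp)).differentiableAt ((isOpen_dom hI).mem_nhds hp)

theorem pd_comm (hI : IsOpen I) (hF : ContDiffOn ℝ ∞ F (dom I)) (v w : Pt) (hp : p ∈ dom I) :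
    pd v (pd w F) p = pd w (pd v F) p := by
  have h2 : ContDiffAt ℝ ∞ F p := hF.contDiffAt ((isOpen_dom hI).mem_nhds hp)
  have hs : IsSymmSndFDerivAt ℝ F p := h2.isSymmSndFDerivAt (by simp; exact WithTop.coe_le_coe.2 le_top)
  have hd : DifferentiableAt ℝ (fderiv ℝ F) p :=
    (h2.fderiv_right (m := ∞) (by simp)).differentiableAt (by simp)
  have key : ∀ a b : Pt, pd a (pd b F) p = fderiv ℝ (fderiv ℝ F) p a b := by
    intro a b
    change fderiv ℝ (fun q => fderiv ℝ F q b) p a = _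
    rw [fderiv_clm_apply hd (differentiableAt_const b)]
    simp
  rw [key, key]
  exact hs v w

theorem pd_congr (hI : IsOpen I) (h : Set.EqOn F F' (dom I)) (v : Pt) :
    Set.EqOn (pd v F) (pd v F') (dom I) := fun q hq => by
  have : F =ᶠ[nhds q] F' := Filter.eventuallyEq_of_mem ((isOpen_dom hI).mem_nhds hq) h
  simp only [pd, this.fderiv_eq]

theorem pd_eq_zero_of_eqOn_const (hI : IsOpen I) {c : ℝ} (h : ∀ q ∈ dom I, F q = c) (v : Pt) :
    ∀ q ∈ dom I, pd v F q = 0 := fun q hq => by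
  rw [pd_congr hI (F' := fun _ => c) h v hq]
  simp [pd]

theorem pd_decomp (F : Pt → ℝ) (p : Pt) (a b c : ℝ) :
    fderiv ℝ F p (a, b, c) = a * pdt F p + b * pdx F p + c * pdu F p := by
  have : ((a, b, c) : Pt) = a • ((1, 0, 0) : Pt) + b • ((0, 1, 0) : Pt) + c • ((0, 0, 1) : Pt) := by
    simp
  rw [this]
  simp only [map_add, map_smul, smul_eq_mul, pd]

theorem hasDerivAt_t (hF : DifferentiableAt ℝ F p) :
    HasDerivAt (fun s => F (s, p.2)) (pdt F p) p.1 := by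
  have h : HasDerivAt (fun s : ℝ => ((s, p.2) : Pt)) ((1, 0, 0) : Pt) p.1 :=
    (hasDerivAt_id _).prodMk (hasDerivAt_const _ _)
  exact HasFDerivAt.comp_hasDerivAt (x := p.1) (l := F) hF.hasFDerivAt h

theorem hasDerivAt_x (hF : DifferentiableAt ℝ F p) :
    HasDerivAt (fun s => F (p.1, s, p.2.2)) (pdx F p) p.2.1 := by
  have h : HasDerivAt (fun s : ℝ => ((p.1, s, p.2.2) : Pt)) ((0, 1, 0) : Pt) p.2.1 :=
    (hasDerivAt_const _ _).prodMk ((hasDerivAt_id _).prodMk (hasDerivAt_const _ _))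
  exact HasFDerivAt.comp_hasDerivAt (x := p.2.1) (l := F) hF.hasFDerivAt h

theorem hasDerivAt_u (hF : DifferentiableAt ℝ F p) :
    HasDerivAt (fun s => F (p.1, p.2.1, s)) (pdu F p) p.2.2 := by
  have h : HasDerivAt (fun s : ℝ => ((p.1, p.2.1, s) : Pt)) ((0, 0, 1) : Pt) p.2.2 :=
    (hasDerivAt_const _ _).prodMk ((hasDerivAt_const _ _).prodMk (hasDerivAt_id _))
  exact HasFDerivAt.comp_hasDerivAt (x := p.2.2) (l := F) hF.hasFDerivAt h

end partial_derivatives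

/-! ### Total derivatives of functions of the base point -/

/-- The direction of the total derivative `D_x` at a jet. -/
def dirX (j : Jet) : Jet := (0, 1, fun a b => j.2.2 a (b + 1))

/-- The direction of the total derivative `D_t` at a jet. -/
def dirT (j : Jet) : Jet := (1, 0, fun a b => j.2.2 (a + 1) b)

/-- The function `D_x F` of the jet, for a function `F` of the base point. -/
def totalD1 (F : Pt → ℝ) (j : Jet) : ℝ := pdx F j.base + j.2.2 0 1 * pdu F j.base

/-- The function `D_x² F` of the jet, for a function `F` of the base point. -/
def totalD2 (F : Pt → ℝ) (j : Jet) : ℝ :=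
  totalD1 (pdx F) j + j.2.2 0 1 * totalD1 (pdu F) j + j.2.2 0 2 * pdu F j.base

/-- The function `D_x³ F` of the jet, for a function `F` of the base point. -/
def totalD3 (F : Pt → ℝ) (j : Jet) : ℝ :=
  totalD2 (pdx F) j + j.2.2 0 1 * totalD2 (pdu F) j + 2 * j.2.2 0 2 * totalD1 (pdu F) j
    + j.2.2 0 3 * pdu F j.base

/-- Jets form an infinite product without a norm, so calculus on them runs along single lines. A
line derivative is an ordinary derivative at 0 in the line parameter, and the usual rules carry
over. -/
theorem _root_.HasLineDerivAt.mul_jet {F F' : Jet → ℝ} {d d' : ℝ} {j v : Jet}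
    (h : HasLineDerivAt ℝ F d j v) (h' : HasLineDerivAt ℝ F' d' j v) :
    HasLineDerivAt ℝ (fun i => F i * F' i) (d * F' j + F j * d') j v := by
  have := HasDerivAt.mul h h'
  simp only [zero_smul, add_zero] at this
  exact this

theorem _root_.HasLineDerivAt.add_jet {F F' : Jet → ℝ} {d d' : ℝ} {j v : Jet}
    (h : HasLineDerivAt ℝ F d j v) (h' : HasLineDerivAt ℝ F' d' j v) :
    HasLineDerivAt ℝ (fun i => F i + F' i) (d + d') j v :=
  HasDerivAt.add h h'

theorem _root_.HasLineDerivAt.sub_jet {F F' : Jet → ℝ} {d d' : ℝ} {j v : Jet}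
    (h : HasLineDerivAt ℝ F d j v) (h' : HasLineDerivAt ℝ F' d' j v) :
    HasLineDerivAt ℝ (fun i => F i - F' i) (d - d') j v :=
  HasDerivAt.sub h h'

theorem _root_.HasLineDerivAt.const_mul_jet {F : Jet → ℝ} {d : ℝ} {j v : Jet} (c : ℝ)
    (h : HasLineDerivAt ℝ F d j v) : HasLineDerivAt ℝ (fun i => c * F i) (c * d) j v :=
  HasDerivAt.const_mul c h

theorem hasLineDerivAt_coord (a b : ℕ) (j v : Jet) :
    HasLineDerivAt ℝ (fun i : Jet => i.2.2 a b) (v.2.2 a b) j v := by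
  have : HasDerivAt (fun s : ℝ => j.2.2 a b + s * v.2.2 a b) (v.2.2 a b) 0 := by
    simpa using ((hasDerivAt_id (0 : ℝ)).mul_const (v.2.2 a b)).const_add (j.2.2 a b)
  simpa [HasLineDerivAt] using this

theorem hasLineDerivAt_time {h : ℝ → ℝ} {j v : Jet} (hd : DifferentiableAt ℝ h j.1) :
    HasLineDerivAt ℝ (fun i : Jet => h i.1) (deriv h j.1 * v.1) j v := by
  have h1 : HasDerivAt (fun s : ℝ => j.1 + s * v.1) v.1 0 := by
    simpa using ((hasDerivAt_id (0 : ℝ)).mul_const v.1).const_add j.1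
  have h2 : HasDerivAt h (deriv h j.1) (j.1 + 0 * v.1) := by simpa using hd.hasDerivAt
  exact h2.comp 0 h1

section total_derivatives

variable {I : Set ℝ} {F : Pt → ℝ} {j : Jet}

/-- Taking base points sends a line of jets to a line in (t, x, u), where the Fréchet derivative is
available. -/
theorem hasLineDerivAt_base (hI : IsOpen I) (hF : ContDiffOn ℝ ∞ F (dom I)) (hj : j.1 ∈ I)
    (v : Jet) : HasLineDerivAt ℝ (fun i : Jet => F i.base)
      (v.1 * pdt F j.base + v.2.1 * pdx F j.base + v.2.2 0 0 * pdu F j.base) j v := by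
  rw [← pd_decomp]
  have hp : j.base ∈ dom I := hj
  have h1 : HasFDerivAt F (fderiv ℝ F j.base) j.base :=
    (differentiableAt_of_mem_dom hI hF hp).hasFDerivAt
  have h2 := h1.hasLineDerivAt (v.1, v.2.1, v.2.2 0 0)
  exact h2

theorem hasLineDerivAt_totalD0 (hI : IsOpen I) (hF : ContDiffOn ℝ ∞ F (dom I)) (hj : j.1 ∈ I) :
    HasLineDerivAt ℝ (fun i : Jet => F i.base) (totalD1 F j) j (dirX j) := by
  have := hasLineDerivAt_base hI hF hj (dirX j)
  simpa [dirX, totalD1] using this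

theorem hasLineDerivAt_totalD1 (hI : IsOpen I) (hF : ContDiffOn ℝ ∞ F (dom I)) (hj : j.1 ∈ I) :
    HasLineDerivAt ℝ (totalD1 F) (totalD2 F j) j (dirX j) := by
  have hx := hasLineDerivAt_totalD0 hI (contDiffOn_pd hI (0, 1, 0) hF) hj
  have hu := hasLineDerivAt_totalD0 hI (contDiffOn_pd hI (0, 0, 1) hF) hj
  have := hx.add_jet ((hasLineDerivAt_coord 0 1 j (dirX j)).mul_jet hu)
  refine this.congr_deriv ?_
  simp only [totalD2, dirX]; ring

/-- Term by term differentiation produces u_xx D_x(F_u) twice, from u_x D_x(F_u) and from u_xx F_u.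
No exchange of mixed partials is needed. -/
theorem hasLineDerivAt_totalD2 (hI : IsOpen I) (hF : ContDiffOn ℝ ∞ F (dom I)) (hj : j.1 ∈ I) :
    HasLineDerivAt ℝ (totalD2 F) (totalD3 F j) j (dirX j) := by
  have hx := hasLineDerivAt_totalD1 hI (contDiffOn_pd hI (0, 1, 0) hF) hj
  have hu := hasLineDerivAt_totalD1 hI (contDiffOn_pd hI (0, 0, 1) hF) hj
  have hu0 := hasLineDerivAt_totalD0 hI (contDiffOn_pd hI (0, 0, 1) hF) hj
  have := (hx.add_jet ((hasLineDerivAt_coord 0 1 j (dirX j)).mul_jet hu)).add_jet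
    ((hasLineDerivAt_coord 0 2 j (dirX j)).mul_jet hu0)
  refine this.congr_deriv ?_
  simp only [totalD3, totalD2, dirX]; ring

end total_derivatives

/-! ### Explicit prolongation formulas -/

/-- The component `τ` of a vector field. -/
def compT (Q : VField) : Pt → ℝ := fun p => (Q p).1

/-- The component `ξ` of a vector field. -/
def compX (Q : VField) : Pt → ℝ := fun p => (Q p).2.1

/-- The component `η` of a vector field. -/
def compU (Q : VField) : Pt → ℝ := fun p => (Q p).2.2

/-- The explicit form of `η^x`. -/
def etaX (Q : VField) (j : Jet) : ℝ :=
  totalD1 (compU Q) j - j.2.2 1 0 * totalD1 (compT Q) j - j.2.2 0 1 * totalD1 (compX Q) j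

/-- The explicit form of `η^{xx}`. -/
def etaXX (Q : VField) (j : Jet) : ℝ :=
  totalD2 (compU Q) j
    - (j.2.2 1 0 * totalD2 (compT Q) j + 2 * (j.2.2 1 1 * totalD1 (compT Q) j))
    - (j.2.2 0 1 * totalD2 (compX Q) j + 2 * (j.2.2 0 2 * totalD1 (compX Q) j))

/-- The explicit form of `η^{xxx}`. -/
def etaXXX (Q : VField) (j : Jet) : ℝ :=
  totalD3 (compU Q) j
    - (j.2.2 1 0 * totalD3 (compT Q) j + 3 * (j.2.2 1 1 * totalD2 (compT Q) j)
      + 3 * (j.2.2 1 2 * totalD1 (compT Q) j))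
    - (j.2.2 0 1 * totalD3 (compX Q) j + 3 * (j.2.2 0 2 * totalD2 (compX Q) j)
      + 3 * (j.2.2 0 3 * totalD1 (compX Q) j))

/-- The direction of D_x has zero time component, so the line stays at one time. Prolongation
formulas known only over I can thus be differentiated again. -/
theorem totalDx_congr {F F' : Jet → ℝ} {j : Jet} (h : ∀ i : Jet, i.1 = j.1 → F i = F' i) :
    totalDx F j = totalDx F' j := by
  unfold totalDx lineDeriv
  congr 1
  funext s
  exact h _ (by simp)

section prolongation

variable {I : Set ℝ} {Q : VField} {j : Jet}

theorem contDiffOn_compT (hQ : ContDiffOn ℝ ∞ Q (dom I)) : ContDiffOn ℝ ∞ (compT Q) (dom I) :=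
  hQ.fst

theorem contDiffOn_compX (hQ : ContDiffOn ℝ ∞ Q (dom I)) : ContDiffOn ℝ ∞ (compX Q) (dom I) :=
  hQ.snd.fst

theorem contDiffOn_compU (hQ : ContDiffOn ℝ ∞ Q (dom I)) : ContDiffOn ℝ ∞ (compU Q) (dom I) :=
  hQ.snd.snd

theorem totalDx_base {F : Pt → ℝ} (hI : IsOpen I) (hF : ContDiffOn ℝ ∞ F (dom I)) (hj : j.1 ∈ I) :
    totalDx (fun i => F i.base) j = totalD1 F j :=
  (hasLineDerivAt_totalD0 hI hF hj).lineDeriv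

theorem prolongX_one (hI : IsOpen I) (hQ : ContDiffOn ℝ ∞ Q (dom I)) (hj : j.1 ∈ I) :
    prolongX Q 1 j = etaX Q j := by
  have hT := totalDx_base hI (contDiffOn_compT hQ) hj
  have hX := totalDx_base hI (contDiffOn_compX hQ) hj
  have hU := totalDx_base hI (contDiffOn_compU hQ) hj
  simp only [compT, compX, compU] at hT hX hU
  simp only [prolongX, hT, hX, hU, etaX]

theorem prolongX_two (hI : IsOpen I) (hQ : ContDiffOn ℝ ∞ Q (dom I)) (hj : j.1 ∈ I) :
    prolongX Q 2 j = etaXX Q j := by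
  have hT := totalDx_base hI (contDiffOn_compT hQ) hj
  have hX := totalDx_base hI (contDiffOn_compX hQ) hj
  have hT1 := hasLineDerivAt_totalD1 hI (contDiffOn_compT hQ) hj
  have hX1 := hasLineDerivAt_totalD1 hI (contDiffOn_compX hQ) hj
  have hU1 := hasLineDerivAt_totalD1 hI (contDiffOn_compU hQ) hj
  have h := (hU1.sub_jet ((hasLineDerivAt_coord 1 0 j (dirX j)).mul_jet hT1)).sub_jet
    ((hasLineDerivAt_coord 0 1 j (dirX j)).mul_jet hX1)
  have e : totalDx (prolongX Q 1) j = totalDx (etaX Q) j :=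
    totalDx_congr fun i hi => prolongX_one hI hQ (hi ▸ hj)
  have e' : totalDx (etaX Q) j = _ := h.lineDeriv
  change totalDx (prolongX Q 1) j - j.2.2 1 1 * totalDx (fun i => compT Q i.base) j
    - j.2.2 0 2 * totalDx (fun i => compX Q i.base) j = _
  rw [e, e', hT, hX]
  simp [dirX, etaXX]; ring

theorem prolongX_three (hI : IsOpen I) (hQ : ContDiffOn ℝ ∞ Q (dom I)) (hj : j.1 ∈ I) :
    prolongX Q 3 j = etaXXX Q j := by
  have hT := totalDx_base hI (contDiffOn_compT hQ) hj
  have hX := totalDx_base hI (contDiffOn_compX hQ) hj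
  have hT1 := hasLineDerivAt_totalD1 hI (contDiffOn_compT hQ) hj
  have hX1 := hasLineDerivAt_totalD1 hI (contDiffOn_compX hQ) hj
  have hT2 := hasLineDerivAt_totalD2 hI (contDiffOn_compT hQ) hj
  have hX2 := hasLineDerivAt_totalD2 hI (contDiffOn_compX hQ) hj
  have hU2 := hasLineDerivAt_totalD2 hI (contDiffOn_compU hQ) hj
  have hc := fun a b => hasLineDerivAt_coord a b j (dirX j)
  have h := (hU2.sub_jet (((hc 1 0).mul_jet hT2).add_jet
      (((hc 1 1).mul_jet hT1).const_mul_jet 2))).sub_jet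
    (((hc 0 1).mul_jet hX2).add_jet (((hc 0 2).mul_jet hX1).const_mul_jet 2))
  have e : totalDx (prolongX Q 2) j = totalDx (etaXX Q) j :=
    totalDx_congr fun i hi => prolongX_two hI hQ (hi ▸ hj)
  have e' : totalDx (etaXX Q) j = _ := h.lineDeriv
  change totalDx (prolongX Q 2) j - j.2.2 1 2 * totalDx (fun i => compT Q i.base) j
    - j.2.2 0 3 * totalDx (fun i => compX Q i.base) j = _
  rw [e, e', hT, hX]
  simp [dirX, etaXXX]; ring

/-- The total derivative `D_t` of a function of the base point. -/
theorem totalDt_base {F : Pt → ℝ} (hI : IsOpen I) (hF : ContDiffOn ℝ ∞ F (dom I)) (hj : j.1 ∈ I) :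
    totalDt (fun i => F i.base) j = pdt F j.base + j.2.2 1 0 * pdu F j.base := by
  have := (hasLineDerivAt_base hI hF hj (dirT j)).lineDeriv
  simpa [dirT, totalDt] using this

theorem prolongCoeff_one_zero (hI : IsOpen I) (hQ : ContDiffOn ℝ ∞ Q (dom I)) (hj : j.1 ∈ I) :
    prolongCoeff Q 1 0 j = pdt (compU Q) j.base + j.2.2 1 0 * pdu (compU Q) j.base
      - j.2.2 1 0 * (pdt (compT Q) j.base + j.2.2 1 0 * pdu (compT Q) j.base)
      - j.2.2 0 1 * (pdt (compX Q) j.base + j.2.2 1 0 * pdu (compX Q) j.base) := by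
  rw [← totalDt_base hI (contDiffOn_compT hQ) hj, ← totalDt_base hI (contDiffOn_compX hQ) hj,
    ← totalDt_base hI (contDiffOn_compU hQ) hj]
  rfl

/-- The prolongation of `Q` applied to the left-hand side of the equation. -/
theorem lineDeriv_lhs (hI : IsOpen I) (E : GardnerEq I) (hQ : ContDiffOn ℝ ∞ Q (dom I))
    (hj : j.1 ∈ I) : lineDeriv ℝ E.lhs j (prolong Q j) =
      prolongCoeff Q 1 0 j
      + (deriv E.k j.1 * compT Q j.base * j.2.2 0 0 + E.k j.1 * compU Q j.base
        + deriv E.f j.1 * compT Q j.base * j.2.2 0 0 ^ 2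
        + 2 * E.f j.1 * j.2.2 0 0 * compU Q j.base) * j.2.2 0 1
      + (E.k j.1 * j.2.2 0 0 + E.f j.1 * j.2.2 0 0 ^ 2) * etaX Q j
      + deriv E.g j.1 * compT Q j.base * j.2.2 0 3 + E.g j.1 * etaXXX Q j := by
  have hd : ∀ {h : ℝ → ℝ}, ContDiffOn ℝ ∞ h I → DifferentiableAt ℝ h j.1 := fun hh =>
    (hh.differentiableOn (by simp)).differentiableAt (hI.mem_nhds hj)
  have hk := hasLineDerivAt_time (v := prolong Q j) (hd E.smooth_k)
  have hf := hasLineDerivAt_time (v := prolong Q j) (hd E.smooth_f)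
  have hg := hasLineDerivAt_time (v := prolong Q j) (hd E.smooth_g)
  have hc := fun a b => hasLineDerivAt_coord a b j (prolong Q j)
  have h := (((hc 1 0).add_jet ((hk.mul_jet (hc 0 0)).mul_jet (hc 0 1))).add_jet
    ((hf.mul_jet ((hc 0 0).mul_jet (hc 0 0))).mul_jet (hc 0 1))).add_jet (hg.mul_jet (hc 0 3))
  have e : E.lhs = fun i => i.2.2 1 0 + E.k i.1 * i.2.2 0 0 * i.2.2 0 1
      + E.f i.1 * (i.2.2 0 0 * i.2.2 0 0) * i.2.2 0 1 + E.g i.1 * i.2.2 0 3 := by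
    funext i; simp only [GardnerEq.lhs]; ring
  rw [e, h.lineDeriv]
  have h0 : (prolong Q j).2.2 0 0 = compU Q j.base := rfl
  have h1 : (prolong Q j).2.2 0 1 = etaX Q j := prolongX_one hI hQ hj
  have h3 : (prolong Q j).2.2 0 3 = etaXXX Q j := prolongX_three hI hQ hj
  have ht : (prolong Q j).1 = compT Q j.base := rfl
  have h10 : (prolong Q j).2.2 1 0 = prolongCoeff Q 1 0 j := rfl
  rw [h0, h1, h3, ht, h10]
  ring

end prolongation

/-! ### Functions with vanishing partial derivatives -/

theorem IsOpenInterval.isPreconnected {I : Set ℝ} (hI : IsOpenInterval I) : IsPreconnected I :=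
  hI.ordConnected.isPreconnected

theorem IsOpenInterval.eq_of_hasDerivAt_zero {I : Set ℝ} (hI : IsOpenInterval I) {F : ℝ → ℝ}
    (h : ∀ t ∈ I, HasDerivAt F 0 t) {s t : ℝ} (hs : s ∈ I) (ht : t ∈ I) : F s = F t :=
  hI.isOpen.is_const_of_deriv_eq_zero hI.isPreconnected
    (fun r hr => (h r hr).differentiableAt.differentiableWithinAt) (fun r hr => (h r hr).deriv) hs ht

section vanishing

variable {I : Set ℝ} {F : Pt → ℝ} {t x u : ℝ}

theorem eq_of_pdu_eq_zero (hI : IsOpen I) (hF : ContDiffOn ℝ ∞ F (dom I))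
    (h : ∀ q ∈ dom I, pdu F q = 0) (ht : t ∈ I) : F (t, x, u) = F (t, x, 0) := by
  have hd : ∀ s : ℝ, HasDerivAt (fun s => F (t, x, s)) 0 s := fun s => by
    have hm : (t, x, s) ∈ dom I := ht
    have := hasDerivAt_u (differentiableAt_of_mem_dom hI hF hm)
    rwa [h _ hm] at this
  exact is_const_of_deriv_eq_zero (fun s => (hd s).differentiableAt) (fun s => (hd s).deriv) u 0

theorem eq_of_pdx_eq_zero (hI : IsOpen I) (hF : ContDiffOn ℝ ∞ F (dom I))
    (h : ∀ q ∈ dom I, pdx F q = 0) (ht : t ∈ I) : F (t, x, u) = F (t, 0, u) := by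
  have hd : ∀ s : ℝ, HasDerivAt (fun s => F (t, s, u)) 0 s := fun s => by
    have hm : (t, s, u) ∈ dom I := ht
    have := hasDerivAt_x (differentiableAt_of_mem_dom hI hF hm)
    rwa [h _ hm] at this
  exact is_const_of_deriv_eq_zero (fun s => (hd s).differentiableAt) (fun s => (hd s).deriv) x 0

theorem eq_of_pdx_pdu_eq_zero (hI : IsOpen I) (hF : ContDiffOn ℝ ∞ F (dom I))
    (hx : ∀ q ∈ dom I, pdx F q = 0) (hu : ∀ q ∈ dom I, pdu F q = 0) (ht : t ∈ I) :
    F (t, x, u) = F (t, 0, 0) := by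
  rw [eq_of_pdx_eq_zero hI hF hx ht, eq_of_pdu_eq_zero hI hF hu ht]

theorem pdx_eq_zero_of_indep (hI : IsOpen I) (hF : ContDiffOn ℝ ∞ F (dom I))
    (h : ∀ t ∈ I, ∀ x u, F (t, x, u) = F (t, 0, u)) : ∀ q ∈ dom I, pdx F q = 0 := by
  rintro ⟨t, x, u⟩ hq
  have h1 := hasDerivAt_x (differentiableAt_of_mem_dom hI hF hq)
  have h2 : (fun s => F (t, s, u)) = fun _ => F (t, 0, u) := funext fun s => h t hq s u
  dsimp only at h1
  rw [h2] at h1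
  exact h1.unique (hasDerivAt_const _ _)

theorem exists_const_of_pd_eq_zero (hI : IsOpenInterval I) (hF : ContDiffOn ℝ ∞ F (dom I))
    (ht : ∀ q ∈ dom I, pdt F q = 0) (hx : ∀ q ∈ dom I, pdx F q = 0)
    (hu : ∀ q ∈ dom I, pdu F q = 0) : ∃ c, ∀ q ∈ dom I, F q = c := by
  obtain ⟨t₀, ht₀⟩ := hI.nonempty
  refine ⟨F (t₀, 0, 0), ?_⟩
  rintro ⟨t, x, u⟩ hq
  rw [eq_of_pdx_pdu_eq_zero hI.isOpen hF hx hu hq]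
  refine hI.eq_of_hasDerivAt_zero (F := fun s => F (s, 0, 0)) (fun s hs => ?_) hq ht₀
  have hm : (s, 0, 0) ∈ dom I := hs
  have := hasDerivAt_t (differentiableAt_of_mem_dom hI.isOpen hF hm)
  rwa [ht _ hm] at this

theorem eq_add_mul_of_pdu_eq (hI : IsOpen I) (hF : ContDiffOn ℝ ∞ F (dom I)) {c : ℝ} (ht : t ∈ I)
    (h : ∀ s, pdu F (t, x, s) = c) : F (t, x, u) = F (t, x, 0) + c * u := by
  have hd : ∀ s : ℝ, HasDerivAt (fun s => F (t, x, s) - c * s) 0 s := fun s => by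
    have hm : (t, x, s) ∈ dom I := ht
    have h1 := hasDerivAt_u (differentiableAt_of_mem_dom hI hF hm)
    rw [h s] at h1
    exact (h1.sub ((hasDerivAt_id s).const_mul c)).congr_deriv (by simp)
  have := is_const_of_deriv_eq_zero (fun s => (hd s).differentiableAt) (fun s => (hd s).deriv) u 0
  linarith

theorem eq_add_mul_of_pdx_eq (hI : IsOpen I) (hF : ContDiffOn ℝ ∞ F (dom I)) {c : ℝ} (ht : t ∈ I)
    (h : ∀ s, pdx F (t, s, u) = c) : F (t, x, u) = F (t, 0, u) + c * x := by
  have hd : ∀ s : ℝ, HasDerivAt (fun s => F (t, s, u) - c * s) 0 s := fun s => by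
    have hm : (t, s, u) ∈ dom I := ht
    have h1 := hasDerivAt_x (differentiableAt_of_mem_dom hI hF hm)
    rw [h s] at h1
    exact (h1.sub ((hasDerivAt_id s).const_mul c)).congr_deriv (by simp)
  have := is_const_of_deriv_eq_zero (fun s => (hd s).differentiableAt) (fun s => (hd s).deriv) x 0
  linarith

variable {j : Jet}

theorem totalD_eq_zero (hI : IsOpen I) (hx : ∀ q ∈ dom I, pdx F q = 0)
    (hu : ∀ q ∈ dom I, pdu F q = 0) (hj : j.1 ∈ I) :
    totalD1 F j = 0 ∧ totalD2 F j = 0 ∧ totalD3 F j = 0 := by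
  have hb : j.base ∈ dom I := hj
  have z := fun v => pd_eq_zero_of_eqOn_const hI hx v
  have z' := fun v => pd_eq_zero_of_eqOn_const hI hu v
  have zz := fun v w => pd_eq_zero_of_eqOn_const hI (z v) w
  have zz' := fun v w => pd_eq_zero_of_eqOn_const hI (z' v) w
  simp [totalD1, totalD2, totalD3, hx _ hb, hu _ hb, z _ _ hb, z' _ _ hb, zz _ _ _ hb, zz' _ _ _ hb]

theorem totalD_of_pdu_eq_zero (hI : IsOpen I) (hF : ContDiffOn ℝ ∞ F (dom I))
    (hu : ∀ q ∈ dom I, pdu F q = 0) (hj : j.1 ∈ I) :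
    totalD1 F j = pdx F j.base ∧ totalD2 F j = pdx (pdx F) j.base ∧
      totalD3 F j = pdx (pdx (pdx F)) j.base := by
  have hb : j.base ∈ dom I := hj
  have z' := fun v => pd_eq_zero_of_eqOn_const hI hu v
  have zz' := fun v w => pd_eq_zero_of_eqOn_const hI (z' v) w
  have e1 : ∀ q ∈ dom I, pdu (pdx F) q = 0 := fun q hq => by
    rw [pd_comm hI hF _ _ hq, z' _ _ hq]
  have e1' := fun v => pd_eq_zero_of_eqOn_const hI e1 v
  have e2 : ∀ q ∈ dom I, pdu (pdx (pdx F)) q = 0 := fun q hq => by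
    rw [pd_comm hI (contDiffOn_pd hI _ hF) _ _ hq, e1' _ _ hq]
  simp [totalD1, totalD2, totalD3, hu _ hb, z' _ _ hb, zz' _ _ _ hb, e1 _ hb, e2 _ hb, e1' _ _ hb]

/-- Meant for η: once its u-slope depends on t alone, the only term of D_x³η besides η_xxx is u_xxx
η_u. -/
theorem totalD_of_affine (hI : IsOpen I) (hF : ContDiffOn ℝ ∞ F (dom I))
    (huu : ∀ q ∈ dom I, pdu (pdu F) q = 0) (hxu : ∀ q ∈ dom I, pdx (pdu F) q = 0) (hj : j.1 ∈ I) :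
    totalD3 F j = pdx (pdx (pdx F)) j.base + j.2.2 0 3 * pdu F j.base := by
  have hb : j.base ∈ dom I := hj
  have z := fun v => pd_eq_zero_of_eqOn_const hI huu v
  have z' := fun v => pd_eq_zero_of_eqOn_const hI hxu v
  have e1 : ∀ q ∈ dom I, pdu (pdx F) q = 0 := fun q hq => by rw [pd_comm hI hF _ _ hq, hxu _ hq]
  have e1' := fun v => pd_eq_zero_of_eqOn_const hI e1 v
  have e2 : ∀ q ∈ dom I, pdu (pdx (pdx F)) q = 0 := fun q hq => by
    rw [pd_comm hI (contDiffOn_pd hI _ hF) _ _ hq, e1' _ _ hq]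
  simp [totalD1, totalD2, totalD3, huu _ hb, hxu _ hb, z _ _ hb, z' _ _ hb, e1 _ hb, e2 _ hb,
    e1' _ _ hb]

end vanishing

/-! ### Solution of the determining equations -/

/-- The determining equations for the field `T ∂_t + (a x + X) ∂_x + (b u + c) ∂_u`. -/
structure GardnerEq.SymData {I : Set ℝ} (E : GardnerEq I) (a b c : ℝ) (T X : ℝ → ℝ) : Prop where
  smooth_T : ContDiffOn ℝ ∞ T I
  smooth_X : ContDiffOn ℝ ∞ X I
  eq_g : ∀ t ∈ I, E.g t * deriv T t + deriv E.g t * T t = 3 * a * E.g t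
  eq_f : ∀ t ∈ I, E.f t * deriv T t + deriv E.f t * T t = (a - 2 * b) * E.f t
  eq_k : ∀ t ∈ I, E.k t * deriv T t + deriv E.k t * T t = (a - b) * E.k t - 2 * c * E.f t
  eq_X : ∀ t ∈ I, HasDerivAt X (c * E.k t) t

/-- The vector field `T ∂_t + (a x + X) ∂_x + (b u + c) ∂_u`. -/
def affField (a b c : ℝ) (T X : ℝ → ℝ) : VField :=
  vfield (fun t _ _ => T t) (fun t x _ => a * x + X t) (fun _ _ u => b * u + c)

/-- The jet with the given coordinates up to third order, and all others zero. -/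
def jetOf (t x u ux uxx uxxx ut utxx : ℝ) : Jet := (t, x, fun a b =>
  match a, b with
  | 0, 0 => u
  | 0, 1 => ux
  | 0, 2 => uxx
  | 0, 3 => uxxx
  | 1, 0 => ut
  | 1, 2 => utxx
  | _, _ => 0)

section determining

variable {I : Set ℝ} {E : GardnerEq I} {Q : VField}

theorem GardnerEq.f_ne_zero (E : GardnerEq I) {t : ℝ} (ht : t ∈ I) : E.f t ≠ 0 :=
  left_ne_zero_of_mul (E.fg_ne_zero t ht)

theorem GardnerEq.g_ne_zero (E : GardnerEq I) {t : ℝ} (ht : t ∈ I) : E.g t ≠ 0 :=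
  right_ne_zero_of_mul (E.fg_ne_zero t ht)

/-- The invariance condition at the jet of a point with given coordinates. -/
theorem GardnerEq.IsLieSymmetry.at_jetOf (hI : IsOpen I) (h : E.IsLieSymmetry Q) {t : ℝ}
    (ht : t ∈ I) (x u p r s n : ℝ) {j : Jet}
    (hj : j = jetOf t x u p r s (-(E.k t * u + E.f t * u ^ 2) * p - E.g t * s) n) :
    (pdt (compU Q) (t, x, u) + j.2.2 1 0 * pdu (compU Q) (t, x, u)
      - j.2.2 1 0 * (pdt (compT Q) (t, x, u) + j.2.2 1 0 * pdu (compT Q) (t, x, u))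
      - p * (pdt (compX Q) (t, x, u) + j.2.2 1 0 * pdu (compX Q) (t, x, u)))
      + (deriv E.k t * compT Q (t, x, u) * u + E.k t * compU Q (t, x, u)
        + deriv E.f t * compT Q (t, x, u) * u ^ 2
        + 2 * E.f t * u * compU Q (t, x, u)) * p
      + (E.k t * u + E.f t * u ^ 2) * etaX Q j
      + deriv E.g t * compT Q (t, x, u) * s + E.g t * etaXXX Q j = 0 := by
  have hjt : j.1 ∈ I := by rw [hj]; exact ht
  have h1 := h.2 j hjt (by rw [hj]; simp only [GardnerEq.lhs, jetOf]; ring)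
  rw [lineDeriv_lhs hI E h.1 hjt, prolongCoeff_one_zero hI h.1 hjt] at h1
  subst hj
  exact h1

theorem GardnerEq.IsLieSymmetry.pd_compT (hI : IsOpen I) (h : E.IsLieSymmetry Q) :
    (∀ q ∈ dom I, pdx (compT Q) q = 0) ∧ ∀ q ∈ dom I, pdu (compT Q) q = 0 := by
  have key : ∀ q ∈ dom I, ∀ p, pdx (compT Q) q + p * pdu (compT Q) q = 0 := by
    rintro ⟨t, x, u⟩ hq p
    have hq' : t ∈ I := hq
    -- The two jets differ only in u_txx, which enters only through the term -3 u_txx D_x τ of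
    -- η^{xxx}.
    have h0 := h.at_jetOf hI hq' x u p 0 0 0 rfl
    have h1 := h.at_jetOf hI hq' x u p 0 0 1 rfl
    have h2 : E.g t * (pdx (compT Q) (t, x, u) + p * pdu (compT Q) (t, x, u)) = 0 := by
      simp only [etaX, etaXXX, totalD1, totalD2, totalD3, jetOf, Jet.base] at h0 h1
      linear_combination (h0 - h1) / 3
    exact (mul_eq_zero.1 h2).resolve_left (E.g_ne_zero hq)
  refine ⟨fun q hq => by simpa using key q hq 0, fun q hq => ?_⟩
  linear_combination key q hq 1 - key q hq 0

theorem GardnerEq.IsLieSymmetry.pd_compX (hI : IsOpen I) (h : E.IsLieSymmetry Q) :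
    ∀ q ∈ dom I, pdu (compX Q) q = 0 := by
  obtain ⟨hTx, hTu⟩ := h.pd_compT hI
  rintro ⟨t, x, u⟩ hq
  have hq' : t ∈ I := hq
  have z := fun p r s n => totalD_eq_zero hI hTx hTu
    (j := jetOf t x u p r s (-(E.k t * u + E.f t * u ^ 2) * p - E.g t * s) n) hq'
  -- The second difference in u_xx at u_x = 0 isolates u_xx². Its coefficient is -3g ξ_u, because
  -- D_x²ξ contains u_xx ξ_u.
  have h0 := h.at_jetOf hI hq' x u 0 0 0 0 rfl
  have h1 := h.at_jetOf hI hq' x u 0 1 0 0 rfl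
  have h2 := h.at_jetOf hI hq' x u 0 (-1) 0 0 rfl
  have h3 : E.g t * pdu (compX Q) (t, x, u) = 0 := by
    simp only [etaX, etaXXX, z] at h0 h1 h2
    simp only [totalD1, totalD2, totalD3, jetOf, Jet.base] at h0 h1 h2
    linear_combination (-h1 - h2 + 2 * h0) / 6
  exact (mul_eq_zero.1 h3).resolve_left (E.g_ne_zero hq)

theorem GardnerEq.IsLieSymmetry.pd_compU (hI : IsOpen I) (h : E.IsLieSymmetry Q) :
    (∀ q ∈ dom I, pdu (pdu (compU Q)) q = 0) ∧
      (∀ q ∈ dom I, pdx (pdu (compU Q)) q = pdx (pdx (compX Q)) q) ∧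
      ∀ q ∈ dom I, E.g q.1 * pdt (compT Q) q + deriv E.g q.1 * compT Q q
        = 3 * E.g q.1 * pdx (compX Q) q := by
  obtain ⟨hTx, hTu⟩ := h.pd_compT hI
  have hXu := h.pd_compX hI
  have zT := fun t x u p r s n (hq : t ∈ I) => totalD_eq_zero hI hTx hTu
    (j := jetOf t x u p r s (-(E.k t * u + E.f t * u ^ 2) * p - E.g t * s) n) hq
  have zX := fun t x u p r s n (hq : t ∈ I) => totalD_of_pdu_eq_zero hI (contDiffOn_compX h.1) hXu
    (j := jetOf t x u p r s (-(E.k t * u + E.f t * u ^ 2) * p - E.g t * s) n) hq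
  have key : ∀ q ∈ dom I, ∀ p, pdx (pdu (compU Q)) q + p * pdu (pdu (compU Q)) q
      - pdx (pdx (compX Q)) q = 0 := by
    rintro ⟨t, x, u⟩ hq p
    have hq' : t ∈ I := hq
    -- The difference in u_xx isolates 3g(η_xu + p η_uu - ξ_xx), which then splits in p = u_x.
    have h0 := h.at_jetOf hI hq' x u p 0 0 0 rfl
    have h1 := h.at_jetOf hI hq' x u p 1 0 0 rfl
    have hc := pd_comm hI (contDiffOn_compU h.1) (0, 0, 1) (0, 1, 0) hq
    have h2 : E.g t * (pdx (pdu (compU Q)) (t, x, u) + p * pdu (pdu (compU Q)) (t, x, u)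
        - pdx (pdx (compX Q)) (t, x, u)) = 0 := by
      simp only [etaX, etaXXX, zT _ _ _ _ _ _ _ hq', zX _ _ _ _ _ _ _ hq'] at h0 h1
      simp only [totalD1, totalD2, totalD3, jetOf, Jet.base, hc] at h0 h1
      linear_combination (h1 - h0) / 3
    exact (mul_eq_zero.1 h2).resolve_left (E.g_ne_zero hq)
  refine ⟨fun q hq => ?_, fun q hq => ?_, ?_⟩
  · linear_combination key q hq 1 - key q hq 0
  · linear_combination key q hq 0
  · rintro ⟨t, x, u⟩ hq
    have hq' : t ∈ I := hq
    -- At u_x = u_xx = 0 the equation reads u_t = -g u_xxx, so the contributions of η_u from u_t and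
    -- from u_xxx cancel.
    have h0 := h.at_jetOf hI hq' x u 0 0 0 0 rfl
    have h1 := h.at_jetOf hI hq' x u 0 0 1 0 rfl
    simp only [etaX, etaXXX, zT _ _ _ _ _ _ _ hq', zX _ _ _ _ _ _ _ hq'] at h0 h1
    simp only [totalD1, totalD2, totalD3, jetOf, Jet.base] at h0 h1
    linear_combination h1 - h0 + E.g t ^ 2 * hTu _ hq

/-- Every Lie symmetry operator is of the form `T(t) ∂_t + (a x + X(t)) ∂_x + (b u + c) ∂_u`. -/
theorem GardnerEq.IsLieSymmetry.exists_symData (hI : IsOpenInterval I) (h : E.IsLieSymmetry Q) :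
    ∃ (a b c : ℝ) (T X : ℝ → ℝ), E.SymData a b c T X ∧ ∀ q ∈ dom I, Q q = affField a b c T X q := by
  have hO := hI.isOpen
  have sT := contDiffOn_compT h.1
  have sX := contDiffOn_compX h.1
  have sU := contDiffOn_compU h.1
  obtain ⟨hTx, hTu⟩ := h.pd_compT hO
  have hXu := h.pd_compX hO
  obtain ⟨hUuu, hUxu, hg⟩ := h.pd_compU hO
  have vT : ∀ t ∈ I, ∀ x u, compT Q (t, x, u) = compT Q (t, 0, 0) := fun t ht x u =>
    eq_of_pdx_pdu_eq_zero hO sT hTx hTu ht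
  have vTt : ∀ t ∈ I, ∀ x u, pdt (compT Q) (t, x, u) = pdt (compT Q) (t, 0, 0) := by
    intro t ht x u
    refine eq_of_pdx_pdu_eq_zero hO (contDiffOn_pd hO _ sT) (fun q hq => ?_) (fun q hq => ?_) ht
    · rw [pd_comm hO sT _ _ hq]; exact pd_eq_zero_of_eqOn_const hO hTx _ _ hq
    · rw [pd_comm hO sT _ _ hq]; exact pd_eq_zero_of_eqOn_const hO hTu _ _ hq
  -- The equation for g expresses ξ_x through τ and τ_t, which depend on t alone.
  have vXx : ∀ t ∈ I, ∀ x u, pdx (compX Q) (t, x, u) = pdx (compX Q) (t, 0, 0) := by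
    intro t ht x u
    have h1 := hg (t, x, u) ht
    have h2 := hg (t, 0, 0) ht
    dsimp only at h1 h2
    rw [vT t ht, vTt t ht] at h1
    exact mul_left_cancel₀ (mul_ne_zero three_ne_zero (E.g_ne_zero ht)) (h1.symm.trans h2)
  have hXxx : ∀ q ∈ dom I, pdx (pdx (compX Q)) q = 0 :=
    pdx_eq_zero_of_indep hO (contDiffOn_pd hO _ sX) fun t ht x u => by
      rw [vXx t ht x u, vXx t ht 0 u]
  have hUxu' : ∀ q ∈ dom I, pdx (pdu (compU Q)) q = 0 := fun q hq => by
    rw [hUxu q hq, hXxx q hq]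
  have hXxxx : ∀ q ∈ dom I, pdx (pdx (pdx (compX Q))) q = 0 :=
    pd_eq_zero_of_eqOn_const hO hXxx _
  -- With u_xx = u_xxx = 0 the condition is affine in p = u_x. The part linear in p is `redp`, and
  -- the part free of p later gives η_t = 0.
  have red : ∀ t ∈ I, ∀ x u p, pdt (compU Q) (t, x, u)
      + (E.k t * u + E.f t * u ^ 2) * pdx (compU Q) (t, x, u)
      + E.g t * pdx (pdx (pdx (compU Q))) (t, x, u)
      + p * ((E.k t * u + E.f t * u ^ 2) * (pdt (compT Q) (t, x, u) - pdx (compX Q) (t, x, u))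
        - pdt (compX Q) (t, x, u) + deriv E.k t * compT Q (t, x, u) * u + E.k t * compU Q (t, x, u)
        + deriv E.f t * compT Q (t, x, u) * u ^ 2 + 2 * E.f t * u * compU Q (t, x, u)) = 0 := by
    intro t ht x u p
    have h0 := h.at_jetOf hO ht x u p 0 0 0 rfl
    have hj : (jetOf t x u p 0 0 (-(E.k t * u + E.f t * u ^ 2) * p - E.g t * 0) 0).1 ∈ I := ht
    have hm : (t, x, u) ∈ dom I := ht
    simp only [etaX, etaXXX, totalD_eq_zero hO hTx hTu hj, totalD_of_pdu_eq_zero hO sX hXu hj,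
      totalD_of_affine hO sU hUuu hUxu' hj] at h0
    simp only [totalD1, jetOf, Jet.base, hTu _ hm, hXu _ hm, hXxx _ hm, hXxxx _ hm] at h0
    linear_combination h0
  have redp : ∀ t ∈ I, ∀ x u,
      (E.k t * u + E.f t * u ^ 2) * (pdt (compT Q) (t, 0, 0) - pdx (compX Q) (t, 0, 0))
        - pdt (compX Q) (t, x, 0) + deriv E.k t * compT Q (t, 0, 0) * u + E.k t * compU Q (t, x, u)
        + deriv E.f t * compT Q (t, 0, 0) * u ^ 2 + 2 * E.f t * u * compU Q (t, x, u) = 0 := by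
    intro t ht x u
    have hXt : pdt (compX Q) (t, x, u) = pdt (compX Q) (t, x, 0) :=
      eq_of_pdu_eq_zero hO (contDiffOn_pd hO _ sX) (fun q hq => by
        rw [pd_comm hO sX _ _ hq]; exact pd_eq_zero_of_eqOn_const hO hXu _ _ hq) ht
    rw [← hXt, ← vT t ht x u, ← vTt t ht x u, ← vXx t ht x u]
    linear_combination red t ht x u 1 - red t ht x u 0
  have vUu : ∀ t ∈ I, ∀ x u, pdu (compU Q) (t, x, u) = pdu (compU Q) (t, 0, 0) := fun t ht x u =>
    eq_of_pdx_pdu_eq_zero hO (contDiffOn_pd hO _ sU) hUxu' hUuu ht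
  have vU : ∀ t ∈ I, ∀ x u,
      compU Q (t, x, u) = compU Q (t, x, 0) + pdu (compU Q) (t, 0, 0) * u := fun t ht x u =>
    eq_add_mul_of_pdu_eq hO sU ht fun s => vUu t ht x s
  -- Since η is affine in u, `redp` is quadratic in u. Its values at u = 0, 1, -1 give the
  -- coefficients of u² here and of u in `eqk`.
  have eqf : ∀ t ∈ I, E.f t * (pdt (compT Q) (t, 0, 0) - pdx (compX Q) (t, 0, 0))
      + deriv E.f t * compT Q (t, 0, 0) + 2 * E.f t * pdu (compU Q) (t, 0, 0) = 0 := by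
    intro t ht
    have h0 := redp t ht 0 0
    have h1 := redp t ht 0 1
    have h2 := redp t ht 0 (-1)
    rw [vU t ht] at h1 h2
    linear_combination (h1 + h2 - 2 * h0) / 2
  have eqk : ∀ t ∈ I, ∀ x, E.k t * (pdt (compT Q) (t, 0, 0) - pdx (compX Q) (t, 0, 0))
      + deriv E.k t * compT Q (t, 0, 0) + E.k t * pdu (compU Q) (t, 0, 0)
      + 2 * E.f t * compU Q (t, x, 0) = 0 := by
    intro t ht x
    have h1 := redp t ht x 1
    have h2 := redp t ht x (-1)
    rw [vU t ht] at h1 h2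
    linear_combination (h1 - h2) / 2
  -- In `eqk` only the term 2f η(t, x, 0) involves x, and f does not vanish.
  have vU0 : ∀ t ∈ I, ∀ x, compU Q (t, x, 0) = compU Q (t, 0, 0) := by
    intro t ht x
    refine mul_left_cancel₀ (mul_ne_zero two_ne_zero (E.f_ne_zero ht)) ?_
    linear_combination eqk t ht x - eqk t ht 0
  have hUx : ∀ q ∈ dom I, pdx (compU Q) q = 0 := pdx_eq_zero_of_indep hO sU fun t ht x u => by
    rw [vU t ht x u, vU t ht 0 u, vU0 t ht]
  have hUxxx := pd_eq_zero_of_eqOn_const hO (pd_eq_zero_of_eqOn_const hO hUx (0, 1, 0)) (0, 1, 0)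
  have hUt : ∀ q ∈ dom I, pdt (compU Q) q = 0 := by
    rintro ⟨t, x, u⟩ hq
    have h0 := red t hq x u 0
    rw [hUx _ hq, hUxxx _ hq] at h0
    linear_combination h0
  obtain ⟨b, hb⟩ := exists_const_of_pd_eq_zero hI (contDiffOn_pd hO (0, 0, 1) sU)
    (fun q hq => by rw [pd_comm hO sU _ _ hq]; exact pd_eq_zero_of_eqOn_const hO hUt _ _ hq)
    hUxu' hUuu
  obtain ⟨t₀, ht₀⟩ := hI.nonempty
  have vUc : ∀ t ∈ I, compU Q (t, 0, 0) = compU Q (t₀, 0, 0) := fun t ht =>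
    hI.eq_of_hasDerivAt_zero (F := fun s => compU Q (s, 0, 0)) (fun s hs => by
      have hm : (s, 0, 0) ∈ dom I := hs
      have := hasDerivAt_t (differentiableAt_of_mem_dom hO sU hm)
      rwa [hUt _ hm] at this) ht ht₀
  -- This is the coefficient of u⁰ in `redp`. Being independent of x, it makes ξ_x constant in time
  -- as well.
  have vXt : ∀ t ∈ I, ∀ x u, pdt (compX Q) (t, x, u) = compU Q (t₀, 0, 0) * E.k t := by
    intro t ht x u
    have h0 := redp t ht x 0
    rw [vU0 t ht, vUc t ht] at h0
    rw [eq_of_pdu_eq_zero hO (contDiffOn_pd hO _ sX) (fun q hq => by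
        rw [pd_comm hO sX _ _ hq]; exact pd_eq_zero_of_eqOn_const hO hXu _ _ hq) ht]
    linear_combination -h0
  have hXtx : ∀ q ∈ dom I, pdx (pdt (compX Q)) q = 0 :=
    pdx_eq_zero_of_indep hO (contDiffOn_pd hO _ sX) fun t ht x u => by rw [vXt t ht, vXt t ht]
  obtain ⟨a, ha⟩ := exists_const_of_pd_eq_zero hI (contDiffOn_pd hO (0, 1, 0) sX)
    (fun q hq => by rw [pd_comm hO sX _ _ hq, hXtx q hq]) hXxx
    (fun q hq => by rw [pd_comm hO sX _ _ hq]; exact pd_eq_zero_of_eqOn_const hO hXu _ _ hq)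
  have cT : ContDiffOn ℝ ∞ (fun t : ℝ => ((t, 0, 0) : Pt)) I := by fun_prop
  have dT : ∀ t ∈ I, deriv (fun t => compT Q (t, 0, 0)) t = pdt (compT Q) (t, 0, 0) :=
    fun t ht => (hasDerivAt_t (p := (t, 0, 0))
      (differentiableAt_of_mem_dom hO sT (show _ ∈ dom I from ht))).deriv
  refine ⟨a, b, compU Q (t₀, 0, 0), fun t => compT Q (t, 0, 0), fun t => compX Q (t, 0, 0),
    ⟨sT.comp cT fun t ht => ht, sX.comp cT fun t ht => ht, fun t ht => ?_, fun t ht => ?_,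
      fun t ht => ?_, fun t ht => ?_⟩, ?_⟩
  · have := hg (t, 0, 0) ht
    rw [ha (t, 0, 0) ht] at this
    rw [dT t ht]
    linear_combination this
  · have := eqf t ht
    rw [ha (t, 0, 0) ht, hb (t, 0, 0) ht] at this
    rw [dT t ht]
    linear_combination this
  · have := eqk t ht 0
    rw [ha (t, 0, 0) ht, hb (t, 0, 0) ht, vUc t ht] at this
    rw [dT t ht]
    linear_combination this
  · rw [← vXt t ht 0 0]
    exact hasDerivAt_t (p := (t, 0, 0))
      (differentiableAt_of_mem_dom hO sX (show _ ∈ dom I from ht))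
  · rintro ⟨t, x, u⟩ hq
    have e1 : compT Q (t, x, u) = compT Q (t, 0, 0) := vT t hq x u
    have e2 : compX Q (t, x, u) = a * x + compX Q (t, 0, 0) := by
      rw [eq_add_mul_of_pdx_eq hO sX hq fun s => ha _ hq, eq_of_pdu_eq_zero hO sX hXu hq, add_comm]
    have e3 : compU Q (t, x, u) = b * u + compU Q (t₀, 0, 0) := by
      rw [vU t hq, vU0 t hq, vUc t hq, hb (t, 0, 0) hq, add_comm]
    exact Prod.ext e1 (Prod.ext e2 e3)

/-- The determining equations are sufficient. -/
theorem GardnerEq.SymData.isLieSymmetry (hI : IsOpen I) {a b c : ℝ} {T X : ℝ → ℝ}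
    (h : E.SymData a b c T X) : E.IsLieSymmetry (affField a b c T X) := by
  have cf : ContDiffOn ℝ ∞ (fun p : Pt => p.1) (dom I) := contDiffOn_fst
  have hT : ContDiffOn ℝ ∞ (fun p : Pt => T p.1) (dom I) := h.smooth_T.comp cf fun p hp => hp
  have hX : ContDiffOn ℝ ∞ (fun p : Pt => X p.1) (dom I) := h.smooth_X.comp cf fun p hp => hp
  have cx : ContDiffOn ℝ ∞ (fun p : Pt => a * p.2.1) (dom I) := by fun_prop
  have cu : ContDiffOn ℝ ∞ (fun p : Pt => b * p.2.2 + c) (dom I) := by fun_prop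
  have hQ : ContDiffOn ℝ ∞ (affField a b c T X) (dom I) := hT.prodMk ((cx.add hX).prodMk cu)
  refine ⟨hQ, fun j hj he => ?_⟩
  set Q := affField a b c T X with hQd
  have sT := contDiffOn_compT hQ
  have sX := contDiffOn_compX hQ
  have sU := contDiffOn_compU hQ
  have dT : ∀ t ∈ I, HasDerivAt T (deriv T t) t := fun t ht =>
    ((h.smooth_T.differentiableOn (by simp)).differentiableAt (hI.mem_nhds ht)).hasDerivAt
  have dif := fun {F : Pt → ℝ} (hF : ContDiffOn ℝ ∞ F (dom I)) q (hq : q ∈ dom I) =>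
    differentiableAt_of_mem_dom hI hF hq
  have eTt : ∀ q ∈ dom I, pdt (compT Q) q = deriv T q.1 := fun q hq =>
    (hasDerivAt_t (dif sT q hq)).unique (dT _ hq)
  have eTx : ∀ q ∈ dom I, pdx (compT Q) q = 0 := fun q hq =>
    (hasDerivAt_x (dif sT q hq)).unique (hasDerivAt_const _ (T q.1))
  have eTu : ∀ q ∈ dom I, pdu (compT Q) q = 0 := fun q hq =>
    (hasDerivAt_u (dif sT q hq)).unique (hasDerivAt_const _ (T q.1))
  have eXt : ∀ q ∈ dom I, pdt (compX Q) q = c * E.k q.1 := fun q hq =>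
    (hasDerivAt_t (dif sX q hq)).unique ((h.eq_X _ hq).const_add (a * q.2.1))
  have eXx : ∀ q ∈ dom I, pdx (compX Q) q = a := fun q hq =>
    (hasDerivAt_x (dif sX q hq)).unique
      ((((hasDerivAt_id q.2.1).const_mul a).add_const (X q.1)).congr_deriv (mul_one a))
  have eXu : ∀ q ∈ dom I, pdu (compX Q) q = 0 := fun q hq =>
    (hasDerivAt_u (dif sX q hq)).unique (hasDerivAt_const _ (a * q.2.1 + X q.1))
  have eUt : ∀ q ∈ dom I, pdt (compU Q) q = 0 := fun q hq =>
    (hasDerivAt_t (dif sU q hq)).unique (hasDerivAt_const _ (b * q.2.2 + c))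
  have eUx : ∀ q ∈ dom I, pdx (compU Q) q = 0 := fun q hq =>
    (hasDerivAt_x (dif sU q hq)).unique (hasDerivAt_const _ (b * q.2.2 + c))
  have eUu : ∀ q ∈ dom I, pdu (compU Q) q = b := fun q hq =>
    (hasDerivAt_u (dif sU q hq)).unique
      ((((hasDerivAt_id q.2.2).const_mul b).add_const c).congr_deriv (mul_one b))
  have eXxx := pd_eq_zero_of_eqOn_const hI eXx (0, 1, 0)
  have eXxxx := pd_eq_zero_of_eqOn_const hI eXxx (0, 1, 0)
  have eUxxx := pd_eq_zero_of_eqOn_const hI (pd_eq_zero_of_eqOn_const hI eUx (0, 1, 0)) (0, 1, 0)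
  have hb : j.base ∈ dom I := hj
  rw [lineDeriv_lhs hI E hQ hj, prolongCoeff_one_zero hI hQ hj]
  simp only [etaX, etaXXX, totalD_eq_zero hI eTx eTu hj, totalD_of_pdu_eq_zero hI sX eXu hj,
    totalD_of_affine hI sU (pd_eq_zero_of_eqOn_const hI eUu _)
      (pd_eq_zero_of_eqOn_const hI eUu _) hj]
  simp only [totalD1, eTt _ hb, eTu _ hb, eXt _ hb, eXx _ hb, eXu _ hb, eUt _ hb, eUx _ hb,
    eUu _ hb, eXxx _ hb, eXxxx _ hb, eUxxx _ hb]
  have e1 : compT Q j.base = T j.1 := rfl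
  have e2 : compU Q j.base = b * j.2.2 0 0 + c := rfl
  have e3 : j.base.1 = j.1 := rfl
  rw [e1, e2, e3]
  simp only [GardnerEq.lhs] at he
  -- Even off the equation, the prolongation applied to the left-hand side is (b - T') times that
  -- side plus multiples of the equations for g, k and f. The equation for X has entered through
  -- `eXt`.
  linear_combination (b - deriv T j.1) * he + j.2.2 0 3 * h.eq_g _ hj
    + j.2.2 0 0 * j.2.2 0 1 * h.eq_k _ hj + j.2.2 0 0 ^ 2 * j.2.2 0 1 * h.eq_f _ hj

theorem GardnerEq.mem_maxAlgebra_iff (hI : IsOpenInterval I) (E : GardnerEq I) {q : dom I → Pt} :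
    q ∈ E.maxAlgebra ↔ ∃ (a b c : ℝ) (T X : ℝ → ℝ), E.SymData a b c T X ∧
      q = restrictTo I (affField a b c T X) := by
  constructor
  · rintro ⟨Q, hQ, rfl⟩
    obtain ⟨a, b, c, T, X, h, h'⟩ := hQ.exists_symData hI
    exact ⟨a, b, c, T, X, h, funext fun p => h' p p.2⟩
  · rintro ⟨a, b, c, T, X, h, rfl⟩
    exact ⟨_, h.isLieSymmetry hI.isOpen, rfl⟩

end determining

/-! ### The maximal algebra as a vector space, and the kernel -/

theorem _root_.ContDiffOn.hasDerivAt_of_isOpen {I : Set ℝ} (hI : IsOpen I) {F : ℝ → ℝ}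
    (hF : ContDiffOn ℝ ∞ F I) {t : ℝ} (ht : t ∈ I) : HasDerivAt F (deriv F t) t :=
  ((hF.differentiableOn (by simp)).differentiableAt (hI.mem_nhds ht)).hasDerivAt

section algebra

variable {I : Set ℝ} {E : GardnerEq I} {a b c a' b' c' : ℝ} {T X T' X' : ℝ → ℝ}

theorem GardnerEq.SymData.add (hI : IsOpen I) (h : E.SymData a b c T X)
    (h' : E.SymData a' b' c' T' X') :
    E.SymData (a + a') (b + b') (c + c') (fun t => T t + T' t) (fun t => X t + X' t) := by
  have d : ∀ t ∈ I, deriv (fun t => T t + T' t) t = deriv T t + deriv T' t := fun t ht =>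
    ((h.smooth_T.hasDerivAt_of_isOpen hI ht).add (h'.smooth_T.hasDerivAt_of_isOpen hI ht)).deriv
  refine ⟨h.smooth_T.add h'.smooth_T, h.smooth_X.add h'.smooth_X, fun t ht => ?_, fun t ht => ?_,
    fun t ht => ?_, fun t ht => ?_⟩
  · rw [d t ht]; linear_combination h.eq_g t ht + h'.eq_g t ht
  · rw [d t ht]; linear_combination h.eq_f t ht + h'.eq_f t ht
  · rw [d t ht]; linear_combination h.eq_k t ht + h'.eq_k t ht
  · exact ((h.eq_X t ht).add (h'.eq_X t ht)).congr_deriv (by ring)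

theorem GardnerEq.SymData.smul (hI : IsOpen I) (s : ℝ) (h : E.SymData a b c T X) :
    E.SymData (s * a) (s * b) (s * c) (fun t => s * T t) (fun t => s * X t) := by
  have d : ∀ t ∈ I, deriv (fun t => s * T t) t = s * deriv T t := fun t ht =>
    ((h.smooth_T.hasDerivAt_of_isOpen hI ht).const_mul s).deriv
  refine ⟨contDiffOn_const.mul h.smooth_T, contDiffOn_const.mul h.smooth_X, fun t ht => ?_,
    fun t ht => ?_, fun t ht => ?_, fun t ht => ?_⟩
  · rw [d t ht]; linear_combination s * h.eq_g t ht
  · rw [d t ht]; linear_combination s * h.eq_f t ht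
  · rw [d t ht]; linear_combination s * h.eq_k t ht
  · exact ((h.eq_X t ht).const_mul s).congr_deriv (by ring)

theorem symData_const (E : GardnerEq I) (d : ℝ) :
    E.SymData 0 0 0 (fun _ => 0) (fun _ => d) := by
  refine ⟨contDiffOn_const, contDiffOn_const, ?_, ?_, ?_, fun t _ => ?_⟩
  · simp
  · simp
  · simp
  · simpa using hasDerivAt_const t d

theorem restrictTo_affField_const (d : ℝ) :
    restrictTo I (affField 0 0 0 (fun _ => 0) (fun _ => d)) = d • restrictTo I dX := by
  funext p
  simp [restrictTo, affField, vfield, dX]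

/-- The maximal Lie invariance algebra as a vector space. -/
def GardnerEq.maxSubmodule (hI : IsOpenInterval I) (E : GardnerEq I) :
    Submodule ℝ (dom I → Pt) where
  carrier := E.maxAlgebra
  add_mem' := by
    intro p q hp hq
    rw [E.mem_maxAlgebra_iff hI] at hp hq ⊢
    obtain ⟨a, b, c, T, X, h, rfl⟩ := hp
    obtain ⟨a', b', c', T', X', h', rfl⟩ := hq
    refine ⟨_, _, _, _, _, h.add hI.isOpen h', ?_⟩
    funext p
    simp only [restrictTo, affField, vfield, Pi.add_apply, Prod.mk_add_mk]
    exact Prod.ext rfl (Prod.ext (by ring) (by ring))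
  zero_mem' := by
    rw [E.mem_maxAlgebra_iff hI]
    exact ⟨0, 0, 0, _, _, symData_const E 0, by rw [restrictTo_affField_const, zero_smul]⟩
  smul_mem' := by
    intro s q hq
    rw [E.mem_maxAlgebra_iff hI] at hq ⊢
    obtain ⟨a, b, c, T, X, h, rfl⟩ := hq
    refine ⟨_, _, _, _, _, h.smul hI.isOpen s, ?_⟩
    funext p
    simp only [restrictTo, affField, vfield, Pi.smul_apply, Prod.smul_mk, smul_eq_mul]
    exact Prod.ext rfl (Prod.ext (by ring) (by ring))

theorem GardnerEq.smul_dX_mem (hI : IsOpenInterval I) (E : GardnerEq I) (d : ℝ) :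
    d • restrictTo I dX ∈ E.maxAlgebra :=
  (E.mem_maxAlgebra_iff hI).2 ⟨_, _, _, _, _, symData_const E d, (restrictTo_affField_const d).symm⟩

/-- For T = 0 the determining equations reduce to ag = 0, (a - 2b)f = 0 and (a - b)k = 2cf. Hence an
operator is fixed by its t-component up to a multiple of ∂_x, and the later computations of maximal
algebras only concern T. -/
theorem GardnerEq.SymData.eq_zero_of_time_eq_zero (hI : IsOpenInterval I)
    (h : E.SymData a b c T X) (hT : ∀ t ∈ I, T t = 0) : a = 0 ∧ b = 0 ∧ c = 0 := by
  obtain ⟨t, ht⟩ := hI.nonempty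
  have hd : deriv T t = 0 := by
    have : T =ᶠ[nhds t] fun _ => 0 :=
      Filter.eventuallyEq_of_mem (hI.isOpen.mem_nhds ht) fun s hs => hT s hs
    rw [this.deriv_eq, deriv_const]
  have eg := h.eq_g t ht
  have ef := h.eq_f t ht
  have ek := h.eq_k t ht
  rw [hd, hT t ht] at eg ef ek
  have ha : a = 0 := by
    refine (mul_eq_zero.1 (?_ : a * E.g t = 0)).resolve_right (E.g_ne_zero ht)
    linear_combination -eg / 3
  subst ha
  have hb : b = 0 := by
    refine (mul_eq_zero.1 (?_ : b * E.f t = 0)).resolve_right (E.f_ne_zero ht)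
    linear_combination ef / 2
  subst hb
  refine ⟨rfl, rfl, (mul_eq_zero.1 (?_ : c * E.f t = 0)).resolve_right (E.f_ne_zero ht)⟩
  linear_combination ek / 2

theorem GardnerEq.exists_smul_dX (hI : IsOpenInterval I) (E : GardnerEq I) {q : dom I → Pt}
    (hq : q ∈ E.maxAlgebra) (h0 : ∀ p, (q p).1 = 0) : ∃ d : ℝ, q = d • restrictTo I dX := by
  obtain ⟨a, b, c, T, X, h, rfl⟩ := (E.mem_maxAlgebra_iff hI).1 hq
  obtain ⟨rfl, rfl, rfl⟩ := h.eq_zero_of_time_eq_zero hI fun t ht => h0 ⟨(t, 0, 0), ht⟩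
  obtain ⟨t₀, ht₀⟩ := hI.nonempty
  refine ⟨X t₀, ?_⟩
  rw [← restrictTo_affField_const]
  funext p
  have hT : T p.1.1 = 0 := h0 p
  have hX : X p.1.1 = X t₀ :=
    hI.eq_of_hasDerivAt_zero (fun s hs => (h.eq_X s hs).congr_deriv (zero_mul _)) p.2 ht₀
  simp [restrictTo, affField, vfield, hT, hX]

/-- The equation `u_t + u u_x + e^t u² u_x + u_xxx = 0`, whose only symmetries are those of the kernel. -/
def expEq (I : Set ℝ) : GardnerEq I where
  k := fun _ => 1
  f := Real.exp
  g := fun _ => 1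
  smooth_k := contDiffOn_const
  smooth_f := Real.contDiff_exp.contDiffOn
  smooth_g := contDiffOn_const
  fg_ne_zero := fun t _ => by simp [Real.exp_ne_zero]

theorem IsOpenInterval.exists_ne (hI : IsOpenInterval I) : ∃ s ∈ I, ∃ t ∈ I, s < t := by
  obtain ⟨s, hs⟩ := hI.nonempty
  obtain ⟨e, he, h⟩ := Metric.isOpen_iff.1 hI.isOpen s hs
  refine ⟨s, hs, s + e / 2, h ?_, by linarith⟩
  rw [Metric.mem_ball, Real.dist_eq, add_sub_cancel_left, abs_of_pos] <;> linarith

theorem IsOpenInterval.coeff_eq_zero (hI : IsOpenInterval I) {m n : ℝ}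
    (h : ∀ t ∈ I, m * t + n = 0) : m = 0 ∧ n = 0 := by
  obtain ⟨s, hs, t, ht, hst⟩ := hI.exists_ne
  have hm : m = 0 := by
    refine (mul_eq_zero.1 (?_ : m * (t - s) = 0)).resolve_right (sub_ne_zero.2 hst.ne')
    linear_combination h t ht - h s hs
  refine ⟨hm, ?_⟩
  have := h s hs
  rwa [hm, zero_mul, zero_add] at this

theorem GardnerEq.SymData.time_eq_of_g_eq_one (hI : IsOpenInterval I) (h : E.SymData a b c T X)
    (hg : ∀ t ∈ I, E.g t = 1) :
    (∀ t ∈ I, deriv T t = 3 * a) ∧ ∃ d, ∀ t ∈ I, T t = 3 * a * t + d := by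
  have hd : ∀ t ∈ I, deriv T t = 3 * a := fun t ht => by
    have e := h.eq_g t ht
    have : E.g =ᶠ[nhds t] fun _ => 1 :=
      Filter.eventuallyEq_of_mem (hI.isOpen.mem_nhds ht) fun s hs => hg s hs
    rw [this.deriv_eq, deriv_const, hg t ht] at e
    linear_combination e
  obtain ⟨t₀, ht₀⟩ := hI.nonempty
  refine ⟨hd, T t₀ - 3 * a * t₀, fun t ht => ?_⟩
  have := hI.eq_of_hasDerivAt_zero (F := fun t => T t - 3 * a * t) (fun s hs => by
    have h1 := h.smooth_T.hasDerivAt_of_isOpen hI.isOpen hs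
    exact (h1.sub ((hasDerivAt_id s).const_mul (3 * a))).congr_deriv (by rw [hd s hs]; ring)) ht ht₀
  linarith

/-- For `expEq` the equation for f becomes 3at + 2a + 2b + d = 0, so a = 0 and d = -2b. The equation
for k becomes 2a + b + 2c e^t = 0, so c = 0 and b = 0. Hence T = 0. -/
theorem kernelAlgebra_eq (hI : IsOpenInterval I) :
    kernelAlgebra I = (Submodule.span ℝ {restrictTo I dX} : Submodule ℝ (dom I → Pt)) := by
  ext q
  simp only [kernelAlgebra, Set.mem_iInter, SetLike.mem_coe, Submodule.mem_span_singleton]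
  constructor
  · intro hall
    have hq := hall (expEq I)
    suffices h0 : ∀ p, (q p).1 = 0 by
      obtain ⟨d, hd⟩ := (expEq I).exists_smul_dX hI hq h0
      exact ⟨d, hd.symm⟩
    obtain ⟨a, b, c, T, X, h, he⟩ := ((expEq I).mem_maxAlgebra_iff hI).1 hq
    obtain ⟨hd, d, hT⟩ := h.time_eq_of_g_eq_one hI fun _ _ => rfl
    have e1 : ∀ t ∈ I, (3 * a) * t + (2 * a + 2 * b + d) = 0 := fun t ht => by
      have := h.eq_f t ht
      rw [hd t ht, hT t ht] at this
      simp only [expEq, Real.deriv_exp] at this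
      refine (mul_eq_zero.1 (?_ : Real.exp t * _ = 0)).resolve_left (Real.exp_ne_zero t)
      linear_combination this
    obtain ⟨ha, hb⟩ := hI.coeff_eq_zero e1
    have e2 : ∀ t ∈ I, 2 * a + b + 2 * c * Real.exp t = 0 := fun t ht => by
      have := h.eq_k t ht
      rw [hd t ht, hT t ht] at this
      simp only [expEq, deriv_const] at this
      linear_combination this
    obtain ⟨s, hs, t, ht, hst⟩ := hI.exists_ne
    have hc : c = 0 := by
      refine (mul_eq_zero.1 (?_ : c * (Real.exp t - Real.exp s) = 0)).resolve_right
        (sub_ne_zero.2 (Real.exp_lt_exp.2 hst).ne')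
      linear_combination (e2 t ht - e2 s hs) / 2
    have e3 := e2 t ht
    rw [hc] at e3
    intro p
    rw [he]
    change T p.1.1 = 0
    rw [hT _ p.2]
    linear_combination (p.1.1 + 2 / 3) * ha + hb - 2 * e3
  · rintro ⟨d, rfl⟩ E
    exact E.smul_dX_mem hI d

theorem GardnerEq.hasExtension_of_mem (hI : IsOpenInterval I) (E : GardnerEq I) {q : dom I → Pt}
    (hq : q ∈ E.maxAlgebra) {p : dom I} (hp : (q p).1 ≠ 0) : E.HasExtension := by
  refine ⟨Set.iInter_subset _ E, fun h => ?_⟩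
  have := h hq
  rw [kernelAlgebra_eq hI, SetLike.mem_coe, Submodule.mem_span_singleton] at this
  obtain ⟨d, rfl⟩ := this
  exact hp (by simp [restrictTo, dX, vfield])

theorem GardnerEq.HasExtension.exists_symData (hI : IsOpenInterval I) (h : E.HasExtension) :
    ∃ (a b c : ℝ) (T X : ℝ → ℝ), E.SymData a b c T X ∧ ∃ t ∈ I, T t ≠ 0 := by
  obtain ⟨q, hq, hn⟩ := Set.exists_of_ssubset h
  by_contra! hc
  obtain ⟨a, b, c, T, X, hs, he⟩ := (E.mem_maxAlgebra_iff hI).1 hq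
  obtain ⟨d, rfl⟩ := E.exists_smul_dX hI hq fun p => by
    rw [he]; exact hc a b c T X hs p.1.1 p.2
  refine hn ?_
  rw [kernelAlgebra_eq hI, SetLike.mem_coe, Submodule.mem_span_singleton]
  exact ⟨d, rfl⟩

/-- Symmetry operators of the equation, together with `∂_x`, form a basis of the maximal algebra as
soon as their `t`-components form a basis of the space of all possible `t`-components. -/
theorem GardnerEq.isBasis_vecCons (hI : IsOpenInterval I) (E : GardnerEq I) {n : ℕ}
    {V : Fin n → VField} (hV : ∀ i, restrictTo I (V i) ∈ E.maxAlgebra)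
    (hli : ∀ s : Fin n → ℝ, (∀ p ∈ dom I, ∑ i, s i * (V i p).1 = 0) → ∀ i, s i = 0)
    (hall : ∀ a b c T X, E.SymData a b c T X →
      ∃ s : Fin n → ℝ, ∀ p ∈ dom I, T p.1 = ∑ i, s i * (V i p).1) :
    E.IsBasisOfMaxAlgebra (Matrix.vecCons dX V) := by
  have fst_sum : ∀ (s : Fin n → ℝ) (p : dom I),
      ((∑ i, s i • restrictTo I (V i)) p).1 = ∑ i, s i * (V i p).1 := fun s p => by
    simp [restrictTo, Prod.fst_sum]
  constructor
  · rw [Fintype.linearIndependent_iff]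
    intro s hs
    simp only [Fin.sum_univ_succ, Matrix.cons_val_zero, Matrix.cons_val_succ] at hs
    have hz : ∀ i : Fin n, s i.succ = 0 := hli (fun i => s i.succ) fun p hp => by
      have := congrArg Prod.fst (congrFun hs ⟨p, hp⟩)
      rw [Pi.add_apply, Prod.fst_add, fst_sum (fun i => s i.succ)] at this
      simpa [restrictTo, dX, vfield] using this
    simp only [hz, zero_smul, Finset.sum_const_zero, add_zero] at hs
    obtain ⟨t, ht⟩ := hI.nonempty
    have h0 := congrArg (fun v : Pt => v.2.1) (congrFun hs ⟨(t, 0, 0), ht⟩)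
    simp only [restrictTo, dX, vfield, Pi.smul_apply, Prod.smul_mk, smul_eq_mul, mul_one,
      Pi.zero_apply, Prod.snd_zero, Prod.fst_zero] at h0
    intro i
    exact Fin.cases h0 hz i
  · have hsub : Submodule.span ℝ (Set.range fun i => restrictTo I (Matrix.vecCons dX V i))
        ≤ E.maxSubmodule hI := by
      rw [Submodule.span_le]
      rintro _ ⟨i, rfl⟩
      refine Fin.cases ?_ (fun i => hV i) i
      have := E.smul_dX_mem hI 1
      rwa [one_smul] at this
    refine Set.Subset.antisymm (fun q hq => ?_) hsub
    obtain ⟨a, b, c, T, X, h, he⟩ := (E.mem_maxAlgebra_iff hI).1 hq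
    obtain ⟨s, hs⟩ := hall a b c T X h
    have hV' : ∀ i, restrictTo I (V i) ∈ E.maxSubmodule hI := hV
    have hq' : q ∈ E.maxSubmodule hI := hq
    have hm : q - ∑ i, s i • restrictTo I (V i) ∈ E.maxSubmodule hI :=
      sub_mem hq' (sum_mem fun i _ => Submodule.smul_mem _ _ (hV' i))
    obtain ⟨d, hd⟩ := E.exists_smul_dX hI hm fun p => by
      rw [Pi.sub_apply, Prod.fst_sub, fst_sum, he, sub_eq_zero]
      exact hs p p.2
    rw [SetLike.mem_coe, Submodule.mem_span_range_iff_exists_fun]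
    refine ⟨Matrix.vecCons d s, ?_⟩
    simp only [Fin.sum_univ_succ, Matrix.cons_val_zero, Matrix.cons_val_succ]
    rw [← hd, sub_add_cancel]

/-- The case of an extension by a single operator, where all admissible t-components are multiples
of T. -/
theorem GardnerEq.isBasis_pair (hI : IsOpenInterval I) (E : GardnerEq I) {V : VField}
    (h : E.SymData a b c T X) (hV : ∀ p ∈ dom I, V p = affField a b c T X p)
    (hne : ∃ t ∈ I, T t ≠ 0)
    (hall : ∀ a' b' c' T' X', E.SymData a' b' c' T' X' → ∃ s, ∀ t ∈ I, T' t = s * T t) :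
    E.IsBasisOfMaxAlgebra ![dX, V] ∧ E.HasExtension := by
  have hm : restrictTo I V ∈ E.maxAlgebra :=
    (E.mem_maxAlgebra_iff hI).2 ⟨a, b, c, T, X, h, funext fun p => hV p p.2⟩
  have hT : ∀ p ∈ dom I, (V p).1 = T p.1 := fun p hp => by rw [hV p hp]; rfl
  obtain ⟨t, ht, htn⟩ := hne
  constructor
  · refine E.isBasis_vecCons hI (V := ![V]) (fun i => by simpa using hm) (fun s hs i => ?_) ?_
    · have := hs (t, 0, 0) ht
      rw [Fin.sum_univ_one] at this
      rw [Subsingleton.elim i 0]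
      refine (mul_eq_zero.1 this).resolve_right ?_
      rw [Matrix.cons_val_zero, hT _ ht]
      exact htn
    · intro a' b' c' T' X' h'
      obtain ⟨s, hs⟩ := hall a' b' c' T' X' h'
      refine ⟨fun _ => s, fun p hp => ?_⟩
      rw [Fin.sum_univ_one, Matrix.cons_val_zero, hT p hp, hs _ hp]
  · refine E.hasExtension_of_mem hI hm (p := ⟨(t, 0, 0), ht⟩) ?_
    rw [restrictTo, hT _ ht]
    exact htn

end algebra

/-! ### The maximal algebras of the equations of the tables -/

theorem hasDerivAt_rpow_of_pos (r : ℝ) {t : ℝ} (ht : 0 < t) :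
    HasDerivAt (fun s : ℝ => s ^ r) (r * (t ^ r / t)) t := by
  have := Real.hasDerivAt_rpow_const (x := t) (p := r) (Or.inl ht.ne')
  rwa [Real.rpow_sub_one ht.ne'] at this

section rows

variable {I : Set ℝ} {E : GardnerEq I} {a b c : ℝ} {T X F K F' K' : ℝ → ℝ}

theorem contDiffOn_of_hasDerivAt (hI : IsOpen I) (hK : ContDiffOn ℝ ∞ K I)
    (hX : ∀ t ∈ I, HasDerivAt X (K t) t) : ContDiffOn ℝ ∞ X I := by
  rw [contDiffOn_infty_iff_deriv_of_isOpen hI]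
  exact ⟨fun t ht => (hX t ht).differentiableAt.differentiableWithinAt,
    hK.congr fun t ht => (hX t ht).deriv⟩

theorem deriv_eq_of_eqOn (hI : IsOpen I) (h : ∀ t ∈ I, F t = K t)
    (hK : ∀ t ∈ I, HasDerivAt K (K' t) t) {t : ℝ} (ht : t ∈ I) : deriv F t = K' t := by
  have : F =ᶠ[nhds t] K := Filter.eventuallyEq_of_mem (hI.mem_nhds ht) fun s hs => h s hs
  rw [this.deriv_eq, (hK t ht).deriv]

/-- The determining equations for a linear function `T`, when `g = 1`. -/
theorem symData_of_coeffs (hI : IsOpen I) (d : ℝ) (hg : ∀ t ∈ I, E.g t = 1)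
    (hf : ∀ t ∈ I, E.f t = F t) (hk : ∀ t ∈ I, E.k t = K t)
    (hF : ∀ t ∈ I, HasDerivAt F (F' t) t) (hK : ∀ t ∈ I, HasDerivAt K (K' t) t)
    (eqF : ∀ t ∈ I, F t * (3 * a) + F' t * (3 * a * t + d) = (a - 2 * b) * F t)
    (eqK : ∀ t ∈ I, K t * (3 * a) + K' t * (3 * a * t + d) = (a - b) * K t - 2 * c * F t)
    (eqX : ∀ t ∈ I, HasDerivAt X (c * K t) t) :
    E.SymData a b c (fun t => 3 * a * t + d) X := by
  have hT : ∀ t, deriv (fun t => 3 * a * t + d) t = 3 * a := fun t =>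
    ((((hasDerivAt_id t).const_mul (3 * a)).add_const d).congr_deriv (mul_one _)).deriv
  have hX : ∀ t ∈ I, HasDerivAt X (c * E.k t) t := fun t ht => by rw [hk t ht]; exact eqX t ht
  refine ⟨by fun_prop, contDiffOn_of_hasDerivAt hI (contDiffOn_const.mul E.smooth_k) hX,
    fun t ht => ?_, fun t ht => ?_, fun t ht => ?_, hX⟩
  · rw [hT, deriv_eq_of_eqOn hI hg (K' := fun _ => 0) (fun t _ => hasDerivAt_const t 1) ht, hg t ht]
    ring
  · rw [hT, deriv_eq_of_eqOn hI hf hF ht, hf t ht, eqF t ht]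
  · rw [hT, deriv_eq_of_eqOn hI hk hK ht, hk t ht, hf t ht, eqK t ht]

variable {l₁ l₂ μ ρ : ℝ}

theorem hasDerivAt_const_mul_rpow (hpos : I ⊆ Set.Ioi 0) :
    ∀ t ∈ I, HasDerivAt (fun s => l₁ * s ^ ρ) (l₁ * (ρ * (t ^ ρ / t))) t := fun _ ht =>
  (hasDerivAt_rpow_of_pos ρ (hpos ht)).const_mul l₁

theorem hasDerivAt_pow_k (hpos : I ⊆ Set.Ioi 0) :
    ∀ t ∈ I, HasDerivAt (fun t => l₂ * t ^ ((3 * ρ - 2) / 6) + μ * t ^ ρ)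
      (l₂ * ((3 * ρ - 2) / 6 * (t ^ ((3 * ρ - 2) / 6) / t)) + μ * (ρ * (t ^ ρ / t))) t := fun t ht =>
  (hasDerivAt_const_mul_rpow hpos t ht).add (hasDerivAt_const_mul_rpow hpos t ht)

/-- Because t f' = ρ f, the equation for f divided by f/t is an affine identity in t, and both of
its coefficients vanish. -/
theorem GardnerEq.SymData.pow_f (hI : IsOpenInterval I) (h : E.SymData a b c T X)
    (hpos : I ⊆ Set.Ioi 0) (hl : l₁ ≠ 0) (hg : ∀ t ∈ I, E.g t = 1)
    (hf : ∀ t ∈ I, E.f t = l₁ * t ^ ρ) :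
    ∃ d, ρ * d = 0 ∧ 3 * a * ρ + 2 * a + 2 * b = 0 ∧ (∀ t ∈ I, deriv T t = 3 * a) ∧
      ∀ t ∈ I, T t = 3 * a * t + d := by
  obtain ⟨hd, d, hT⟩ := h.time_eq_of_g_eq_one hI hg
  have e : ∀ t ∈ I, (3 * a * ρ + 2 * a + 2 * b) * t + ρ * d = 0 := fun t ht => by
    have h0 : 0 < t := hpos ht
    have := h.eq_f t ht
    rw [deriv_eq_of_eqOn hI.isOpen hf (hasDerivAt_const_mul_rpow hpos) ht, hd t ht, hT t ht,
      hf t ht] at this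
    field_simp at this
    linear_combination this
  obtain ⟨e1, e2⟩ := hI.coeff_eq_zero e
  exact ⟨d, e2, e1, hd, hT⟩

/-- Serves all power rows of both tables, which differ only in the antiderivative X. The value of c
comes from the shift u + μ/(2l₁) that completes the square in μu + l₁u². If ρ = l₂ = 0, the
coefficients are constant and ∂_t is a further symmetry, which `hne` rules out. -/
theorem GardnerEq.isBasis_of_pow (hI : IsOpenInterval I) (hpos : I ⊆ Set.Ioi 0) (hl : l₁ ≠ 0)
    (hne : ρ ≠ 0 ∨ l₂ ≠ 0) (hg : ∀ t ∈ I, E.g t = 1) (hf : ∀ t ∈ I, E.f t = l₁ * t ^ ρ)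
    (hk : ∀ t ∈ I, E.k t = l₂ * t ^ ((3 * ρ - 2) / 6) + μ * t ^ ρ)
    (hb : b = -((3 * ρ + 2) / 2)) (hc : c = b * (1 / 2 * (μ / l₁)))
    (hX : ∀ t ∈ I, HasDerivAt X (c * (l₂ * t ^ ((3 * ρ - 2) / 6) + μ * t ^ ρ)) t)
    {V : VField} (hV : ∀ p ∈ dom I, V p = (3 * p.1, p.2.1 + X p.1, b * p.2.2 + c)) :
    E.IsBasisOfMaxAlgebra ![dX, V] ∧ E.HasExtension := by
  have hs : E.SymData 1 b c (fun t => 3 * 1 * t + 0) X := by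
    refine symData_of_coeffs hI.isOpen 0 hg hf hk (hasDerivAt_const_mul_rpow hpos)
      (hasDerivAt_pow_k hpos) (fun t ht => ?_) (fun t ht => ?_) hX
    · have h0 : 0 < t := hpos ht
      rw [hb]; field_simp; ring
    · have h0 : 0 < t := hpos ht
      rw [hc, hb]; field_simp; ring
  obtain ⟨s, hs', t, ht, hst⟩ := hI.exists_ne
  refine E.isBasis_pair hI hs (fun p hp => ?_) ⟨t, ht, ?_⟩ fun a' b' c' T' X' h' => ⟨a', ?_⟩
  · rw [hV p hp]
    exact Prod.ext (by simp [affField, vfield]) (Prod.ext (by simp [affField, vfield]) rfl)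
  · have h0 : 0 < t := hpos ht
    positivity
  · obtain ⟨d, e1, e2, hd, hT⟩ := h'.pow_f hI hpos hl hg hf
    suffices d = 0 by
      intro t ht
      rw [hT t ht, this]; ring
    -- For ρ = 0 the equation for f leaves d free. In the equation for k it then appears as l₂ d
    -- t^(-4/3) plus a constant, and since this power is not constant, d = 0.
    by_cases hρ : ρ = 0
    · subst hρ
      have hl₂ : l₂ ≠ 0 := hne.resolve_left (fun h => h rfl)
      have e3 : ∀ t ∈ I, -(1 / 3) * l₂ * d * t ^ (-(4 / 3) : ℝ) + (a' * μ + 2 * c' * l₁) = 0 := by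
        intro t ht
        have h0 : 0 < t := hpos ht
        have := h'.eq_k t ht
        rw [deriv_eq_of_eqOn hI.isOpen hk (hasDerivAt_pow_k hpos) ht, hd t ht, hT t ht,
          hk t ht, hf t ht] at this
        have e4 : t ^ (-(4 / 3) : ℝ) = t ^ ((3 * 0 - 2) / 6 : ℝ) / t := by
          rw [← Real.rpow_sub_one h0.ne']; norm_num
        rw [e4]
        simp only [Real.rpow_zero] at this
        field_simp at this ⊢
        linear_combination this / 2 - 3 / 2 * t * (l₂ * t ^ ((3 * 0 - 2) / 6 : ℝ) + μ) * e2
      have e5 : t ^ (-(4 / 3) : ℝ) < s ^ (-(4 / 3) : ℝ) :=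
        Real.rpow_lt_rpow_of_neg (hpos hs') hst (by norm_num)
      have e6 : (l₂ * d) * (t ^ (-(4 / 3) : ℝ) - s ^ (-(4 / 3) : ℝ)) = 0 := by
        linear_combination -3 * (e3 t ht - e3 s hs')
      exact (mul_eq_zero.1 ((mul_eq_zero.1 e6).resolve_right (sub_ne_zero.2 e5.ne))).resolve_left hl₂
    · exact (mul_eq_zero.1 e1).resolve_left hρ

theorem GardnerEq.isBasis_rowI2 (hI : IsOpenInterval I) (hl : l₁ ≠ 0) (h : E.IsOfForm (rowI2 l₁)) :
    E.IsBasisOfMaxAlgebra (rowI2 l₁).basis ∧ E.HasExtension := by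
  have hpos : I ⊆ Set.Ioi 0 := h.subset
  have hlog : ∀ t ∈ I, HasDerivAt (fun t => Real.log |t|) t⁻¹ t := fun t ht => by
    simpa using Real.hasDerivAt_log (x := t) (ne_of_gt (hpos ht))
  -- The exponent -2/3 of f gives b = 0. The logarithm in k then requires 3a = -2c l₁, normalised by
  -- c = -1.
  have hs : E.SymData (2 / 3 * l₁) 0 (-1) (fun t => 3 * (2 / 3 * l₁) * t + 0)
      (fun t => -(3 * (Real.log |t| - 3) * t ^ (1 / 3 : ℝ))) := by
    refine symData_of_coeffs hI.isOpen 0 h.g_eq h.f_eq h.k_eq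
      (hasDerivAt_const_mul_rpow hpos)
      (fun t ht => (hasDerivAt_rpow_of_pos (-(2 / 3)) (hpos ht)).mul (hlog t ht))
      (fun t ht => ?_) (fun t ht => ?_) (fun t ht => ?_)
    · have h0 : 0 < t := hpos ht
      simp only [rowI2]; field_simp; ring
    · have h0 : 0 < t := hpos ht
      simp only [rowI2]; field_simp; ring
    · have h0 : 0 < t := hpos ht
      have h1 := ((((hlog t ht).sub_const 3).const_mul 3).mul
        (hasDerivAt_rpow_of_pos (1 / 3) h0)).neg
      have e : t ^ (-(2 / 3) : ℝ) = t ^ (1 / 3 : ℝ) / t := by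
        rw [← Real.rpow_sub_one h0.ne']; norm_num
      refine h1.congr_deriv ?_
      simp only [rowI2]; rw [e]; field_simp; ring
  obtain ⟨t, ht⟩ := hI.nonempty
  refine E.isBasis_pair hI hs (fun p hp => ?_) ⟨t, ht, ?_⟩ fun a' b' c' T' X' h' =>
    ⟨3 * a' / (2 * l₁), ?_⟩
  · simp only [affField, vfield]
    exact Prod.ext (by ring) (Prod.ext (by ring) (by ring))
  · have h0 : 0 < t := hpos ht
    have := mul_ne_zero hl h0.ne'
    intro e
    exact this (by linear_combination e / 2)
  · obtain ⟨d, e1, -, -, hT⟩ := h'.pow_f hI hpos hl h.g_eq h.f_eq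
    have hd : d = 0 := (mul_eq_zero.1 e1).resolve_left (by norm_num)
    intro t ht
    rw [hT t ht, hd]; field_simp; ring

/-- For an exponential f the equation for f is 3at + 2a + 2b + d = 0, so a = 0 and only constant T
survive. As before, c completes the square in u. -/
theorem GardnerEq.isBasis_of_exp (hI : IsOpenInterval I) (hl : l₁ ≠ 0)
    (hg : ∀ t ∈ I, E.g t = 1) (hf : ∀ t ∈ I, E.f t = l₁ * Real.exp t)
    (hk : ∀ t ∈ I, E.k t = l₂ * Real.exp (t / 2) + μ * Real.exp t)
    (hc : c = -(1 / 2 * (μ / l₁)))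
    (hX : ∀ t ∈ I, HasDerivAt X (c * (l₂ * Real.exp (t / 2) + μ * Real.exp t)) t)
    {V : VField} (hV : ∀ p ∈ dom I, V p = (2, X p.1, -p.2.2 + c)) :
    E.IsBasisOfMaxAlgebra ![dX, V] ∧ E.HasExtension := by
  have hF : ∀ t ∈ I, HasDerivAt (fun t => l₁ * Real.exp t) (l₁ * Real.exp t) t := fun t _ =>
    (Real.hasDerivAt_exp t).const_mul l₁
  have hK : ∀ t ∈ I, HasDerivAt (fun t => l₂ * Real.exp (t / 2) + μ * Real.exp t)
      (l₂ * (Real.exp (t / 2) * (1 / 2)) + μ * Real.exp t) t := fun t _ =>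
    (((hasDerivAt_id t).div_const 2).exp.const_mul l₂).add ((Real.hasDerivAt_exp t).const_mul μ)
  have hs : E.SymData 0 (-1) c (fun t => 3 * 0 * t + 2) X := by
    refine symData_of_coeffs hI.isOpen 2 hg hf hk hF hK (fun t ht => ?_) (fun t ht => ?_) hX
    · ring
    · rw [hc]; field_simp; ring
  obtain ⟨t, ht⟩ := hI.nonempty
  refine E.isBasis_pair hI hs (fun p hp => ?_) ⟨t, ht, ?_⟩ fun a' b' c' T' X' h' => ?_
  · rw [hV p hp]
    exact Prod.ext (by simp [affField, vfield]) (Prod.ext (by simp [affField, vfield])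
      (by simp [affField, vfield]))
  · norm_num
  · obtain ⟨hd, d, hT⟩ := h'.time_eq_of_g_eq_one hI hg
    have e : ∀ t ∈ I, (3 * a') * t + (2 * a' + 2 * b' + d) = 0 := fun t ht => by
      have := h'.eq_f t ht
      rw [deriv_eq_of_eqOn hI.isOpen hf hF ht, hd t ht, hT t ht, hf t ht] at this
      refine (mul_eq_zero.1 (?_ : (l₁ * Real.exp t) * _ = 0)).resolve_left
        (mul_ne_zero hl (Real.exp_ne_zero t))
      linear_combination this
    refine ⟨d / 2, fun t ht => ?_⟩
    rw [hT t ht, (hI.coeff_eq_zero e).1]; ring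

/-- Constant f gives a + b = 0. Then k = t turns its equation into 4at + d + 2c l₁ = 0, so T is
again constant. -/
theorem GardnerEq.isBasis_rowIII (hI : IsOpenInterval I) (hl : l₁ ≠ 0)
    (h : E.IsOfForm (rowIII l₁)) :
    E.IsBasisOfMaxAlgebra (rowIII l₁).basis ∧ E.HasExtension := by
  have hF : ∀ t ∈ I, HasDerivAt (rowIII l₁).f 0 t := fun t _ => hasDerivAt_const t l₁
  have hK : ∀ t ∈ I, HasDerivAt (rowIII l₁).k 1 t := fun t _ => hasDerivAt_id t
  have hs : E.SymData 0 0 (-1) (fun t => 3 * 0 * t + 2 * l₁) (fun t => -(1 / 2) * t ^ 2) := by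
    refine symData_of_coeffs hI.isOpen (2 * l₁) h.g_eq h.f_eq h.k_eq hF hK
      (fun t ht => ?_) (fun t ht => ?_) (fun t ht => ?_)
    · ring
    · simp only [rowIII]; ring
    · refine ((hasDerivAt_pow 2 t).const_mul (-(1 / 2))).congr_deriv ?_
      simp only [rowIII]; norm_num; ring
  obtain ⟨t, ht⟩ := hI.nonempty
  refine E.isBasis_pair hI hs (fun p hp => ?_) ⟨t, ht, ?_⟩ fun a' b' c' T' X' h' => ?_
  · simp only [affField, vfield]
    exact Prod.ext (by ring) (Prod.ext (by ring) (by ring))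
  · simpa using hl
  · obtain ⟨hd, d, hT⟩ := h'.time_eq_of_g_eq_one hI h.g_eq
    have e : ∀ t ∈ I, (4 * a') * t + (d + 2 * c' * l₁) = 0 := fun t ht => by
      have h1 := h'.eq_f t ht
      have h2 := h'.eq_k t ht
      rw [deriv_eq_of_eqOn hI.isOpen h.f_eq hF ht, hd t ht, hT t ht, h.f_eq t ht] at h1
      rw [deriv_eq_of_eqOn hI.isOpen h.k_eq hK ht, hd t ht, hT t ht, h.f_eq t ht, h.k_eq t ht] at h2
      simp only [rowIII] at h1 h2
      have hb : a' + b' = 0 := mul_left_cancel₀ hl (by linear_combination h1 / 2)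
      linear_combination h2 - t * hb
    refine ⟨d / (2 * l₁), fun t ht => ?_⟩
    rw [hT t ht]
    have := (hI.coeff_eq_zero e).1
    field_simp
    linear_combination (3 / 2 * t * l₁) * this

/-- Here all affine T occur: T = 1 and T = 3t both extend to symmetries and span the possible
t-components. -/
theorem GardnerEq.isBasis_of_const (hI : IsOpenInterval I) (hl : l₁ ≠ 0)
    (hg : ∀ t ∈ I, E.g t = 1) (hf : ∀ t ∈ I, E.f t = l₁) (hk : ∀ t ∈ I, E.k t = μ)
    (hc : c = -(1 / 2 * (μ / l₁))) {V : VField}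
    (hV : ∀ p ∈ dom I, V p = (3 * p.1, p.2.1 + c * μ * p.1, -p.2.2 + c)) :
    E.IsBasisOfMaxAlgebra ![dX, dT, V] ∧ E.HasExtension := by
  have hF : ∀ t ∈ I, HasDerivAt (fun _ => l₁) 0 t := fun t _ => hasDerivAt_const t l₁
  have hK : ∀ t ∈ I, HasDerivAt (fun _ => μ) 0 t := fun t _ => hasDerivAt_const t μ
  have h1 : E.SymData 0 0 0 (fun t => 3 * 0 * t + 1) (fun _ => 0) := by
    refine symData_of_coeffs hI.isOpen 1 hg hf hk hF hK
      (fun t ht => by ring) (fun t ht => by ring) fun t ht => ?_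
    simpa using hasDerivAt_const t (0 : ℝ)
  have h2 : E.SymData 1 (-1) c (fun t => 3 * 1 * t + 0) (fun t => c * μ * t) := by
    refine symData_of_coeffs hI.isOpen 0 hg hf hk hF hK
      (fun t ht => by ring) (fun t ht => by rw [hc]; field_simp; ring) fun t ht => ?_
    simpa using (hasDerivAt_id t).const_mul (c * μ)
  have m1 : restrictTo I dT ∈ E.maxAlgebra :=
    (E.mem_maxAlgebra_iff hI).2 ⟨_, _, _, _, _, h1, funext fun p => by
      simp [restrictTo, dT, affField, vfield]⟩
  have m2 : restrictTo I V ∈ E.maxAlgebra :=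
    (E.mem_maxAlgebra_iff hI).2 ⟨_, _, _, _, _, h2, funext fun p => by
      rw [restrictTo, hV p p.2]; simp [restrictTo, affField, vfield]⟩
  have hsum : ∀ (s : Fin 2 → ℝ), ∀ p ∈ dom I,
      ∑ i, s i * ((![dT, V] : Fin 2 → VField) i p).1 = 3 * s 1 * p.1 + s 0 := fun s p hp => by
    rw [Fin.sum_univ_two, Matrix.cons_val_zero, Matrix.cons_val_one, Matrix.cons_val_zero, hV p hp]
    simp only [dT, vfield]; ring
  obtain ⟨t, ht⟩ := hI.nonempty
  refine ⟨E.isBasis_vecCons hI (V := ![dT, V]) (fun i => ?_) (fun s hs => ?_) ?_,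
    E.hasExtension_of_mem hI m1 (p := ⟨(t, 0, 0), ht⟩) (by simp [restrictTo, dT, vfield])⟩
  · fin_cases i
    · exact m1
    · exact m2
  · obtain ⟨e1, e2⟩ := hI.coeff_eq_zero (m := 3 * s 1) (n := s 0) fun t ht => by
      rw [← hsum s (t, 0, 0) ht]; exact hs _ ht
    intro i
    fin_cases i
    · exact e2
    · exact (mul_eq_zero.1 e1).resolve_left three_ne_zero
  · intro a' b' c' T' X' h'
    obtain ⟨-, d, hT⟩ := h'.time_eq_of_g_eq_one hI hg
    refine ⟨![d, a'], fun p hp => ?_⟩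
    rw [hsum _ p hp, hT _ hp]
    simp

end rows

theorem isBasis_of_mem_table1 {ca : Case1} {r : Row} (hr : r ∈ table1 ca) {I : Set ℝ}
    (hI : IsOpenInterval I) {E : GardnerEq I} (h : E.IsOfForm r) :
    E.IsBasisOfMaxAlgebra r.basis ∧ E.HasExtension := by
  cases ca with
  | I1 =>
    obtain ⟨l₁, l₂, ρ, δ, ϰ, hl, h4, h1, -, hne, hϰ, rfl⟩ := hr
    have hne' : ρ ≠ 0 ∨ l₂ ≠ 0 := by
      by_contra! hc
      exact hne (Prod.ext hc.1 hc.2)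
    have hpos : I ⊆ Set.Ioi 0 := h.subset
    -- The excluded exponents are those at which one of the two powers in k integrates to a
    -- logarithm. They form the separate rows `I3` and `I4`.
    have n4 : 3 * ρ + 4 ≠ 0 := fun e => h4 (by linarith)
    have n1 : ρ + 1 ≠ 0 := fun e => h1 (by linarith)
    refine GardnerEq.isBasis_of_pow hI hpos hl hne' h.g_eq h.f_eq h.k_eq
      (X := fun t => -(ϰ * ((3 * ρ + 2) / 2) *
        (6 * l₂ / (3 * ρ + 4) * t ^ ((3 * ρ + 4) / 6) + δ / (ρ + 1) * t ^ (ρ + 1)))) rfl rfl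
      (fun t ht => ?_) (fun p hp => ?_)
    · have h0 : 0 < t := hpos ht
      have hd := ((((hasDerivAt_rpow_of_pos ((3 * ρ + 4) / 6) h0).const_mul
        (6 * l₂ / (3 * ρ + 4))).add ((hasDerivAt_rpow_of_pos (ρ + 1) h0).const_mul
        (δ / (ρ + 1)))).const_mul (ϰ * ((3 * ρ + 2) / 2))).neg
      refine hd.congr_deriv ?_
      rw [← Real.rpow_sub_one h0.ne', ← Real.rpow_sub_one h0.ne', hϰ,
        show (3 * ρ + 4) / 6 - 1 = (3 * ρ - 2) / 6 by ring, add_sub_cancel_right]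
      field_simp
    · simp only [vfield, hϰ]
      exact Prod.ext rfl (Prod.ext (by ring) (by ring))
  | I2 =>
    obtain ⟨l₁, hl, rfl⟩ := hr
    exact GardnerEq.isBasis_rowI2 hI hl h
  | I3 =>
    obtain ⟨l₁, l₂, δ, ϰ, hl, -, hϰ, rfl⟩ := hr
    have hpos : I ⊆ Set.Ioi 0 := h.subset
    have ee : (3 * (-1 : ℝ) - 2) / 6 = -(5 / 6) := by norm_num
    refine GardnerEq.isBasis_of_pow hI hpos hl (ρ := -1) (l₂ := l₂) (μ := δ) (Or.inl (by norm_num))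
      h.g_eq h.f_eq (fun t ht => by rw [h.k_eq t ht, ee])
      (X := fun t => ϰ * (3 * l₂ * t ^ (1 / 6 : ℝ) + 1 / 2 * δ * Real.log |t|)) rfl rfl
      (fun t ht => ?_) (fun p hp => ?_)
    · have h0 : 0 < t := hpos ht
      have hlog : HasDerivAt (fun t => Real.log |t|) t⁻¹ t := by
        simpa using Real.hasDerivAt_log (x := t) h0.ne'
      have hd := (((hasDerivAt_rpow_of_pos (1 / 6) h0).const_mul (3 * l₂)).add
        (hlog.const_mul (1 / 2 * δ))).const_mul ϰ
      refine hd.congr_deriv ?_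
      rw [← Real.rpow_sub_one h0.ne', hϰ, ee, Real.rpow_neg_one,
        show (1 / 6 - 1 : ℝ) = -(5 / 6) by norm_num]
      ring
    · simp only [vfield, hϰ]
      exact Prod.ext rfl (Prod.ext (by ring) (by ring))
  | I4 =>
    obtain ⟨l₁, l₂, δ, ϰ, hl, -, hϰ, rfl⟩ := hr
    have hpos : I ⊆ Set.Ioi 0 := h.subset
    have ee : (3 * (-(4 / 3) : ℝ) - 2) / 6 = -1 := by norm_num
    refine GardnerEq.isBasis_of_pow hI hpos hl (ρ := -(4 / 3)) (l₂ := l₂) (μ := δ)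
      (Or.inl (by norm_num)) h.g_eq h.f_eq (fun t ht => by rw [h.k_eq t ht, ee])
      (X := fun t => ϰ * (l₂ * Real.log |t| - 3 * δ * t ^ (-(1 / 3) : ℝ))) rfl rfl
      (fun t ht => ?_) (fun p hp => ?_)
    · have h0 : 0 < t := hpos ht
      have hlog : HasDerivAt (fun t => Real.log |t|) t⁻¹ t := by
        simpa using Real.hasDerivAt_log (x := t) h0.ne'
      have hd := ((hlog.const_mul l₂).sub
        ((hasDerivAt_rpow_of_pos (-(1 / 3)) h0).const_mul (3 * δ))).const_mul ϰ
      refine hd.congr_deriv ?_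
      rw [← Real.rpow_sub_one h0.ne', hϰ, ee, Real.rpow_neg_one,
        show (-(1 / 3) - 1 : ℝ) = -(4 / 3) by norm_num]
      ring
    · simp only [vfield, hϰ]
      exact Prod.ext rfl (Prod.ext (by ring) (by ring))
  | II =>
    obtain ⟨l₁, l₂, δ, ϰ, hl, -, hϰ, rfl⟩ := hr
    refine GardnerEq.isBasis_of_exp hI hl h.g_eq h.f_eq h.k_eq
      (X := fun t => -ϰ * (2 * l₂ * Real.exp (t / 2) + δ * Real.exp t)) rfl
      (fun t ht => ?_) (fun p hp => ?_)
    · refine (((((hasDerivAt_id t).div_const 2).exp.const_mul (2 * l₂)).add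
        ((Real.hasDerivAt_exp t).const_mul δ)).const_mul (-ϰ)).congr_deriv ?_
      simp only [id, hϰ]; ring
    · simp only [vfield, hϰ]
      exact Prod.ext rfl (Prod.ext rfl (by ring))
  | III =>
    obtain ⟨l₁, hl, rfl⟩ := hr
    exact GardnerEq.isBasis_rowIII hI hl h
  | IV =>
    obtain ⟨ε, δ, ϰ, hε, -, hϰ, rfl⟩ := hr
    have hl : ε ≠ 0 := by rcases hε with rfl | rfl <;> norm_num
    refine GardnerEq.isBasis_of_const hI hl h.g_eq h.f_eq h.k_eq rfl (fun p hp => ?_)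
    simp only [vfield, hϰ]
    exact Prod.ext rfl (Prod.ext (by ring) (by ring))

theorem isBasis_of_mem_table2 {ca : Case2} {r : Row} (hr : r ∈ table2 ca) {I : Set ℝ}
    (hI : IsOpenInterval I) {E : GardnerEq I} (h : E.IsOfForm r) :
    E.IsBasisOfMaxAlgebra r.basis ∧ E.HasExtension := by
  cases ca with
  | I1 =>
    obtain ⟨l₁, ρ, δ, hl, -, hne, rfl⟩ := hr
    have hne' : ρ ≠ 0 ∨ δ ≠ 0 := by
      by_contra! hc
      exact hne (Prod.ext hc.1 hc.2)
    refine GardnerEq.isBasis_of_pow hI h.subset hl hne' (μ := 0) h.g_eq h.f_eq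
      (fun t ht => by rw [h.k_eq t ht]; ring) (X := fun _ => 0) rfl rfl
      (fun t ht => ?_) (fun p hp => ?_)
    · simpa using hasDerivAt_const t (0 : ℝ)
    · simp [vfield]
  | I2 =>
    obtain ⟨l₁, hl, rfl⟩ := hr
    exact GardnerEq.isBasis_rowI2 hI hl h
  | II =>
    obtain ⟨l₁, δ, hl, -, rfl⟩ := hr
    refine GardnerEq.isBasis_of_exp hI hl (l₂ := δ) (μ := 0) h.g_eq h.f_eq
      (fun t ht => by rw [h.k_eq t ht]; ring) (X := fun _ => 0) rfl (fun t ht => ?_) (fun p hp => ?_)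
    · simpa using hasDerivAt_const t (0 : ℝ)
    · simp [vfield]
  | III =>
    obtain ⟨l₁, hl, rfl⟩ := hr
    exact GardnerEq.isBasis_rowIII hI hl h
  | IV =>
    obtain ⟨ε, hε, rfl⟩ := hr
    have hl : ε ≠ 0 := by rcases hε with rfl | rfl <;> norm_num
    refine GardnerEq.isBasis_of_const hI hl (μ := 0) h.g_eq h.f_eq h.k_eq rfl (fun p hp => ?_)
    simp [vfield]

/-! ### Construction of equivalence transformations -/

section transformations

variable {I : Set ℝ}

theorem IsOpenInterval.exists_antideriv (hI : IsOpenInterval I) {h : ℝ → ℝ}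
    (hh : ContinuousOn h I) : ∃ H : ℝ → ℝ, ∀ t ∈ I, HasDerivAt H (h t) t := by
  obtain ⟨t₀, ht₀⟩ := hI.nonempty
  refine ⟨fun t => ∫ s in t₀..t, h s, fun t ht => ?_⟩
  have hsub : Set.uIcc t₀ t ⊆ I := hI.ordConnected.uIcc_subset ht₀ ht
  exact intervalIntegral.integral_hasDerivAt_right (hh.mono hsub).intervalIntegrable
    (hh.stronglyMeasurableAtFilter hI.isOpen t ht) (hh.continuousAt (hI.isOpen.mem_nhds ht))

theorem IsOpenInterval.injOn_of_deriv_ne_zero (hI : IsOpenInterval I) {F F' : ℝ → ℝ}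
    (hF : ∀ t ∈ I, HasDerivAt F (F' t) t) (hn : ∀ t ∈ I, F' t ≠ 0) : Set.InjOn F I := by
  have key : ∀ s ∈ I, ∀ t ∈ I, s < t → F s ≠ F t := by
    intro s hs t ht hst he
    have hsub : Set.Icc s t ⊆ I := hI.ordConnected.out hs ht
    obtain ⟨c, hc, h0⟩ := exists_hasDerivAt_eq_zero hst
      (fun r hr => (hF r (hsub hr)).continuousAt.continuousWithinAt) he
      (fun r hr => hF r (hsub (Set.Ioo_subset_Icc_self hr)))
    exact hn c (hsub (Set.Ioo_subset_Icc_self hc)) h0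
  intro s hs t ht he
  rcases lt_trichotomy s t with h | h | h
  · exact absurd he (key s hs t ht h)
  · exact h
  · exact absurd he.symm (key t ht s hs h)

theorem IsOpenInterval.image (hI : IsOpenInterval I) {F : ℝ → ℝ} (hF : ContDiffOn ℝ ∞ F I)
    (hn : ∀ t ∈ I, deriv F t ≠ 0) : IsOpenInterval (F '' I) := by
  refine ⟨isOpen_iff_mem_nhds.2 ?_, (hI.isPreconnected.image F hF.continuousOn).ordConnected,
    hI.nonempty.image F⟩
  rintro _ ⟨t, ht, rfl⟩
  have hs : HasStrictDerivAt F (deriv F t) t :=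
    (hF.contDiffAt (hI.isOpen.mem_nhds ht)).hasStrictDerivAt (by simp)
  rw [← hs.map_nhds_eq (hn t ht)]
  exact Filter.image_mem_map (hI.isOpen.mem_nhds ht)

/-- An equation whose coefficients have, up to the constants `p`, `q`, `d₂`, `d₃`, the form
prescribed by a line of a table is equivalent to an equation from that line. -/
theorem GardnerEq.exists_equiv (hI : IsOpenInterval I) (E : GardnerEq I) {G : ℝ → ℝ}
    (hG : ∀ t ∈ I, HasDerivAt G (E.g t) t) {p : ℝ} (q : ℝ) {d₂ : ℝ} (d₃ : ℝ) (hp : p ≠ 0)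
    (hd₂ : d₂ ≠ 0) {r : Row} (hrf : ContDiffOn ℝ ∞ r.f r.timeDomain)
    (hrk : ContDiffOn ℝ ∞ r.k r.timeDomain) (hdom : ∀ t ∈ I, p ^ 3 * G t + q ∈ r.timeDomain)
    (hf : ∀ t ∈ I, r.f (p ^ 3 * G t + q) * (p ^ 2 * d₂ ^ 2) * E.g t = E.f t)
    (hk : ∀ t ∈ I, r.k (p ^ 3 * G t + q) * (p ^ 2 * d₂) * E.g t
      = E.k t - 2 * (d₃ / d₂) * E.f t) :
    ∃ (I' : Set ℝ) (E' : GardnerEq I'), IsOpenInterval I' ∧ E'.IsOfForm r ∧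
      ∃ T : EquivTransf E, T.δ₃ = d₃ ∧ T.Maps E' := by
  -- With δ₁ = p, the choice α' = p³g is exactly what makes the new g equal to 1. The new f and k
  -- are then multiplied by 1/(p²d₂²g) and 1/(p²d₂g).
  set α : ℝ → ℝ := fun t => p ^ 3 * G t + q with hα
  have hα' : ∀ t ∈ I, HasDerivAt α (p ^ 3 * E.g t) t := fun t ht =>
    ((hG t ht).const_mul (p ^ 3)).add_const q
  have hd : ∀ t ∈ I, deriv α t = p ^ 3 * E.g t := fun t ht => (hα' t ht).deriv
  have hne : ∀ t ∈ I, p ^ 3 * E.g t ≠ 0 := fun t ht => mul_ne_zero (pow_ne_zero 3 hp) (E.g_ne_zero ht)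
  have hsm : ContDiffOn ℝ ∞ α I :=
    contDiffOn_of_hasDerivAt hI.isOpen (contDiffOn_const.mul E.smooth_g) hα'
  have hinj : Set.InjOn α I := hI.injOn_of_deriv_ne_zero hα' hne
  have hI' : IsOpenInterval (α '' I) := hI.image hsm fun t ht => by rw [hd t ht]; exact hne t ht
  have hsub : α '' I ⊆ r.timeDomain := by
    rintro _ ⟨t, ht, rfl⟩
    exact hdom t ht
  obtain ⟨Γ, hΓ⟩ := hI.exists_antideriv (h := fun t => d₂ * E.k t - d₃ * E.f t)
    ((contDiffOn_const.mul E.smooth_k).sub (contDiffOn_const.mul E.smooth_f)).continuousOn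
  let E' : GardnerEq (α '' I) :=
    { k := r.k
      f := r.f
      g := fun _ => 1
      smooth_k := hrk.mono hsub
      smooth_f := hrf.mono hsub
      smooth_g := contDiffOn_const
      fg_ne_zero := by
        rintro _ ⟨t, ht, rfl⟩
        have h1 := E.f_ne_zero ht
        rw [← hf t ht] at h1
        rw [mul_one]
        exact left_ne_zero_of_mul (left_ne_zero_of_mul h1) }
  let T : EquivTransf E :=
    { α := α
      δ₁ := p
      δ₂ := d₂
      δ₃ := d₃
      δ₄ := 0
      Γ := Γ
      smooth_α := hsm
      deriv_α_ne_zero := fun t ht => by rw [hd t ht]; exact hne t ht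
      δ₁_ne_zero := hp
      δ₂_ne_zero := hd₂
      hasDerivAt_Γ := hΓ }
  refine ⟨α '' I, E', hI', ⟨hsub, fun _ _ => rfl, fun _ _ => rfl, fun _ _ => rfl⟩, T, rfl, ?_, ?_,
    ?_, ?_⟩
  · refine ⟨fun z hz => ⟨z.1, hz, rfl⟩, ?_, ?_⟩
    · rintro ⟨t, x, u⟩ hz ⟨t', x', u'⟩ hz' he
      simp only [EquivTransf.pointMap, Prod.mk.injEq] at he
      obtain ⟨e1, e2, e3⟩ := he
      have ht : t = t' := hinj hz hz' e1
      subst ht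
      have hx : x = x' := mul_left_cancel₀ hp (by
        have : p * x + p * d₃ / d₂ ^ 2 * Γ t + 0 = p * x' + p * d₃ / d₂ ^ 2 * Γ t + 0 := e2
        linarith)
      have hu : u = u' := mul_left_cancel₀ hd₂ (by
        have : d₂ * u + d₃ = d₂ * u' + d₃ := e3
        linarith)
      rw [hx, hu]
    · rintro ⟨t', x', u'⟩ ⟨t, ht, he⟩
      refine ⟨(t, (x' - p * d₃ / d₂ ^ 2 * Γ t) / p, (u' - d₃) / d₂), ht, ?_⟩
      refine Prod.ext he (Prod.ext ?_ ?_)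
      · change p * ((x' - p * d₃ / d₂ ^ 2 * Γ t) / p) + p * d₃ / d₂ ^ 2 * Γ t + 0 = x'
        rw [mul_div_cancel₀ _ hp]; ring
      · change d₂ * ((u' - d₃) / d₂) + d₃ = u'
        rw [mul_div_cancel₀ _ hd₂]; ring
  · intro t ht
    change r.k (α t) = p / (d₂ * deriv α t) * (E.k t - 2 * (d₃ / d₂) * E.f t)
    rw [← hk t ht, hd t ht]
    have := E.g_ne_zero ht
    field_simp
    rfl
  · intro t ht
    change r.f (α t) = p / (d₂ ^ 2 * deriv α t) * E.f t
    rw [← hf t ht, hd t ht]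
    have := E.g_ne_zero ht
    field_simp
    rfl
  · intro t ht
    change 1 = p ^ 3 / deriv α t * E.g t
    rw [hd t ht]
    have := E.g_ne_zero ht
    field_simp

end transformations

/-! ### Normal forms of the coefficients -/

section normal_forms

variable {I : Set ℝ} {E : GardnerEq I} {g G y y' : ℝ → ℝ}

theorem IsOpenInterval.exists_eq_const_mul_exp (hI : IsOpenInterval I)
    (hG : ∀ t ∈ I, HasDerivAt G (g t) t) (hy : ∀ t ∈ I, HasDerivAt y (y' t) t) {m : ℝ}
    (h : ∀ t ∈ I, y' t = m * g t * y t) : ∃ C, ∀ t ∈ I, y t = C * Real.exp (m * G t) := by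
  obtain ⟨t₀, ht₀⟩ := hI.nonempty
  refine ⟨y t₀ * Real.exp (-(m * G t₀)), fun t ht => ?_⟩
  have hc := hI.eq_of_hasDerivAt_zero (F := fun t => y t * Real.exp (-(m * G t))) (fun s hs => by
    refine ((hy s hs).mul ((hG s hs).const_mul m).neg.exp).congr_deriv ?_
    rw [h s hs]; simp only [Pi.neg_apply]; ring) ht ht₀
  rw [← hc, mul_assoc, ← Real.exp_add, neg_add_cancel, Real.exp_zero, mul_one]

/-- The previous lemma applied to log(σG), an antiderivative of g/G. The factor σ makes the base of
the power positive. -/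
theorem IsOpenInterval.exists_eq_const_mul_rpow (hI : IsOpenInterval I) {σ : ℝ}
    (hG : ∀ t ∈ I, HasDerivAt G (g t) t) (hpos : ∀ t ∈ I, 0 < σ * G t)
    (hy : ∀ t ∈ I, HasDerivAt y (y' t) t) {ρ : ℝ} (h : ∀ t ∈ I, y' t * G t = ρ * g t * y t) :
    ∃ C, ∀ t ∈ I, y t = C * (σ * G t) ^ ρ := by
  have hlog : ∀ t ∈ I, HasDerivAt (fun t => Real.log (σ * G t)) (σ * g t / (σ * G t)) t :=
    fun t ht => ((hG t ht).const_mul σ).log (hpos t ht).ne'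
  obtain ⟨C, hC⟩ := hI.exists_eq_const_mul_exp (m := ρ) hlog hy fun t ht => by
    have h0 := hpos t ht
    have hσ0 : σ ≠ 0 := left_ne_zero_of_mul h0.ne'
    have hG0 : G t ≠ 0 := right_ne_zero_of_mul h0.ne'
    have := h t ht
    field_simp
    linear_combination this
  refine ⟨C, fun t ht => ?_⟩
  rw [hC t ht, Real.rpow_def_of_pos (hpos t ht), mul_comm ρ]

/-- A solution of `G y' = -G' y / 3` vanishes if `G` has a zero. -/
theorem IsOpenInterval.eq_zero_of_mul_deriv (hI : IsOpenInterval I) (hgn : ∀ t ∈ I, g t ≠ 0)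
    (hG : ∀ t ∈ I, HasDerivAt G (g t) t) {t₀ : ℝ} (ht₀ : t₀ ∈ I) (h0 : G t₀ = 0)
    (hy : ∀ t ∈ I, HasDerivAt y (y' t) t) (h : ∀ t ∈ I, y' t * G t = -(1 / 3) * g t * y t) :
    ∀ t ∈ I, y t = 0 := by
  -- The derivative of y³G is y²(3y'G + g y) = 0, and y³G vanishes at t₀.
  have hc : ∀ t ∈ I, y t ^ 3 * G t = 0 := fun t ht => by
    have := hI.eq_of_hasDerivAt_zero (F := fun t => y t ^ 3 * G t) (fun s hs => by
      refine (((hy s hs).pow 3).mul (hG s hs)).congr_deriv ?_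
      simp only [Pi.pow_apply]
      push_cast
      linear_combination 3 * y s ^ 2 * h s hs) ht ht₀
    simpa [h0] using this
  intro t ht
  by_cases hGt : G t = 0
  · have := h t ht
    rw [hGt, mul_zero] at this
    have h1 : g t * y t = 0 := by linear_combination 3 * this
    exact (mul_eq_zero.1 h1).resolve_left (hgn t ht)
  · exact pow_eq_zero_iff three_ne_zero |>.1 ((mul_eq_zero.1 (hc t ht)).resolve_right hGt)

/-- Zeros of G are isolated because G' = g ≠ 0. So y' vanishes off them, and by continuity
everywhere. -/
theorem IsOpenInterval.deriv_eq_zero_of_mul (hI : IsOpenInterval I) (hgn : ∀ t ∈ I, g t ≠ 0)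
    (hG : ∀ t ∈ I, HasDerivAt G (g t) t) (hy' : ContinuousOn y' I)
    (h : ∀ t ∈ I, y' t * G t = 0) : ∀ t ∈ I, y' t = 0 := by
  intro t ht
  by_contra hne
  have h1 : ∀ᶠ s in nhds t, y' s ≠ 0 :=
    (hy'.continuousAt (hI.isOpen.mem_nhds ht)).eventually_ne hne
  have h2 : ∀ᶠ s in nhds t, s ∈ I := hI.isOpen.mem_nhds ht
  have h3 : ∀ᶠ s in nhdsWithin t {t}ᶜ, G s ≠ 0 := (hG t ht).eventually_ne (hgn t ht)
  obtain ⟨s, ⟨hs1, hs2⟩, hs3⟩ :=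
    (((h1.and h2).filter_mono nhdsWithin_le_nhds).and h3).exists
  exact (mul_ne_zero hs1 hs3) (h s hs2)

/-- The possible forms of the coefficients of an equation with an extension of the kernel algebra,
in terms of an antiderivative `G` of `g`. -/
inductive NormalForm {I : Set ℝ} (E : GardnerEq I) (G : ℝ → ℝ) : Prop
  | const (l μ : ℝ) (hl : l ≠ 0) (hf : ∀ t ∈ I, E.f t = l * E.g t)
      (hk : ∀ t ∈ I, E.k t = μ * E.g t)
  | pow (σ ρ l m μ : ℝ) (hσ : σ ^ 2 = 1) (hpos : ∀ t ∈ I, 0 < σ * G t) (hl : l ≠ 0)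
      (hne : ρ ≠ 0 ∨ m ≠ 0) (hf : ∀ t ∈ I, E.f t = l * (σ * G t) ^ ρ * E.g t)
      (hk : ∀ t ∈ I, E.k t
        = (m * (σ * G t) ^ ((3 * ρ - 2) / 6) + μ * (σ * G t) ^ ρ) * E.g t)
  | log (σ l m μ : ℝ) (hσ : σ ^ 2 = 1) (hpos : ∀ t ∈ I, 0 < σ * G t) (hl : l ≠ 0) (hμ : μ ≠ 0)
      (hf : ∀ t ∈ I, E.f t = l * (σ * G t) ^ (-(2 / 3) : ℝ) * E.g t)
      (hk : ∀ t ∈ I, E.k t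
        = (σ * G t) ^ (-(2 / 3) : ℝ) * (m + μ * Real.log (σ * G t)) * E.g t)
  | exp (n l m μ : ℝ) (hn : n ≠ 0) (hl : l ≠ 0) (hf : ∀ t ∈ I, E.f t = l * Real.exp (n * G t) * E.g t)
      (hk : ∀ t ∈ I, E.k t
        = (m * Real.exp (n / 2 * G t) + μ * Real.exp (n * G t)) * E.g t)
  | lin (l m μ : ℝ) (hl : l ≠ 0) (hμ : μ ≠ 0) (hf : ∀ t ∈ I, E.f t = l * E.g t)
      (hk : ∀ t ∈ I, E.k t = (m + μ * G t) * E.g t)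

variable {φ κ φ' κ' : ℝ → ℝ}

/-- The symmetry is a scaling of the time G. In this variable φ and κ solve Euler equations, κ with
homogeneous exponent (3ρ - 2)/6 and source eφ. -/
theorem normalForm_of_scaling (hI : IsOpenInterval I) (hG : ∀ t ∈ I, HasDerivAt G (E.g t) t)
    (hf : ∀ t ∈ I, E.f t = φ t * E.g t) (hk : ∀ t ∈ I, E.k t = κ t * E.g t)
    (hφ : ∀ t ∈ I, HasDerivAt φ (φ' t) t) (hκ : ∀ t ∈ I, HasDerivAt κ (κ' t) t)
    (hφc : ContinuousOn φ' I) {ρ e : ℝ} (eφ : ∀ t ∈ I, φ' t * G t = ρ * E.g t * φ t)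
    (eκ : ∀ t ∈ I, κ' t * G t = (3 * ρ - 2) / 6 * E.g t * κ t + e * E.g t * φ t) :
    NormalForm E G := by
  have hgn : ∀ t ∈ I, E.g t ≠ 0 := fun t ht => E.g_ne_zero ht
  have hφn : ∀ t ∈ I, φ t ≠ 0 := fun t ht => by
    have := E.f_ne_zero ht
    rw [hf t ht] at this
    exact left_ne_zero_of_mul this
  obtain ⟨t₁, ht₁⟩ := hI.nonempty
  -- If G vanishes somewhere, evaluation there gives ρ = 0, so φ is constant. Then κ - 3eφ solves
  -- the homogeneous equation with exponent -1/3, and regularity at the zero kills it.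
  by_cases hz : ∃ t₀ ∈ I, G t₀ = 0
  · obtain ⟨t₀, ht₀, hG0⟩ := hz
    have hρ : ρ = 0 := by
      have := eφ t₀ ht₀
      rw [hG0, mul_zero] at this
      have h1 := (mul_eq_zero.1 this.symm).resolve_right (hφn _ ht₀)
      exact (mul_eq_zero.1 h1).resolve_right (hgn _ ht₀)
    subst hρ
    have hφ0 := hI.deriv_eq_zero_of_mul hgn hG hφc fun t ht => by rw [eφ t ht]; ring
    have hφe : ∀ t ∈ I, φ t = φ t₁ := fun t ht => hI.eq_of_hasDerivAt_zero
      (fun s hs => (hφ s hs).congr_deriv (hφ0 s hs)) ht ht₁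
    have hκe := hI.eq_zero_of_mul_deriv (y := fun t => κ t - 3 * e * φ t₁) (y' := κ') hgn hG ht₀ hG0
      (fun t ht => (hκ t ht).sub_const _) fun t ht => by
        rw [eκ t ht, hφe t ht]; ring
    refine .const (φ t₁) (3 * e * φ t₁) (hφn _ ht₁) (fun t ht => ?_) (fun t ht => ?_)
    · rw [hf t ht, hφe t ht]
    · rw [hk t ht]
      linear_combination E.g t * hκe t ht
  · push Not at hz
    have hσ : ∃ σ : ℝ, σ ^ 2 = 1 ∧ ∀ t ∈ I, 0 < σ * G t := by
      have hcont : ContinuousOn G I := fun t ht => (hG t ht).continuousAt.continuousWithinAt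
      have hconn := (hI.isPreconnected.image G hcont).ordConnected
      rcases lt_or_gt_of_ne (hz t₁ ht₁) with hs | hs
      · refine ⟨-1, by norm_num, fun t ht => ?_⟩
        by_contra hc
        have : (0 : ℝ) ∈ G '' I := hconn.out ⟨t₁, ht₁, rfl⟩ ⟨t, ht, rfl⟩ ⟨hs.le, by linarith⟩
        obtain ⟨s, hs1, hs2⟩ := this
        exact hz s hs1 hs2
      · refine ⟨1, by norm_num, fun t ht => ?_⟩
        by_contra hc
        have : (0 : ℝ) ∈ G '' I := hconn.out ⟨t, ht, rfl⟩ ⟨t₁, ht₁, rfl⟩ ⟨by linarith, hs.le⟩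
        obtain ⟨s, hs1, hs2⟩ := this
        exact hz s hs1 hs2
    obtain ⟨σ, hσ, hpos⟩ := hσ
    obtain ⟨l, hl⟩ := hI.exists_eq_const_mul_rpow hG hpos hφ eφ
    have hl0 : l ≠ 0 := fun h => hφn t₁ ht₁ (by rw [hl t₁ ht₁, h, zero_mul])
    -- Resonance: at ρ = -2/3 the homogeneous exponent (3ρ - 2)/6 equals ρ, the exponent of the
    -- source, and a logarithm appears. Otherwise 6e/(3ρ + 2) φ is a particular solution.
    by_cases hρ : 3 * ρ + 2 = 0
    · have hρ' : ρ = -(2 / 3) := by linarith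
      subst hρ'
      have hc : ∀ t ∈ I, HasDerivAt (fun t => κ t / φ t - e * Real.log (σ * G t)) 0 t := by
        intro t ht
        have h0 := hpos t ht
        have hσ0 : σ ≠ 0 := left_ne_zero_of_mul h0.ne'
        have hG0 : G t ≠ 0 := right_ne_zero_of_mul h0.ne'
        have hlog := (((hG t ht).const_mul σ).log h0.ne').const_mul e
        refine (((hκ t ht).div (hφ t ht) (hφn t ht)).sub hlog).congr_deriv ?_
        have h1 := eφ t ht
        have h2 := eκ t ht
        have := hφn t ht
        field_simp
        linear_combination φ t * h2 - κ t * h1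
      set m := κ t₁ / φ t₁ - e * Real.log (σ * G t₁) with hm
      have hκe : ∀ t ∈ I, κ t = φ t * (m + e * Real.log (σ * G t)) := fun t ht => by
        have h1 := hI.eq_of_hasDerivAt_zero hc ht ht₁
        have := hφn t ht
        rw [hm, ← h1]
        field_simp
        ring
      by_cases he : e = 0
      · refine .pow σ (-(2 / 3)) l 0 (l * m) hσ hpos hl0 (Or.inl (by norm_num)) (fun t ht => ?_)
          (fun t ht => ?_)
        · rw [hf t ht, hl t ht]
        · rw [hk t ht, hκe t ht, hl t ht, he]; ring
      · refine .log σ l (l * m) (l * e) hσ hpos hl0 (mul_ne_zero hl0 he) (fun t ht => ?_)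
          (fun t ht => ?_)
        · rw [hf t ht, hl t ht]
        · rw [hk t ht, hκe t ht, hl t ht]; ring
    · obtain ⟨m, hm⟩ := hI.exists_eq_const_mul_rpow (y := fun t => κ t - 6 * e / (3 * ρ + 2) * φ t)
        (y' := fun t => κ' t - 6 * e / (3 * ρ + 2) * φ' t) (ρ := (3 * ρ - 2) / 6) hG hpos
        (fun t ht => (hκ t ht).sub ((hφ t ht).const_mul _)) fun t ht => by
          have h1 := eφ t ht
          have h2 := eκ t ht
          field_simp
          linear_combination 6 * (3 * ρ + 2) * h2 - 36 * e * h1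
      have hke : ∀ t ∈ I, E.k t = (m * (σ * G t) ^ ((3 * ρ - 2) / 6)
          + 6 * e / (3 * ρ + 2) * l * (σ * G t) ^ ρ) * E.g t := fun t ht => by
        have h1 := hm t ht
        have h2 := hl t ht
        rw [hk t ht]
        linear_combination E.g t * h1 + E.g t * (6 * e / (3 * ρ + 2)) * h2
      have hfe : ∀ t ∈ I, E.f t = l * (σ * G t) ^ ρ * E.g t := fun t ht => by rw [hf t ht, hl t ht]
      by_cases hne : ρ ≠ 0 ∨ m ≠ 0
      · exact .pow σ ρ l m _ hσ hpos hl0 hne hfe hke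
      · push Not at hne
        obtain ⟨h1, h2⟩ := hne
        refine .const l (6 * e / (3 * ρ + 2) * l) hl0 (fun t ht => ?_) (fun t ht => ?_)
        · rw [hfe t ht, h1, Real.rpow_zero, mul_one]
        · rw [hke t ht, h2]; simp [h1]

/-- The symmetry is a translation of the time G, so the equations have constant coefficients with
rates n and n/2. For n ≠ 0 a particular solution is (2e/n) φ. The rates coincide only for n = 0,
where κ is affine in G. -/
theorem normalForm_of_shift (hI : IsOpenInterval I) (hG : ∀ t ∈ I, HasDerivAt G (E.g t) t)
    (hf : ∀ t ∈ I, E.f t = φ t * E.g t) (hk : ∀ t ∈ I, E.k t = κ t * E.g t)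
    (hφ : ∀ t ∈ I, HasDerivAt φ (φ' t) t) (hκ : ∀ t ∈ I, HasDerivAt κ (κ' t) t)
    {n e : ℝ} (eφ : ∀ t ∈ I, φ' t = n * E.g t * φ t)
    (eκ : ∀ t ∈ I, κ' t = n / 2 * E.g t * κ t + e * E.g t * φ t) : NormalForm E G := by
  obtain ⟨t₁, ht₁⟩ := hI.nonempty
  obtain ⟨l, hl⟩ := hI.exists_eq_const_mul_exp hG hφ eφ
  have hl0 : l ≠ 0 := fun h => E.f_ne_zero ht₁ (by rw [hf t₁ ht₁, hl t₁ ht₁, h]; ring)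
  by_cases hn : n = 0
  · subst hn
    have hfe : ∀ t ∈ I, φ t = l := fun t ht => by rw [hl t ht]; simp
    have hc : ∀ t ∈ I, HasDerivAt (fun t => κ t - e * l * G t) 0 t := fun t ht => by
      refine ((hκ t ht).sub ((hG t ht).const_mul (e * l))).congr_deriv ?_
      rw [eκ t ht, hfe t ht]; ring
    have hke : ∀ t ∈ I, κ t = κ t₁ - e * l * G t₁ + e * l * G t := fun t ht => by
      linear_combination hI.eq_of_hasDerivAt_zero hc ht ht₁
    by_cases he : e = 0
    · refine .const l (κ t₁) hl0 (fun t ht => ?_) (fun t ht => ?_)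
      · rw [hf t ht, hfe t ht]
      · rw [hk t ht, hke t ht, he]; ring
    · refine .lin l (κ t₁ - e * l * G t₁) (e * l) hl0 (mul_ne_zero he hl0) (fun t ht => ?_)
        (fun t ht => ?_)
      · rw [hf t ht, hfe t ht]
      · rw [hk t ht, hke t ht]
  · obtain ⟨m, hm⟩ := hI.exists_eq_const_mul_exp (y := fun t => κ t - 2 * e / n * φ t)
      (y' := fun t => κ' t - 2 * e / n * φ' t) (m := n / 2) hG
      (fun t ht => (hκ t ht).sub ((hφ t ht).const_mul _)) fun t ht => by
        rw [eκ t ht, eφ t ht]; field_simp; ring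
    refine .exp n l m (2 * e / n * l) hn hl0 (fun t ht => ?_) (fun t ht => ?_)
    · rw [hf t ht, hl t ht]
    · have h1 := hm t ht
      have h2 := hl t ht
      rw [hk t ht]
      linear_combination E.g t * h1 + E.g t * (2 * e / n) * h2

theorem GardnerEq.HasExtension.exists_normalForm (hI : IsOpenInterval I) (h : E.HasExtension) :
    ∃ G : ℝ → ℝ, (∀ t ∈ I, HasDerivAt G (E.g t) t) ∧ NormalForm E G := by
  obtain ⟨a, b, c, T, X, hs, t₁, ht₁, hT⟩ := h.exists_symData hI
  have hgn : ∀ t ∈ I, E.g t ≠ 0 := fun t ht => E.g_ne_zero ht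
  obtain ⟨G₀, hG₀⟩ := hI.exists_antideriv E.smooth_g.continuousOn
  have hf' := fun t ht => E.smooth_f.hasDerivAt_of_isOpen hI.isOpen (t := t) ht
  have hk' := fun t ht => E.smooth_k.hasDerivAt_of_isOpen hI.isOpen (t := t) ht
  have hg' := fun t ht => E.smooth_g.hasDerivAt_of_isOpen hI.isOpen (t := t) ht
  have hT' := fun t ht => hs.smooth_T.hasDerivAt_of_isOpen hI.isOpen (t := t) ht
  -- The product gT is the t-component in the time variable G₀, and it is affine there. Whether a =
  -- 0 separates translations from scalings.
  have hgT : ∀ t ∈ I, E.g t * T t = 3 * a * G₀ t + (E.g t₁ * T t₁ - 3 * a * G₀ t₁) := by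
    intro t ht
    have := hI.eq_of_hasDerivAt_zero (F := fun t => E.g t * T t - 3 * a * G₀ t) (fun s hs' => by
      refine (((hg' s hs').mul (hT' s hs')).sub ((hG₀ s hs').const_mul (3 * a))).congr_deriv ?_
      linear_combination hs.eq_g s hs') ht ht₁
    linear_combination this
  have hφ : ∀ t ∈ I, HasDerivAt (fun t => E.f t / E.g t)
      ((deriv E.f t * E.g t - E.f t * deriv E.g t) / E.g t ^ 2) t := fun t ht =>
    (hf' t ht).div (hg' t ht) (hgn t ht)
  have hκ : ∀ t ∈ I, HasDerivAt (fun t => E.k t / E.g t)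
      ((deriv E.k t * E.g t - E.k t * deriv E.g t) / E.g t ^ 2) t := fun t ht =>
    (hk' t ht).div (hg' t ht) (hgn t ht)
  have eφ : ∀ t ∈ I, (deriv E.f t * E.g t - E.f t * deriv E.g t) / E.g t ^ 2 * (E.g t * T t)
      = -(2 * a + 2 * b) * (E.f t / E.g t) * E.g t := fun t ht => by
    have h1 := hs.eq_g t ht
    have h2 := hs.eq_f t ht
    have := hgn t ht
    field_simp
    linear_combination E.g t * h2 - E.f t * h1
  have eκ : ∀ t ∈ I, (deriv E.k t * E.g t - E.k t * deriv E.g t) / E.g t ^ 2 * (E.g t * T t)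
      = -(2 * a + b) * (E.k t / E.g t) * E.g t - 2 * c * (E.f t / E.g t) * E.g t := fun t ht => by
    have h1 := hs.eq_g t ht
    have h2 := hs.eq_k t ht
    have := hgn t ht
    field_simp
    linear_combination E.g t * h2 - E.k t * h1
  have hf : ∀ t ∈ I, E.f t = E.f t / E.g t * E.g t := fun t ht => (div_mul_cancel₀ _ (hgn t ht)).symm
  have hk : ∀ t ∈ I, E.k t = E.k t / E.g t * E.g t := fun t ht => (div_mul_cancel₀ _ (hgn t ht)).symm
  set d := E.g t₁ * T t₁ - 3 * a * G₀ t₁ with hd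
  by_cases ha : a = 0
  · have hd0 : d ≠ 0 := by
      rw [hd, ha]
      simpa using ⟨hgn t₁ ht₁, hT⟩
    refine ⟨G₀, hG₀, normalForm_of_shift hI hG₀ hf hk hφ hκ (n := -(2 * b) / d) (e := -(2 * c) / d)
      (fun t ht => ?_) (fun t ht => ?_)⟩
    · have h1 := eφ t ht
      rw [hgT t ht, ha] at h1
      rw [← mul_left_inj' hd0]
      have e1 : -(2 * b) / d * E.g t * (E.f t / E.g t) * d = -(2 * b) * E.g t * (E.f t / E.g t) := by
        field_simp
      rw [e1]
      linear_combination h1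
    · have h1 := eκ t ht
      rw [hgT t ht, ha] at h1
      rw [← mul_left_inj' hd0]
      have e1 : (-(2 * b) / d / 2 * E.g t * (E.k t / E.g t)
          + -(2 * c) / d * E.g t * (E.f t / E.g t)) * d
          = -b * E.g t * (E.k t / E.g t) - 2 * c * E.g t * (E.f t / E.g t) := by
        field_simp
        ring
      rw [e1]
      linear_combination h1
  -- This choice of antiderivative absorbs the constant: gT = 3aG.
  · have hG : ∀ t ∈ I, HasDerivAt (fun t => G₀ t + d / (3 * a)) (E.g t) t := fun t ht =>
      (hG₀ t ht).add_const _
    have hgT' : ∀ t ∈ I, G₀ t + d / (3 * a) = E.g t * T t / (3 * a) := fun t ht => by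
      rw [hgT t ht]; field_simp
    have hcf := (E.smooth_f.continuousOn_deriv_of_isOpen hI.isOpen (by simp))
    have hcg := (E.smooth_g.continuousOn_deriv_of_isOpen hI.isOpen (by simp))
    refine ⟨_, hG, normalForm_of_scaling hI hG hf hk hφ hκ ?_ (ρ := -(2 * a + 2 * b) / (3 * a))
      (e := -(2 * c) / (3 * a)) (fun t ht => ?_) (fun t ht => ?_)⟩
    · exact ((hcf.mul E.smooth_g.continuousOn).sub (E.smooth_f.continuousOn.mul hcg)).div
        (E.smooth_g.continuousOn.pow 2) fun t ht => pow_ne_zero 2 (hgn t ht)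
    · rw [hgT' t ht, ← mul_div_assoc, eφ t ht]
      ring
    · rw [hgT' t ht, ← mul_div_assoc, eκ t ht]
      field_simp
      ring

end normal_forms

/-! ### Completeness of the tables -/

section completeness

variable {I : Set ℝ} {E : GardnerEq I} {G : ℝ → ℝ}

theorem contDiffOn_rpow_Ioi (r : ℝ) : ContDiffOn ℝ ∞ (fun t : ℝ => t ^ r) (Set.Ioi 0) :=
  fun _ ht => (Real.contDiffAt_rpow_const_of_ne (ne_of_gt ht)).contDiffWithinAt

theorem exists_unit_scale (m : ℝ) : ∃ δ d : ℝ, (δ = 0 ∨ δ = 1) ∧ d ≠ 0 ∧ m = δ * d := by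
  by_cases hm : m = 0
  · exact ⟨0, 1, Or.inl rfl, one_ne_zero, by rw [hm, zero_mul]⟩
  · exact ⟨1, m, Or.inr rfl, hm, (one_mul m).symm⟩

theorem exists_cube_root {m : ℝ} (hm : m ≠ 0) : ∃ p : ℝ, p ≠ 0 ∧ p ^ 3 = m := by
  have key : ∀ x : ℝ, 0 ≤ x → (x ^ (((3 : ℕ) : ℝ)⁻¹)) ^ 3 = x := fun x hx =>
    Real.rpow_inv_natCast_pow hx three_ne_zero
  obtain ⟨p, hp⟩ : ∃ p : ℝ, p ^ 3 = m := by
    rcases le_total 0 m with h | h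
    · exact ⟨_, key m h⟩
    · exact ⟨-(-m) ^ (((3 : ℕ) : ℝ)⁻¹), by
        rw [Odd.neg_pow (by decide), key (-m) (neg_nonneg.2 h), neg_neg]⟩
  exact ⟨p, fun h => hm (by rw [← hp, h]; norm_num), hp⟩

theorem exists_sign_mul_sq {l : ℝ} (hl : l ≠ 0) :
    ∃ ε s : ℝ, (ε = 1 ∨ ε = -1) ∧ s ≠ 0 ∧ l = ε * s ^ 2 := by
  rcases lt_or_gt_of_ne hl with h | h
  · exact ⟨-1, √(-l), Or.inr rfl, (Real.sqrt_pos.2 (by linarith)).ne', by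
      rw [Real.sq_sqrt (by linarith)]; ring⟩
  · exact ⟨1, √l, Or.inl rfl, (Real.sqrt_pos.2 h).ne', by rw [Real.sq_sqrt h.le]; ring⟩

theorem contDiffOn_pow_row (l m μ r s : ℝ) :
    ContDiffOn ℝ ∞ (fun t : ℝ => l * t ^ r) (Set.Ioi 0) ∧
      ContDiffOn ℝ ∞ (fun t : ℝ => m * t ^ s + μ * t ^ r) (Set.Ioi 0) :=
  ⟨contDiffOn_const.mul (contDiffOn_rpow_Ioi r),
    (contDiffOn_const.mul (contDiffOn_rpow_Ioi s)).add (contDiffOn_const.mul (contDiffOn_rpow_Ioi r))⟩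

/-- Rescaling time by e^{3z} adds 3z to the logarithm, and z = m/(3μ) absorbs m. The factor e^{-2z}
produced by the power -2/3 cancels against p² with p = σe^z. No δ₃ is needed, so the same row serves
both tables. -/
theorem exists_equiv_rowI2 (hI : IsOpenInterval I) (hG : ∀ t ∈ I, HasDerivAt G (E.g t) t)
    {σ l m μ : ℝ} (hσ : σ ^ 2 = 1) (hpos : ∀ t ∈ I, 0 < σ * G t) (hμ : μ ≠ 0)
    (hf : ∀ t ∈ I, E.f t = l * (σ * G t) ^ (-(2 / 3) : ℝ) * E.g t)
    (hk : ∀ t ∈ I, E.k t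
      = (σ * G t) ^ (-(2 / 3) : ℝ) * (m + μ * Real.log (σ * G t)) * E.g t) :
    ∃ (I' : Set ℝ) (E' : GardnerEq I'), IsOpenInterval I' ∧ E'.IsOfForm (rowI2 (l / μ ^ 2)) ∧
      ∃ T : EquivTransf E, T.δ₃ = 0 ∧ T.Maps E' := by
  set z := m / (3 * μ) with hz
  have hσ0 : σ ≠ 0 := fun h => by rw [h] at hσ; norm_num at hσ
  have harg : ∀ t, (σ * Real.exp z) ^ 3 * G t + 0 = Real.exp (3 * z) * (σ * G t) := fun t => by
    have : Real.exp (3 * z) = Real.exp z ^ 3 := by rw [← Real.exp_nat_mul]; norm_num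
    rw [this]
    linear_combination σ * Real.exp z ^ 3 * G t * hσ
  have hscale : ∀ t ∈ I, (Real.exp (3 * z) * (σ * G t)) ^ (-(2 / 3) : ℝ) * (σ * Real.exp z) ^ 2
      = (σ * G t) ^ (-(2 / 3) : ℝ) := fun t ht => by
    rw [Real.mul_rpow (Real.exp_pos _).le (hpos t ht).le, ← Real.exp_mul, mul_pow, hσ,
      ← Real.exp_nat_mul]
    have : Real.exp (3 * z * -(2 / 3)) * Real.exp ((2 : ℕ) * z) = 1 := by
      rw [← Real.exp_add, Real.exp_eq_one_iff]; push_cast; ring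
    linear_combination (σ * G t) ^ (-(2 / 3) : ℝ) * this
  refine E.exists_equiv hI hG (p := σ * Real.exp z) 0 (d₂ := μ) 0
    (mul_ne_zero hσ0 (Real.exp_ne_zero z)) hμ ?_ ?_ (fun t ht => ?_) (fun t ht => ?_)
    (fun t ht => ?_)
  · exact contDiffOn_const.mul (contDiffOn_rpow_Ioi _)
  · refine (contDiffOn_rpow_Ioi _).mul ?_
    refine (Real.contDiffOn_log.mono fun t ht => ne_of_gt ht).congr fun t ht => ?_
    rw [abs_of_pos ht]
  · rw [harg]
    exact mul_pos (Real.exp_pos _) (hpos t ht)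
  · rw [harg, hf t ht, ← hscale t ht]
    simp only [rowI2]
    field_simp
  · rw [harg, hk t ht, ← hscale t ht]
    simp only [rowI2]
    rw [Real.log_abs, Real.log_mul (Real.exp_ne_zero _) (hpos t ht).ne', Real.log_exp, hz]
    field_simp
    ring

theorem exists_equiv_rowIII (hI : IsOpenInterval I) (hG : ∀ t ∈ I, HasDerivAt G (E.g t) t)
    {l m μ : ℝ} (hμ : μ ≠ 0) (hf : ∀ t ∈ I, E.f t = l * E.g t)
    (hk : ∀ t ∈ I, E.k t = (m + μ * G t) * E.g t) :
    ∃ (I' : Set ℝ) (E' : GardnerEq I'), IsOpenInterval I' ∧ E'.IsOfForm (rowIII (l / μ ^ 2)) ∧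
      ∃ T : EquivTransf E, T.δ₃ = 0 ∧ T.Maps E' := by
  refine E.exists_equiv hI hG (p := 1) (m / μ) (d₂ := μ) 0 one_ne_zero hμ contDiffOn_const
    contDiffOn_id (fun t ht => trivial) (fun t ht => ?_) (fun t ht => ?_)
  · rw [hf t ht]
    simp only [rowIII]
    field_simp
  · rw [hk t ht]
    simp only [rowIII]
    field_simp
    ring

theorem exists_table1_of_normalForm (hI : IsOpenInterval I)
    (hG : ∀ t ∈ I, HasDerivAt G (E.g t) t) (h : NormalForm E G) :
    ∃ (ca : Case1) (r : Row), r ∈ table1 ca ∧ ∃ (I' : Set ℝ) (E' : GardnerEq I'),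
      IsOpenInterval I' ∧ E'.IsOfForm r ∧ UsualEquivalent E E' := by
  cases h with
  | const l μ hl hf hk =>
    obtain ⟨ε, s, hε, hs, hls⟩ := exists_sign_mul_sq hl
    obtain ⟨δ, d, hδ, hd, hμ⟩ := exists_unit_scale (μ / s)
    refine ⟨.IV, _, ⟨ε, δ, _, hε, hδ, rfl, rfl⟩, ?_⟩
    -- The requirements are ε(p d₂)² = l and δ p² d₂ = μ. They hold because p d₂ = s and μ = δ d s.
    refine E.exists_equiv hI hG (p := d) 0 (d₂ := s / d) 0 hd (div_ne_zero hs hd)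
      contDiffOn_const contDiffOn_const (fun t ht => trivial) (fun t ht => ?_) (fun t ht => ?_)
    · rw [hf t ht, hls]
      field_simp
    · have : μ = δ * d * s := by rw [← hμ]; field_simp
      rw [hk t ht, this]
      field_simp
      ring
  | pow σ ρ l m μ hσ hpos hl hne hf hk =>
    obtain ⟨δ, d, hδ, hd, hμ⟩ := exists_unit_scale μ
    have hσ0 : σ ≠ 0 := fun h => by rw [h] at hσ; norm_num at hσ
    have harg : ∀ t, σ ^ 3 * G t + 0 = σ * G t := fun t => by linear_combination σ * G t * hσ
    -- The power rows share one formula for f and k, so one transformation suffices and ρ only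
    -- selects the row.
    suffices hr : ∃ (ca : Case1) (r : Row), r ∈ table1 ca ∧ r.timeDomain = Set.Ioi 0 ∧
        r.f = (fun t => l / d ^ 2 * t ^ ρ) ∧
        r.k = fun t => m / d * t ^ ((3 * ρ - 2) / 6) + δ * t ^ ρ by
      obtain ⟨ca, r, hr, hrd, hrf, hrk⟩ := hr
      obtain ⟨s1, s2⟩ := contDiffOn_pow_row (l / d ^ 2) (m / d) δ ρ ((3 * ρ - 2) / 6)
      refine ⟨ca, r, hr, E.exists_equiv hI hG (p := σ) 0 (d₂ := d) 0 hσ0 hd ?_ ?_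
        (fun t ht => ?_) (fun t ht => ?_) (fun t ht => ?_)⟩
      · rw [hrf, hrd]; exact s1
      · rw [hrk, hrd]; exact s2
      · rw [hrd, harg]; exact hpos t ht
      · rw [harg, hf t ht, hrf, hσ]
        field_simp
      · rw [harg, hk t ht, hrk, hσ, hμ]
        field_simp
        ring
    have hl' : l / d ^ 2 ≠ 0 := div_ne_zero hl (pow_ne_zero 2 hd)
    by_cases h1 : ρ = -1
    · subst h1
      refine ⟨.I3, _, ⟨l / d ^ 2, m / d, δ, _, hl', hδ, rfl, rfl⟩, rfl, rfl, ?_⟩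
      norm_num
    by_cases h4 : ρ = -(4 / 3)
    · subst h4
      refine ⟨.I4, _, ⟨l / d ^ 2, m / d, δ, _, hl', hδ, rfl, rfl⟩, rfl, rfl, ?_⟩
      norm_num
    refine ⟨.I1, _, ⟨l / d ^ 2, m / d, ρ, δ, _, hl', h4, h1, hδ, fun h => ?_, rfl, rfl⟩, rfl, rfl,
      rfl⟩
    rw [Prod.mk.injEq, div_eq_zero_iff] at h
    rcases hne with hne | hne
    · exact hne h.1
    · exact h.2.elim hne hd
  | log σ l m μ hσ hpos hl hμ hf hk =>
    exact ⟨.I2, _, ⟨_, div_ne_zero hl (pow_ne_zero 2 hμ), rfl⟩,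
      exists_equiv_rowI2 hI hG hσ hpos hμ hf hk⟩
  | exp n l m μ hn hl hf hk =>
    -- The new time p³G must equal nG. A real cube root also covers n < 0, since δ₁ = p may be
    -- negative.
    obtain ⟨p, hp, rfl⟩ := exists_cube_root hn
    obtain ⟨δ, d, hδ, hd, hμ⟩ := exists_unit_scale (μ / p ^ 2)
    refine ⟨.II, _, ⟨l / (p ^ 2 * d ^ 2), m / (p ^ 2 * d), δ, _,
      div_ne_zero hl (by positivity), hδ, rfl, rfl⟩, ?_⟩
    refine E.exists_equiv hI hG (p := p) 0 (d₂ := d) 0 hp hd ?_ ?_ (fun t ht => trivial)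
      (fun t ht => ?_) (fun t ht => ?_)
    · exact (contDiff_const.mul Real.contDiff_exp).contDiffOn
    · exact ((contDiff_const.mul (Real.contDiff_exp.comp (contDiff_id.div_const 2))).add
        (contDiff_const.mul Real.contDiff_exp)).contDiffOn
    · rw [hf t ht, add_zero]
      field_simp
    · have hμ' : μ = δ * d * p ^ 2 := by rw [← hμ]; field_simp
      have e : (p ^ 3 * G t + 0) / 2 = p ^ 3 / 2 * G t := by ring
      rw [hk t ht, hμ']
      dsimp only
      rw [e, add_zero]
      field_simp
      ring
  | lin l m μ hl hμ hf hk =>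
    exact ⟨.III, _, ⟨_, div_ne_zero hl (pow_ne_zero 2 hμ), rfl⟩, exists_equiv_rowIII hI hG hμ hf hk⟩

/-- In the constant, power and exponential forms, k contains (μ/l) f. The choice δ₃ = δ₂ μ/(2l)
removes it, and the scaling freedom is then spent on the remaining coefficient of k. -/
theorem exists_table2_of_normalForm (hI : IsOpenInterval I)
    (hG : ∀ t ∈ I, HasDerivAt G (E.g t) t) (h : NormalForm E G) :
    ∃ (ca : Case2) (r : Row), r ∈ table2 ca ∧ ∃ (I' : Set ℝ) (E' : GardnerEq I'),
      IsOpenInterval I' ∧ E'.IsOfForm r ∧ GenExtEquivalent E E' := by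
  cases h with
  | const l μ hl hf hk =>
    obtain ⟨ε, s, hε, hs, hls⟩ := exists_sign_mul_sq hl
    refine ⟨.IV, _, ⟨ε, hε, rfl⟩, ?_⟩
    obtain ⟨I', E', h1, h2, T, -, h3⟩ := E.exists_equiv hI hG (p := 1) 0 (d₂ := s) (s * μ / (2 * l))
      (r := { timeDomain := Set.univ
              f := fun _ => ε
              k := fun _ => 0
              n := 3
              basis := ![dX, dT, vfield (fun t _ _ => 3 * t) (fun _ x _ => x) (fun _ _ u => -u)] })
      one_ne_zero hs contDiffOn_const contDiffOn_const (fun t ht => trivial)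
      (fun t ht => by rw [hf t ht, hls]; ring)
      (fun t ht => by rw [hk t ht, hf t ht]; field_simp; ring)
    exact ⟨I', E', h1, h2, T, h3⟩
  | pow σ ρ l m μ hσ hpos hl hne hf hk =>
    obtain ⟨δ, d, hδ, hd, hm⟩ := exists_unit_scale m
    have hσ0 : σ ≠ 0 := fun h => by rw [h] at hσ; norm_num at hσ
    have harg : ∀ t, σ ^ 3 * G t + 0 = σ * G t := fun t => by linear_combination σ * G t * hσ
    refine ⟨.I1, _, ⟨l / d ^ 2, ρ, δ, div_ne_zero hl (pow_ne_zero 2 hd), hδ, fun h => ?_, rfl⟩, ?_⟩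
    · rw [Prod.mk.injEq] at h
      rcases hne with hne | hne
      · exact hne h.1
      · exact hne (by rw [hm, h.2, zero_mul])
    · obtain ⟨I', E', h1, h2, T, -, h3⟩ := E.exists_equiv hI hG (p := σ) 0 (d₂ := d) (d * μ / (2 * l))
        (r := { timeDomain := Set.Ioi 0
                f := fun t => l / d ^ 2 * t ^ ρ
                k := fun t => δ * t ^ ((3 * ρ - 2) / 6)
                n := 2
                basis := ![dX, vfield (fun t _ _ => 3 * t) (fun _ x _ => x)
                  (fun _ _ u => -((3 * ρ + 2) / 2) * u)] })
        hσ0 hd (contDiffOn_const.mul (contDiffOn_rpow_Ioi ρ))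
        (contDiffOn_const.mul (contDiffOn_rpow_Ioi _))
        (fun t ht => by rw [harg]; exact hpos t ht)
        (fun t ht => by rw [harg, hf t ht, hσ]; field_simp)
        (fun t ht => by rw [harg, hk t ht, hf t ht, hσ, hm]; field_simp; ring)
      exact ⟨I', E', h1, h2, T, h3⟩
  | log σ l m μ hσ hpos hl hμ hf hk =>
    obtain ⟨I', E', h1, h2, T, -, h3⟩ := exists_equiv_rowI2 hI hG hσ hpos hμ hf hk
    exact ⟨.I2, _, ⟨_, div_ne_zero hl (pow_ne_zero 2 hμ), rfl⟩, I', E', h1, h2, T, h3⟩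
  | exp n l m μ hn hl hf hk =>
    obtain ⟨p, hp, rfl⟩ := exists_cube_root hn
    obtain ⟨δ, d, hδ, hd, hm⟩ := exists_unit_scale (m / p ^ 2)
    have hm' : m = δ * d * p ^ 2 := by rw [← hm]; field_simp
    refine ⟨.II, _, ⟨l / (p ^ 2 * d ^ 2), δ, div_ne_zero hl (by positivity), hδ, rfl⟩, ?_⟩
    obtain ⟨I', E', h1, h2, T, -, h3⟩ := E.exists_equiv hI hG (p := p) 0 (d₂ := d) (d * μ / (2 * l))
      (r := { timeDomain := Set.univ
              f := fun t => l / (p ^ 2 * d ^ 2) * Real.exp t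
              k := fun t => δ * Real.exp (t / 2)
              n := 2
              basis := ![dX, vfield (fun _ _ _ => 2) (fun _ _ _ => 0) (fun _ _ u => -u)] })
      hp hd (contDiff_const.mul Real.contDiff_exp).contDiffOn
      (contDiff_const.mul (Real.contDiff_exp.comp (contDiff_id.div_const 2))).contDiffOn
      (fun t ht => trivial)
      (fun t ht => by rw [hf t ht, add_zero]; field_simp)
      (fun t ht => by
        have e : (p ^ 3 * G t + 0) / 2 = p ^ 3 / 2 * G t := by ring
        dsimp only
        rw [hk t ht, hf t ht, hm', e]
        field_simp
        ring)
    exact ⟨I', E', h1, h2, T, h3⟩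
  | lin l m μ hl hμ hf hk =>
    obtain ⟨I', E', h1, h2, T, -, h3⟩ := exists_equiv_rowIII hI hG hμ hf hk
    exact ⟨.III, _, ⟨_, div_ne_zero hl (pow_ne_zero 2 hμ), rfl⟩, I', E', h1, h2, T, h3⟩

end completeness

/-! ### Invariants of the equations with `g = 1` -/

section invariants

variable {I I' : Set ℝ} {E' : GardnerEq I'} {E : GardnerEq I}

/-- `f` is a multiple of a power of `|t - m|` with exponent `ρ`. -/
def GardnerEq.PowType (E : GardnerEq I) (ρ : ℝ) : Prop :=
  ∃ m, ∀ t ∈ I, (t - m) * deriv E.f t = ρ * E.f t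

/-- `f` is an exponential. -/
def GardnerEq.ExpType (E : GardnerEq I) : Prop :=
  ∃ ν, ν ≠ 0 ∧ ∀ t ∈ I, deriv E.f t = ν * E.f t

/-- The ratio `k / f` is constant. -/
def GardnerEq.RatioConst (E : GardnerEq I) : Prop := ∃ e, ∀ t ∈ I, E.k t = e * E.f t

/-- The ratio `k / f` is an affine function. -/
def GardnerEq.RatioAffine (E : GardnerEq I) : Prop :=
  ∃ e e', ∀ t ∈ I, E.k t = (e * t + e') * E.f t

theorem GardnerEq.RatioConst.ratioAffine (h : E.RatioConst) : E.RatioAffine := by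
  obtain ⟨e, he⟩ := h
  exact ⟨0, e, fun t ht => by rw [he t ht]; ring⟩

/-- Eliminating f' from the two relations leaves f times an affine function with slope ρ - ρ'. -/
theorem GardnerEq.PowType.unique (hI : IsOpenInterval I) {ρ ρ' : ℝ} (h : E.PowType ρ)
    (h' : E.PowType ρ') : ρ = ρ' := by
  obtain ⟨m, hm⟩ := h
  obtain ⟨m', hm'⟩ := h'
  have e : ∀ t ∈ I, (ρ - ρ') * t + (ρ' * m - ρ * m') = 0 := fun t ht => by
    refine (mul_eq_zero.1 (?_ : _ * E.f t = 0)).resolve_right (E.f_ne_zero ht)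
    linear_combination (t - m) * hm' t ht - (t - m') * hm t ht
  exact sub_eq_zero.1 (hI.coeff_eq_zero e).1

theorem GardnerEq.ExpType.not_powType (hI : IsOpenInterval I) (h : E.ExpType) {ρ : ℝ} :
    ¬ E.PowType ρ := by
  rintro ⟨m, hm⟩
  obtain ⟨ν, hν, h⟩ := h
  have e : ∀ t ∈ I, ν * t + (-(m * ν) - ρ) = 0 := fun t ht => by
    refine (mul_eq_zero.1 (?_ : _ * E.f t = 0)).resolve_right (E.f_ne_zero ht)
    linear_combination hm t ht - (t - m) * h t ht
  exact hν (hI.coeff_eq_zero e).1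

/-- The coefficients of `E'` arise from those of `E` by an affine change of time, scalings and
addition of a multiple of `f` to `k`. -/
structure AffineRelated (E : GardnerEq I) (E' : GardnerEq I') (A B C D N : ℝ) : Prop where
  A_ne_zero : A ≠ 0
  C_ne_zero : C ≠ 0
  D_ne_zero : D ≠ 0
  mapsTo : ∀ t ∈ I, A * t + B ∈ I'
  surj : ∀ s ∈ I', ∃ t ∈ I, s = A * t + B
  map_f : ∀ t ∈ I, E'.f (A * t + B) = C * E.f t
  map_k : ∀ t ∈ I, E'.k (A * t + B) = D * E.k t + N * E.f t

/-- Having g = 1 on both sides forces α' = δ₁³, so α is affine. The constant N records δ₃. -/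
theorem GenExtEquivalent.exists_affineRelated (hI : IsOpenInterval I) (h : GenExtEquivalent E E')
    (hg : ∀ t ∈ I, E.g t = 1) (hg' : ∀ t ∈ I', E'.g t = 1) :
    ∃ A B C D N, AffineRelated E E' A B C D N := by
  obtain ⟨T, hT⟩ := h
  have hmem : ∀ t ∈ I, T.α t ∈ I' := fun t ht => hT.bijOn.mapsTo (show (t, 0, 0) ∈ dom I from ht)
  have hd : ∀ t ∈ I, deriv T.α t = T.δ₁ ^ 3 := fun t ht => by
    have h1 := hT.map_g t ht
    rw [hg t ht, hg' _ (hmem t ht), mul_one, eq_comm, div_eq_one_iff_eq (T.deriv_α_ne_zero t ht)] at h1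
    exact h1.symm
  obtain ⟨t₀, ht₀⟩ := hI.nonempty
  have hα : ∀ t ∈ I, T.α t = T.δ₁ ^ 3 * t + (T.α t₀ - T.δ₁ ^ 3 * t₀) := fun t ht => by
    have := hI.eq_of_hasDerivAt_zero (F := fun t => T.α t - T.δ₁ ^ 3 * t) (fun s hs => by
      have h1 := T.smooth_α.hasDerivAt_of_isOpen hI.isOpen hs
      exact (h1.sub ((hasDerivAt_id s).const_mul (T.δ₁ ^ 3))).congr_deriv
        (by rw [hd s hs]; ring)) ht ht₀
    linear_combination this
  have h1 := T.δ₁_ne_zero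
  have h2 := T.δ₂_ne_zero
  refine ⟨T.δ₁ ^ 3, T.α t₀ - T.δ₁ ^ 3 * t₀, T.δ₁ / (T.δ₂ ^ 2 * T.δ₁ ^ 3),
    T.δ₁ / (T.δ₂ * T.δ₁ ^ 3), -(T.δ₁ / (T.δ₂ * T.δ₁ ^ 3) * (2 * (T.δ₃ / T.δ₂))),
    by positivity, by positivity, by positivity, fun t ht => ?_, fun s hs => ?_, fun t ht => ?_,
    fun t ht => ?_⟩
  · rw [← hα t ht]; exact hmem t ht
  · obtain ⟨z, hz, he⟩ := hT.bijOn.surjOn (show (s, 0, 0) ∈ dom I' from hs)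
    have he1 : T.α z.1 = s := congrArg Prod.fst he
    exact ⟨z.1, hz, by rw [← he1, hα _ hz]⟩
  · rw [← hα t ht, hT.map_f t ht, hd t ht]
  · rw [← hα t ht, hT.map_k t ht, hd t ht]; ring

namespace AffineRelated

variable {A B C D N : ℝ}

theorem deriv_f (hI : IsOpen I) (hI' : IsOpen I') (h : AffineRelated E E' A B C D N) {t : ℝ}
    (ht : t ∈ I) : A * deriv E'.f (A * t + B) = C * deriv E.f t := by
  have h1 := E'.smooth_f.hasDerivAt_of_isOpen hI' (h.mapsTo t ht)
  have h2 : HasDerivAt (fun t => A * t + B) A t := by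
    simpa using ((hasDerivAt_id t).const_mul A).add_const B
  have h3 : HasDerivAt (fun t => E'.f (A * t + B)) (deriv E'.f (A * t + B) * A) t :=
    HasDerivAt.comp t h1 h2
  have h4 := (E.smooth_f.hasDerivAt_of_isOpen hI ht).const_mul C
  have h5 : (fun t => E'.f (A * t + B)) =ᶠ[nhds t] fun t => C * E.f t :=
    Filter.eventuallyEq_of_mem (hI.mem_nhds ht) h.map_f
  rw [mul_comm]
  exact h3.unique (h4.congr_of_eventuallyEq h5)

theorem powType (hI : IsOpen I) (hI' : IsOpen I') (h : AffineRelated E E' A B C D N) {ρ : ℝ}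
    (h' : E'.PowType ρ) : E.PowType ρ := by
  obtain ⟨m, hm⟩ := h'
  refine ⟨(m - B) / A, fun t ht => mul_left_cancel₀ h.C_ne_zero ?_⟩
  have h1 := h.deriv_f hI hI' ht
  have h2 := hm _ (h.mapsTo t ht)
  rw [h.map_f t ht] at h2
  have := h.A_ne_zero
  have h3 : t - (m - B) / A = (A * t + B - m) / A := by field_simp; ring
  rw [h3]
  calc C * ((A * t + B - m) / A * deriv E.f t)
      = (A * t + B - m) / A * (C * deriv E.f t) := by ring
    _ = (A * t + B - m) * deriv E'.f (A * t + B) := by rw [← h1]; field_simp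
    _ = C * (ρ * E.f t) := by rw [h2]; ring

theorem expType (hI : IsOpen I) (hI' : IsOpen I') (h : AffineRelated E E' A B C D N)
    (h' : E'.ExpType) : E.ExpType := by
  obtain ⟨ν, hν, h'⟩ := h'
  refine ⟨A * ν, mul_ne_zero h.A_ne_zero hν, fun t ht => mul_left_cancel₀ h.C_ne_zero ?_⟩
  rw [← h.deriv_f hI hI' ht, h' _ (h.mapsTo t ht), h.map_f t ht]
  ring

theorem ratioConst_iff (h : AffineRelated E E' A B C D N) : E'.RatioConst ↔ E.RatioConst := by
  have hC := h.C_ne_zero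
  have hD := h.D_ne_zero
  constructor
  · rintro ⟨e, he⟩
    refine ⟨(e * C - N) / D, fun t ht => mul_left_cancel₀ hD ?_⟩
    have h1 := he _ (h.mapsTo t ht)
    rw [h.map_k t ht, h.map_f t ht] at h1
    field_simp
    linear_combination h1
  · rintro ⟨e, he⟩
    refine ⟨(D * e + N) / C, fun s hs => ?_⟩
    obtain ⟨t, ht, rfl⟩ := h.surj s hs
    rw [h.map_k t ht, h.map_f t ht, he t ht]
    field_simp

theorem ratioAffine_iff (h : AffineRelated E E' A B C D N) : E'.RatioAffine ↔ E.RatioAffine := by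
  have hA := h.A_ne_zero
  have hC := h.C_ne_zero
  have hD := h.D_ne_zero
  constructor
  · rintro ⟨e, e', he⟩
    refine ⟨e * A * C / D, ((e * B + e') * C - N) / D, fun t ht => mul_left_cancel₀ hD ?_⟩
    have h1 := he _ (h.mapsTo t ht)
    rw [h.map_k t ht, h.map_f t ht] at h1
    field_simp
    linear_combination h1
  · rintro ⟨e, e', he⟩
    refine ⟨D * e / (A * C), (D * (e' - e * B / A) + N) / C, fun s hs => ?_⟩
    obtain ⟨t, ht, rfl⟩ := h.surj s hs
    rw [h.map_k t ht, h.map_f t ht, he t ht]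
    field_simp
    ring

end AffineRelated

/-! ### Inequivalence of different cases -/

/-- Invariant characterization of the cases of the first table. -/
def Case1.Holds (E : GardnerEq I) : Case1 → Prop
  | .I1 => ∃ ρ, E.PowType ρ ∧ ρ ≠ -(4 / 3) ∧ ρ ≠ -1 ∧ (ρ = -(2 / 3) → E.RatioConst) ∧
      (ρ = 0 → ¬ E.RatioAffine)
  | .I2 => E.PowType (-(2 / 3)) ∧ ¬ E.RatioConst
  | .I3 => E.PowType (-1)
  | .I4 => E.PowType (-(4 / 3))
  | .II => E.ExpType
  | .III => E.PowType 0 ∧ ¬ E.RatioConst ∧ E.RatioAffine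
  | .IV => E.PowType 0 ∧ E.RatioConst

/-- Invariant characterization of the cases of the second table. -/
def Case2.Holds (E : GardnerEq I) : Case2 → Prop
  | .I1 => ∃ ρ, E.PowType ρ ∧ (ρ = -(2 / 3) → E.RatioConst) ∧ (ρ = 0 → ¬ E.RatioAffine)
  | .I2 => E.PowType (-(2 / 3)) ∧ ¬ E.RatioConst
  | .II => E.ExpType
  | .III => E.PowType 0 ∧ ¬ E.RatioConst ∧ E.RatioAffine
  | .IV => E.PowType 0 ∧ E.RatioConst

theorem AffineRelated.holds1 {A B C D N : ℝ} (hI : IsOpen I) (hI' : IsOpen I')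
    (h : AffineRelated E E' A B C D N) {ca : Case1} (h' : ca.Holds E') : ca.Holds E := by
  have hp := fun ρ => h.powType hI hI' (ρ := ρ)
  cases ca with
  | I1 =>
    obtain ⟨ρ, h1, h2, h3, h4, h5⟩ := h'
    exact ⟨ρ, hp ρ h1, h2, h3, fun e => h.ratioConst_iff.1 (h4 e),
      fun e he => h5 e (h.ratioAffine_iff.2 he)⟩
  | I2 => exact ⟨hp _ h'.1, fun e => h'.2 (h.ratioConst_iff.2 e)⟩
  | I3 => exact hp _ h'
  | I4 => exact hp _ h'
  | II => exact h.expType hI hI' h'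
  | III => exact ⟨hp _ h'.1, fun e => h'.2.1 (h.ratioConst_iff.2 e), h.ratioAffine_iff.1 h'.2.2⟩
  | IV => exact ⟨hp _ h'.1, h.ratioConst_iff.1 h'.2⟩

theorem AffineRelated.holds2 {A B C D N : ℝ} (hI : IsOpen I) (hI' : IsOpen I')
    (h : AffineRelated E E' A B C D N) {ca : Case2} (h' : ca.Holds E') : ca.Holds E := by
  have hp := fun ρ => h.powType hI hI' (ρ := ρ)
  cases ca with
  | I1 =>
    obtain ⟨ρ, h1, h4, h5⟩ := h'
    exact ⟨ρ, hp ρ h1, fun e => h.ratioConst_iff.1 (h4 e),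
      fun e he => h5 e (h.ratioAffine_iff.2 he)⟩
  | I2 => exact ⟨hp _ h'.1, fun e => h'.2 (h.ratioConst_iff.2 e)⟩
  | II => exact h.expType hI hI' h'
  | III => exact ⟨hp _ h'.1, fun e => h'.2.1 (h.ratioConst_iff.2 e), h.ratioAffine_iff.1 h'.2.2⟩
  | IV => exact ⟨hp _ h'.1, h.ratioConst_iff.1 h'.2⟩

/-- The exponent of f is unique and an exponential is not of power type. Where exponents agree, at
-2/3 and 0, the conditions on k/f exclude one another. -/
theorem Case1.Holds.unique (hI : IsOpenInterval I) {c c' : Case1} (h : c.Holds E)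
    (h' : c'.Holds E) : c = c' := by
  have hu := fun ρ ρ' (h : E.PowType ρ) (h' : E.PowType ρ') => h.unique hI h'
  have he := fun ρ (h : E.ExpType) => h.not_powType hI (ρ := ρ)
  have hr := GardnerEq.RatioConst.ratioAffine (E := E)
  cases c <;> cases c' <;> simp only [Case1.Holds] at h h' <;> grind

theorem Case2.Holds.unique (hI : IsOpenInterval I) {c c' : Case2} (h : c.Holds E)
    (h' : c'.Holds E) : c = c' := by
  have hu := fun ρ ρ' (h : E.PowType ρ) (h' : E.PowType ρ') => h.unique hI h'
  have he := fun ρ (h : E.ExpType) => h.not_powType hI (ρ := ρ)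
  have hr := GardnerEq.RatioConst.ratioAffine (E := E)
  cases c <;> cases c' <;> simp only [Case2.Holds] at h h' <;> grind

/-! ### The rows of the tables satisfy their invariant characterizations. -/

variable {l₁ l₂ μ ρ : ℝ}

theorem powType_of_rpow (hI : IsOpen I) (hpos : I ⊆ Set.Ioi 0)
    (hf : ∀ t ∈ I, E.f t = l₁ * t ^ ρ) : E.PowType ρ := by
  refine ⟨0, fun t ht => ?_⟩
  have h0 : 0 < t := hpos ht
  rw [deriv_eq_of_eqOn hI hf (hasDerivAt_const_mul_rpow hpos) ht, hf t ht]
  field_simp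
  ring

theorem powType_of_const (hI : IsOpen I) (hf : ∀ t ∈ I, E.f t = l₁) : E.PowType 0 :=
  ⟨0, fun t ht => by
    rw [deriv_eq_of_eqOn hI hf (K' := fun _ => 0) (fun t _ => hasDerivAt_const t l₁) ht]; ring⟩

/-- At ρ = -2/3 both exponents in k equal ρ. This separates the power rows from the logarithmic one.
-/
theorem ratioConst_of_rpow (hl : l₁ ≠ 0) (hρ : ρ = -(2 / 3)) (hf : ∀ t ∈ I, E.f t = l₁ * t ^ ρ)
    (hk : ∀ t ∈ I, E.k t = l₂ * t ^ ((3 * ρ - 2) / 6) + μ * t ^ ρ) : E.RatioConst := by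
  refine ⟨(l₂ + μ) / l₁, fun t ht => ?_⟩
  rw [hk t ht, hf t ht, show (3 * ρ - 2) / 6 = ρ by linarith]
  field_simp

/-- Otherwise y = t^(-1/3) would be affine on I, y = mt + n. Then t y' = -y/3 gives 4mt + n = 0, so
m = n = 0, contradicting y > 0. -/
theorem not_ratioAffine_of_rpow (hI : IsOpenInterval I) (hpos : I ⊆ Set.Ioi 0) (hρ : ρ = 0)
    (hl : l₂ ≠ 0) (hf : ∀ t ∈ I, E.f t = l₁ * t ^ ρ)
    (hk : ∀ t ∈ I, E.k t = l₂ * t ^ ((3 * ρ - 2) / 6) + μ * t ^ ρ) : ¬ E.RatioAffine := by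
  rintro ⟨e, e', he⟩
  set r : ℝ := (3 * ρ - 2) / 6 with hr
  have hr' : r = -(1 / 3) := by rw [hr, hρ]; norm_num
  have hy : ∀ t ∈ I, t ^ r = e * l₁ / l₂ * t + (e' * l₁ - μ) / l₂ := fun t ht => by
    have := he t ht
    rw [hk t ht, hf t ht, hρ, Real.rpow_zero] at this
    field_simp
    linear_combination this
  have hd : ∀ t ∈ I, r * (t ^ r / t) = e * l₁ / l₂ := fun t ht => by
    rw [← deriv_eq_of_eqOn hI.isOpen hy (K' := fun _ => e * l₁ / l₂) (fun t _ => by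
      simpa using ((hasDerivAt_id t).const_mul (e * l₁ / l₂)).add_const ((e' * l₁ - μ) / l₂)) ht]
    exact (hasDerivAt_rpow_of_pos r (hpos ht)).deriv.symm
  have hz : ∀ t ∈ I, 4 * (e * l₁ / l₂) * t + (e' * l₁ - μ) / l₂ = 0 := fun t ht => by
    have h0 : 0 < t := hpos ht
    have h1 := hd t ht
    have h2 : r * t ^ r = e * l₁ / l₂ * t := by
      rw [← h1]; field_simp
    have h3 := hy t ht
    rw [hr'] at h2 h3
    linear_combination -3 * h2 - h3
  obtain ⟨h1, h2⟩ := hI.coeff_eq_zero hz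
  obtain ⟨t, ht⟩ := hI.nonempty
  have h3 := hy t ht
  rw [h2, (mul_eq_zero.1 h1).resolve_left four_ne_zero, zero_mul, zero_add] at h3
  exact (Real.rpow_pos_of_pos (hpos ht) r).ne' h3

theorem not_ratioConst_rowI2 (hI : IsOpenInterval I) (h : E.IsOfForm (rowI2 l₁)) :
    ¬ E.RatioConst := by
  rintro ⟨e, he⟩
  have hlog : ∀ t ∈ I, Real.log t = e * l₁ := fun t ht => by
    have h0 : 0 < t := h.subset ht
    have h1 := he t ht
    rw [h.k_eq t ht, h.f_eq t ht] at h1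
    simp only [rowI2, Real.log_abs] at h1
    refine mul_left_cancel₀ (Real.rpow_pos_of_pos h0 (-(2 / 3))).ne' ?_
    linear_combination h1
  obtain ⟨s, hs, t, ht, hst⟩ := hI.exists_ne
  exact (Real.log_lt_log (h.subset hs) hst).ne ((hlog s hs).trans (hlog t ht).symm)

theorem ratio_rowIII (hI : IsOpenInterval I) (hl : l₁ ≠ 0) (h : E.IsOfForm (rowIII l₁)) :
    ¬ E.RatioConst ∧ E.RatioAffine := by
  constructor
  · rintro ⟨e, he⟩
    have hz : ∀ t ∈ I, 1 * t + -(e * l₁) = 0 := fun t ht => by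
      have h1 := he t ht
      rw [h.k_eq t ht, h.f_eq t ht] at h1
      simp only [rowIII] at h1
      linear_combination h1
    exact one_ne_zero (hI.coeff_eq_zero hz).1
  · refine ⟨1 / l₁, 0, fun t ht => ?_⟩
    rw [h.k_eq t ht, h.f_eq t ht]
    simp only [rowIII]
    field_simp
    ring

theorem ratioConst_of_const (hl : l₁ ≠ 0) (hf : ∀ t ∈ I, E.f t = l₁) (hk : ∀ t ∈ I, E.k t = μ) :
    E.RatioConst :=
  ⟨μ / l₁, fun t ht => by rw [hf t ht, hk t ht]; field_simp⟩

theorem expType_of_exp (hI : IsOpen I) (hf : ∀ t ∈ I, E.f t = l₁ * Real.exp t) : E.ExpType :=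
  ⟨1, one_ne_zero, fun t ht => by
    rw [deriv_eq_of_eqOn hI hf (fun t _ => (Real.hasDerivAt_exp t).const_mul l₁) ht, hf t ht]; ring⟩

theorem holds_of_mem_table1 (hI : IsOpenInterval I) {ca : Case1} {r : Row} (hr : r ∈ table1 ca)
    (h : E.IsOfForm r) : ca.Holds E := by
  cases ca with
  | I1 =>
    obtain ⟨l₁, l₂, ρ, δ, ϰ, hl, h4, h1, -, hne, -, rfl⟩ := hr
    exact ⟨ρ, powType_of_rpow hI.isOpen h.subset h.f_eq, h4, h1,
      fun e => ratioConst_of_rpow hl e h.f_eq h.k_eq,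
      fun e => not_ratioAffine_of_rpow hI h.subset e (fun h2 => hne (Prod.ext e h2)) h.f_eq h.k_eq⟩
  | I2 =>
    obtain ⟨l₁, hl, rfl⟩ := hr
    exact ⟨powType_of_rpow hI.isOpen h.subset h.f_eq, not_ratioConst_rowI2 hI h⟩
  | I3 =>
    obtain ⟨l₁, l₂, δ, ϰ, hl, -, -, rfl⟩ := hr
    exact powType_of_rpow hI.isOpen h.subset h.f_eq
  | I4 =>
    obtain ⟨l₁, l₂, δ, ϰ, hl, -, -, rfl⟩ := hr
    exact powType_of_rpow hI.isOpen h.subset h.f_eq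
  | II =>
    obtain ⟨l₁, l₂, δ, ϰ, hl, -, -, rfl⟩ := hr
    exact expType_of_exp hI.isOpen h.f_eq
  | III =>
    obtain ⟨l₁, hl, rfl⟩ := hr
    exact ⟨powType_of_const hI.isOpen h.f_eq, ratio_rowIII hI hl h⟩
  | IV =>
    obtain ⟨ε, δ, ϰ, hε, -, -, rfl⟩ := hr
    have hl : ε ≠ 0 := by rcases hε with rfl | rfl <;> norm_num
    exact ⟨powType_of_const hI.isOpen h.f_eq, ratioConst_of_const hl h.f_eq h.k_eq⟩

theorem holds_of_mem_table2 (hI : IsOpenInterval I) {ca : Case2} {r : Row} (hr : r ∈ table2 ca)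
    (h : E.IsOfForm r) : ca.Holds E := by
  cases ca with
  | I1 =>
    obtain ⟨l₁, ρ, δ, hl, -, hne, rfl⟩ := hr
    have hk : ∀ t ∈ I, E.k t = δ * t ^ ((3 * ρ - 2) / 6) + 0 * t ^ ρ := fun t ht => by
      rw [h.k_eq t ht]; ring
    exact ⟨ρ, powType_of_rpow hI.isOpen h.subset h.f_eq,
      fun e => ratioConst_of_rpow hl e h.f_eq hk,
      fun e => not_ratioAffine_of_rpow hI h.subset e (fun h2 => hne (Prod.ext e h2)) h.f_eq hk⟩
  | I2 =>
    obtain ⟨l₁, hl, rfl⟩ := hr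
    exact ⟨powType_of_rpow hI.isOpen h.subset h.f_eq, not_ratioConst_rowI2 hI h⟩
  | II =>
    obtain ⟨l₁, δ, hl, -, rfl⟩ := hr
    exact expType_of_exp hI.isOpen h.f_eq
  | III =>
    obtain ⟨l₁, hl, rfl⟩ := hr
    exact ⟨powType_of_const hI.isOpen h.f_eq, ratio_rowIII hI hl h⟩
  | IV =>
    obtain ⟨ε, hε, rfl⟩ := hr
    have hl : ε ≠ 0 := by rcases hε with rfl | rfl <;> norm_num
    exact ⟨powType_of_const hI.isOpen h.f_eq, ratioConst_of_const hl h.f_eq h.k_eq⟩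

end invariants

end Gardner

end

/-! ### Assembly of the classification theorem. -/

open Gardner in
theorem theorem3 :
    -- the kernel of the maximal Lie invariance algebras is spanned by `∂_x`
    (∀ I : Set ℝ, IsOpenInterval I →
      kernelAlgebra I = (Submodule.span ℝ {restrictTo I dX} : Submodule ℝ (dom I → Pt))) ∧
    -- first table: the listed algebras are the maximal ones and are extensions of the kernel
    (∀ (c : Case1) (r : Row), r ∈ table1 c → ∀ I : Set ℝ, IsOpenInterval I →
      ∀ E : GardnerEq I, E.IsOfForm r → E.IsBasisOfMaxAlgebra r.basis ∧ E.HasExtension) ∧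
    -- first table: all extensions are listed, up to the usual equivalence group
    (∀ I : Set ℝ, IsOpenInterval I → ∀ E : GardnerEq I, E.HasExtension →
      ∃ (c : Case1) (r : Row) (I' : Set ℝ) (E' : GardnerEq I'),
        r ∈ table1 c ∧ IsOpenInterval I' ∧ E'.IsOfForm r ∧ UsualEquivalent E E') ∧
    -- first table: different cases are inequivalent
    (∀ (c c' : Case1) (r r' : Row), c ≠ c' → r ∈ table1 c → r' ∈ table1 c' →
      ∀ I I' : Set ℝ, IsOpenInterval I → IsOpenInterval I' →
      ∀ (E : GardnerEq I) (E' : GardnerEq I'), E.IsOfForm r → E'.IsOfForm r' →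
        ¬ UsualEquivalent E E') ∧
    -- second table: the listed algebras are the maximal ones and are extensions of the kernel
    (∀ (c : Case2) (r : Row), r ∈ table2 c → ∀ I : Set ℝ, IsOpenInterval I →
      ∀ E : GardnerEq I, E.IsOfForm r → E.IsBasisOfMaxAlgebra r.basis ∧ E.HasExtension) ∧
    -- second table: all extensions are listed, up to the generalized extended equivalence group
    (∀ I : Set ℝ, IsOpenInterval I → ∀ E : GardnerEq I, E.HasExtension →
      ∃ (c : Case2) (r : Row) (I' : Set ℝ) (E' : GardnerEq I'),
        r ∈ table2 c ∧ IsOpenInterval I' ∧ E'.IsOfForm r ∧ GenExtEquivalent E E') ∧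
    -- second table: different cases are inequivalent
    (∀ (c c' : Case2) (r r' : Row), c ≠ c' → r ∈ table2 c → r' ∈ table2 c' →
      ∀ I I' : Set ℝ, IsOpenInterval I → IsOpenInterval I' →
      ∀ (E : GardnerEq I) (E' : GardnerEq I'), E.IsOfForm r → E'.IsOfForm r' →
        ¬ GenExtEquivalent E E') := by
  refine ⟨fun I hI => kernelAlgebra_eq hI, fun c r hr I hI E h => isBasis_of_mem_table1 hr hI h,
    fun I hI E h => ?_, ?_, fun c r hr I hI E h => isBasis_of_mem_table2 hr hI h,
    fun I hI E h => ?_, ?_⟩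
  · obtain ⟨G, hG, hn⟩ := h.exists_normalForm hI
    obtain ⟨c, r, hr, I', E', h1, h2, h3⟩ := exists_table1_of_normalForm hI hG hn
    exact ⟨c, r, I', E', hr, h1, h2, h3⟩
  -- The condition δ₃ = 0 can be dropped: the cases of the first table are inequivalent even under
  -- the larger group.
  · intro c c' r r' hne hr hr' I I' hI hI' E E' h h' ⟨T, _, hT⟩
    have hE : GenExtEquivalent E E' := ⟨T, hT⟩
    obtain ⟨A, B, C, D, N, hA⟩ := hE.exists_affineRelated hI h.g_eq h'.g_eq
    exact hne ((holds_of_mem_table1 hI hr h).unique hI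
      (hA.holds1 hI.isOpen hI'.isOpen (holds_of_mem_table1 hI' hr' h')))
  · obtain ⟨G, hG, hn⟩ := h.exists_normalForm hI
    obtain ⟨c, r, hr, I', E', h1, h2, h3⟩ := exists_table2_of_normalForm hI hG hn
    exact ⟨c, r, I', E', hr, h1, h2, h3⟩
  · intro c c' r r' hne hr hr' I I' hI hI' E E' h h' hE
    obtain ⟨A, B, C, D, N, hA⟩ := hE.exists_affineRelated hI h.g_eq h'.g_eq
    exact hne ((holds_of_mem_table2 hI hr h).unique hI
      (hA.holds2 hI.isOpen hI'.isOpen (holds_of_mem_table2 hI' hr' h')))
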